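/- Let $h(x)=-x\log_2x-(1-x)\log_2(1-x)$, let $h^{-1}:[0,1]\to[0,\frac12]$ be its inverse branch, let $0<R<1$ and $\tau=\delta_{\mathrm{GV}}(R)=h^{-1}(1-R)$. For $x,\omega\in[0,\frac12]$ (and also for $x\in[0,1]$ if $\omega=\frac12$) put $\omega^\perp=\frac12-\sqrt{\omega(1-\omega)}$, $D=(1-2x)^2-4\omega(1-\omega)$, $z=\frac{1-2x-\sqrt D}{2(1-\omega)}$ and $$\tilde\delta(x,\omega)=\begin{cases}2\bigl(x\log_2(1-z)+(1-x)\log_2(1+z)-\omega\log_2z-h(\omega)\bigr)&\text{if }0\le x\le\omega^\perp,\\1-h(x)-h(\omega)&\text{otherwise}\end{cases}$$ (with $0\log_2 0=0$). **The decoder.** Let $C$ be the binary code of length $n$ with a uniformly random $(n-k)\times n$ parity-check matrix, and let $y=c+e$ with $c\in C$. The decoder has integer parameters $s,\ell,u_1,u_2,w_1,w_2,N_{\mathrm{iter}}\ge0$ with $s+\ell\le k$. Each of its $N_{\mathrm{iter}}$ iterations does the following. (1) Cut the $n$ positions uniformly at random into $\mathscr P,\mathscr N_1,\mathscr N_2$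 of sizes $s$, $k-\ell-s$, $n-k+\ell$, and $\mathscr N_2$ into two halves (up to rounding). (2) Dumer's collision search: list all words of weight $w_2/2$ on each half of $\mathscr N_2$ (weights rounded down and up respectively), write down all $h\in C^\perp$ whose restriction to $\mathscr N_2$ is the sum of an element of each list, and keep those of weight $w_1$ on $\mathscr N_1$. This costs the sizes of the two lists plus the number of collisions. (3) Each kept $h$ is an LPN sample $(h_{\mathscr P},\langle y,h\rangle)$ for the secret $e_{\mathscr P}$. By a fast Fourier transform over $\mathbb F_2^s$ compute the correlation of all $x\in\mathbb F_2^s$ with the samples, and accept the best $x$ as $e_{\mathscr P}$ if its correlation is at least half of the one expected for $e_{\mathscr P}$. Let $\delta=\delta_1\delta_2$, where $\delta_i$ is the bias $\mathbb P(\langle e',h'\rangle=0)-\mathbb P(\langle e',h'\rangle=1)$ for a word $e'$ of weight $u_i$ on $\mathscr N_i$ and $h'$ uniform among the words of weight $w_i$ on $\mathscr N_i$. Let $N$ be the expected number of parity-checks kept in an iteration, and $P_{\mathrm{succ}}$ the probability that $e$ has weights $u_1$ on $\mathscr N_1$ and $u_2$ on $\mathscr N_2$. A choice of parameters as functions of $n$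 is *admissible* if, as $n\to\infty$, $s=\omega(1)$, $N=\omega(n/\delta^2)$ (in particular $\delta\ne0$) and $N_{\mathrm{iter}}=\omega(1/P_{\mathrm{succ}})$. The running time $T$ is the expected number of steps (operations on words of length $n$ or on numbers) of all iterations, in the worst case over $y$. **The exponent.** For $(\sigma,\nu_1,\nu_2,\lambda,\omega_1,\omega_2)$ let $$\nu=\max\Bigl(\tfrac{1-R+\lambda}{2}h\bigl(\tfrac{\omega_2}{1-R+\lambda}\bigr),\,(1-R+\lambda)h\bigl(\tfrac{\omega_2}{1-R+\lambda}\bigr)-\lambda\Bigr),$$ $$\pi=1-R-\sigma h\bigl(\tfrac{\tau-\nu_1-\nu_2}{\sigma}\bigr)-(R-\lambda-\sigma)h\bigl(\tfrac{\nu_1}{R-\lambda-\sigma}\bigr)-(1-R+\lambda)h\bigl(\tfrac{\nu_2}{1-R+\lambda}\bigr),$$ $$\beta=\max(\sigma,\nu)+\pi,$$ where a product $a\,g(\cdot/a)$ means $0$ if $a=0$. Let $\mathscr R$ be the set of nonnegative tuples with $$\sigma\le R-\lambda,\quad\nu_1\le R-\lambda-\sigma,\quad\nu_2\le1-R+\lambda,\quad\tau-\sigma\le\nu_1+\nu_2\le\tau,\quad\omega_1=\tfrac{R-\lambda-\sigma}2,\quad\omega_2\le\tfrac{1-R+\lambda}2,$$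 $$(1-R+\lambda)h\bigl(\tfrac{\omega_2}{1-R+\lambda}\bigr)-\lambda=-(R-\lambda-\sigma)\,\tilde\delta\bigl(\tfrac{\nu_1}{R-\lambda-\sigma},\tfrac{\omega_1}{R-\lambda-\sigma}\bigr)-(1-R+\lambda)\,\tilde\delta\bigl(\tfrac{\nu_2}{1-R+\lambda},\tfrac{\omega_2}{1-R+\lambda}\bigr).$$ **Proposition.** The minimum $\alpha_{\mathrm{Dumer89}}(R)=\min_{\mathscr R}\beta$ exists, and it is the asymptotic complexity exponent of the decoder at the Gilbert–Varshamov distance: for all dimensions $k_n\le n$ and all errors $e_n\in\mathbb F_2^n$ with $k_n/n\to R$ and $|e_n|/n\to\delta_{\mathrm{GV}}(R)$, some admissible choice of the parameters has $\frac1n\log_2T\to\alpha_{\mathrm{Dumer89}}(R)$, and every admissible choice has $\liminf_n\frac1n\log_2T\ge\alpha_{\mathrm{Dumer89}}(R)$. -/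

import Mathlib

noncomputable section

namespace RLPN

/-! ### The exponents -/

/-- Binary entropy in bits, `h(x) = -x log₂ x - (1-x) log₂ (1-x)`. -/
def h (x : ℝ) : ℝ := Real.binEntropy x / Real.log 2

/-- Relative Gilbert–Varshamov distance `h⁻¹(1-R)`, with the branch of `h⁻¹` valued in `[0,1/2]`. -/
def deltaGV (R : ℝ) : ℝ := Function.invFunOn h (Set.Icc 0 (1 / 2)) (1 - R)

/-- `ω^⊥ = 1/2 - √(ω(1-ω))`. -/
def omegaPerp (ω : ℝ) : ℝ := 1 / 2 - Real.sqrt (ω * (1 - ω))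

/-- `z = (1 - 2τ - √D) / (2(1-ω))` with `D = (1-2τ)² - 4ω(1-ω)`. -/
def zKraw (τ ω : ℝ) : ℝ :=
  (1 - 2 * τ - Real.sqrt ((1 - 2 * τ) ^ 2 - 4 * ω * (1 - ω))) / (2 * (1 - ω))

open Classical in
/-- The exponent of the squared normalised Krawtchouk polynomial, for `τ, ω ∈ [0,1/2]`
(and also `τ ∈ [0,1]` when `ω = 1/2`). -/
def deltaTilde (τ ω : ℝ) : ℝ :=
  if 0 ≤ τ ∧ τ ≤ omegaPerp ω then
    2 * (τ * Real.logb 2 (1 - zKraw τ ω) + (1 - τ) * Real.logb 2 (1 + zKraw τ ω)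
      - ω * Real.logb 2 (zKraw τ ω) - h ω)
  else 1 - h τ - h ω

/-- A tuple `(σ, ν₁, ν₂, λ, ω₁, ω₂)`. -/
structure Rates where
  σ : ℝ
  ν₁ : ℝ
  ν₂ : ℝ
  lam : ℝ
  ω₁ : ℝ
  ω₂ : ℝ

/-- Exponent of the number of parity-checks found by the collision search. -/
def countExp (R : ℝ) (q : Rates) : ℝ :=
  (1 - R + q.lam) * h (q.ω₂ / (1 - R + q.lam)) - q.lam

/-- `ν(R,λ,ω₂)`: exponent of the cost of the collision search. -/
def nuExp (R : ℝ) (q : Rates) : ℝ :=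
  max ((1 - R + q.lam) / 2 * h (q.ω₂ / (1 - R + q.lam))) (countExp R q)

/-- `π(R,σ,ν₁,ν₂,λ)`: exponent of the inverse of the probability that the bet is right. -/
def piExp (R : ℝ) (q : Rates) : ℝ :=
  1 - R - q.σ * h ((deltaGV R - q.ν₁ - q.ν₂) / q.σ)
    - (R - q.lam - q.σ) * h (q.ν₁ / (R - q.lam - q.σ))
    - (1 - R + q.lam) * h (q.ν₂ / (1 - R + q.lam))

/-- `β = max(σ, ν) + π`. -/
def beta (R : ℝ) (q : Rates) : ℝ := max q.σ (nuExp R q) + piExp R q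

/-- The constraint region. The bound on `ω₂` keeps the second argument of `deltaTilde` in
`[0,1/2]`. Where `R - λ - σ = 0` (or `σ = 0`) the corresponding product is zero. -/
def region (R : ℝ) : Set Rates :=
  {q | 0 ≤ q.σ ∧ 0 ≤ q.ν₁ ∧ 0 ≤ q.ν₂ ∧ 0 ≤ q.lam ∧ 0 ≤ q.ω₁ ∧ 0 ≤ q.ω₂ ∧
    q.σ ≤ R - q.lam ∧ q.ν₁ ≤ R - q.lam - q.σ ∧ q.ν₂ ≤ 1 - R + q.lam ∧
    deltaGV R - q.σ ≤ q.ν₁ + q.ν₂ ∧ q.ν₁ + q.ν₂ ≤ deltaGV R ∧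
    q.ω₁ = (R - q.lam - q.σ) / 2 ∧ q.ω₂ ≤ (1 - R + q.lam) / 2 ∧
    countExp R q =
      -(R - q.lam - q.σ) *
          deltaTilde (q.ν₁ / (R - q.lam - q.σ)) (q.ω₁ / (R - q.lam - q.σ))
        - (1 - R + q.lam) *
          deltaTilde (q.ν₂ / (1 - R + q.lam)) (q.ω₂ / (1 - R + q.lam))}

/-- `α_Dumer89(R)`: the infimum of `β` over the region (that it is attained is part of the
theorem). -/
def alphaDumer89 (R : ℝ) : ℝ := sInf (beta R '' region R)

/-! ### The decoder -/

/-- The binary words of length `n`. -/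
abbrev Word (n : ℕ) : Type := Fin n → ZMod 2

/-- A parity-check matrix of a code of length `n` and (designed) dimension `k`. -/
abbrev PCMatrix (n k : ℕ) : Type := Matrix (Fin (n - k)) (Fin n) (ZMod 2)

/-- The result of a computation together with the number of elementary steps it took. An elementary
step is an operation on words of length `n` or on real numbers. -/
structure Counted (α : Type) where
  val : α
  steps : ℕ

/-- The code with parity-check matrix `H`. -/
def code {n k : ℕ} (H : PCMatrix n k) : Set (Word n) := {c | H.mulVec c = 0}

/-- The dual code: the parity-checks of `C`. -/
def dual {n : ℕ} (C : Set (Word n)) : Set (Word n) := {d | ∀ c ∈ C, dotProduct c d = 0}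

/-- The Hamming weight of `x` on the positions in `A`. -/
def weightOn {n : ℕ} (A : Finset (Fin n)) (x : Word n) : ℕ := {i ∈ A | x i ≠ 0}.card

/-- The sign `(-1)^b` of a bit. -/
def sgn (b : ZMod 2) : ℝ := if b = 0 then 1 else -1

/-- Bias of `⟨e, h'⟩` for a word `e` of length `m` and weight `u` (take `e = 1^u 0^(m-u)`) and `h'`
uniform among the words of length `m` and weight `w`. -/
def wordBias (m w u : ℕ) : ℝ :=
  (∑ x : Word m with hammingNorm x = w,
      sgn (dotProduct (fun i : Fin m => if (i : ℕ) < u then (1 : ZMod 2) else 0) x)) /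
    (({x : Word m | hammingNorm x = w} : Finset (Word m)).card : ℝ)

/-- Parameters of the decoder for codes of length `n` and dimension `k`. -/
structure Params (n k : ℕ) where
  /-- size of the secret part `P` -/
  s : ℕ
  /-- `N₂` has size `n - k + l` -/
  l : ℕ
  /-- bet on the weight of the error on `N₁` -/
  u₁ : ℕ
  /-- bet on the weight of the error on `N₂` -/
  u₂ : ℕ
  /-- weight of the parity-checks on `N₁` -/
  w₁ : ℕ
  /-- weight of the parity-checks on `N₂` -/
  w₂ : ℕ
  /-- number of iterations -/
  iter : ℕ
  size_le : s + l ≤ k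
  dim_le : k ≤ n

namespace Params

variable {n k : ℕ} (p : Params n k)

theorem s_le : p.s ≤ n := by
  have h1 := p.size_le
  have h2 := p.dim_le
  omega

/-- Size of `N₁`. -/
def m₁ : ℕ := k - p.l - p.s

/-- Size of `N₂`. -/
def m₂ : ℕ := n - k + p.l

/-- The estimated bias `δ = δ₁ δ₂`. -/
def bias : ℝ := wordBias p.m₁ p.w₁ p.u₁ * wordBias p.m₂ p.w₂ p.u₂

/-! A permutation of the positions cuts them into `P`, `N₁` and the halves `N₂ᵃ`, `N₂ᵇ` of `N₂`, of
respective sizes `s`, `m₁`, `⌊m₂/2⌋`, `⌈m₂/2⌉`. -/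

/-- The positions of `N₁`. -/
def setN₁ (perm : Equiv.Perm (Fin n)) : Finset (Fin n) :=
  {i | p.s ≤ (perm i : ℕ) ∧ (perm i : ℕ) < p.s + p.m₁}

/-- The first half of `N₂`. -/
def setN₂a (perm : Equiv.Perm (Fin n)) : Finset (Fin n) :=
  {i | p.s + p.m₁ ≤ (perm i : ℕ) ∧ (perm i : ℕ) < p.s + p.m₁ + p.m₂ / 2}

/-- The second half of `N₂`. -/
def setN₂b (perm : Equiv.Perm (Fin n)) : Finset (Fin n) :=
  {i | p.s + p.m₁ + p.m₂ / 2 ≤ (perm i : ℕ)}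

/-- The positions of `N₂`. -/
def setN₂ (perm : Equiv.Perm (Fin n)) : Finset (Fin n) := p.setN₂a perm ∪ p.setN₂b perm

/-- The restriction of a word to `P`. -/
def restrictP (perm : Equiv.Perm (Fin n)) (x : Word n) : Word p.s :=
  fun j => x (perm.symm (Fin.castLE p.s_le j))

/-- The word equal to `x` on `P` and zero elsewhere. -/
def extendP (perm : Equiv.Perm (Fin n)) (x : Word p.s) : Word n :=
  fun i => if hi : (perm i : ℕ) < p.s then x ⟨perm i, hi⟩ else 0

/-- First list of the collision search: the words of weight `⌊w₂/2⌋` supported by `N₂ᵃ`. -/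
def list₁ (perm : Equiv.Perm (Fin n)) : Finset (Word n) :=
  {x | (∀ i, i ∉ p.setN₂a perm → x i = 0) ∧ hammingNorm x = p.w₂ / 2}

/-- Second list of the collision search: the words of weight `⌈w₂/2⌉` supported by `N₂ᵇ`. -/
def list₂ (perm : Equiv.Perm (Fin n)) : Finset (Word n) :=
  {x | (∀ i, i ∉ p.setN₂b perm → x i = 0) ∧ hammingNorm x = p.w₂ - p.w₂ / 2}

open Classical in
/-- The collisions: the parity-checks whose restriction to `N₂` is `h₁ + h₂` with `h₁` in the first
and `h₂` in the second list, i.e. such that `h₁ + h₂` lies in the dual code punctured to `N₂`. -/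
def merged (H : PCMatrix n k) (perm : Equiv.Perm (Fin n)) : Finset (Word n) :=
  {d | d ∈ dual (code H) ∧
    ∃ x₁ ∈ p.list₁ perm, ∃ x₂ ∈ p.list₂ perm, ∀ i ∈ p.setN₂ perm, d i = x₁ i + x₂ i}

/-- Dumer's generator of parity-checks of weights `w₁` on `N₁` and `w₂` on `N₂`: store the first
list in a table addressed by syndromes, look up each element of the second list, write down each
collision, and keep the collisions of weight `w₁` on `N₁`. -/
def create (H : PCMatrix n k) (perm : Equiv.Perm (Fin n)) : Counted (Finset (Word n)) where
  val := {d ∈ p.merged H perm | weightOn (p.setN₁ perm) d = p.w₁}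
  steps := (p.list₁ perm).card + (p.list₂ perm).card + (p.merged H perm).card

end Params

/-- Fast Fourier transform over `F₂^s`: `f ↦ (x ↦ ∑ₐ f(a) (-1)^⟨x,a⟩)`. -/
def fft : (s : ℕ) → (Word s → ℝ) → Counted (Word s → ℝ)
  | 0, f => ⟨f, 1⟩
  | s + 1, f =>
    let g₀ := fft s fun a => f (Fin.cons 0 a)
    let g₁ := fft s fun a => f (Fin.cons 1 a)
    ⟨fun x => g₀.val (Fin.tail x) + sgn (x 0) * g₁.val (Fin.tail x),
      g₀.steps + g₁.steps + 2 ^ (s + 1)⟩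

/-- A point where a function on words is maximal. -/
def argmax {s : ℕ} (F : Word s → ℝ) : Word s := (Finite.exists_max F).choose

namespace Params

variable {n k : ℕ} (p : Params n k)

open Classical in
/-- One iteration: create parity-checks, Fourier transform the LPN samples
`(h_P, ⟨y,h⟩)`, and accept the most likely secret `x₀` if its score is at least half of what is
expected of `e_P`. The score is multiplied by `δ`, so that negative biases are also covered. -/
def iteration (H : PCMatrix n k) (y : Word n) (perm : Equiv.Perm (Fin n)) :
    Counted (Option (Word n)) :=
  let checks := p.create H perm
  let F := fft p.s fun a =>
    p.bias * ∑ d ∈ checks.val with p.restrictP perm d = a, sgn (dotProduct y d)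
  let x₀ := argmax F.val
  ⟨if p.bias ^ 2 * (checks.val.card : ℝ) / 2 ≤ F.val x₀ then some (p.extendP perm x₀) else none,
    checks.steps + checks.val.card + F.steps + 2 ^ p.s⟩

/-- The decoder: `iter` iterations, each with its own permutation; it returns the first accepted
candidate for the error on `P`. The steps are those of all iterations. -/
def decode (H : PCMatrix n k) (y : Word n) (coins : Fin p.iter → Equiv.Perm (Fin n)) :
    Counted (Option (Word n)) where
  val := (List.ofFn fun j => (p.iteration H y (coins j)).val).findSome? id
  steps := ∑ j, (p.iteration H y (coins j)).steps

/-- Running time: worst case over the received word, average over the uniformly random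
parity-check matrix of the code and the random choices of the decoder. -/
def time : ℝ :=
  ⨆ y : Word n,
    (∑ H : PCMatrix n k, ∑ coins : Fin p.iter → Equiv.Perm (Fin n),
        ((p.decode H y coins).steps : ℝ)) /
      (Fintype.card (PCMatrix n k) * Fintype.card (Fin p.iter → Equiv.Perm (Fin n)) : ℝ)

/-- Expected number `N` of parity-checks available in an iteration. -/
def numChecks : ℝ :=
  (∑ H : PCMatrix n k, ∑ perm : Equiv.Perm (Fin n), ((p.create H perm).val.card : ℝ)) /
    (Fintype.card (PCMatrix n k) * Fintype.card (Equiv.Perm (Fin n)) : ℝ)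

/-- Probability that `e` has weight `u₁` on `N₁` and `u₂` on `N₂`. -/
def succProb (e : Word n) : ℝ :=
  (({perm : Equiv.Perm (Fin n) | weightOn (p.setN₁ perm) e = p.u₁ ∧
      weightOn (p.setN₂ perm) e = p.u₂} : Finset (Equiv.Perm (Fin n))).card : ℝ) /
    (Fintype.card (Equiv.Perm (Fin n)) : ℝ)

end Params

/-- The constraints on the parameters, for the errors `e n`:
`s = ω(1)`, `N = ω(n/δ²)` and `N_iter = ω(1/P_succ)`. -/
structure Admissible {k : ℕ → ℕ} (e : ∀ n, Word n) (p : ∀ n, Params n (k n)) : Prop where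
  secret : Filter.Tendsto (fun n => (p n).s) Filter.atTop Filter.atTop
  samples : Filter.Tendsto (fun n => (p n).numChecks * (p n).bias ^ 2 / (n : ℝ))
    Filter.atTop Filter.atTop
  bets : Filter.Tendsto (fun n => ((p n).iter : ℝ) * (p n).succProb (e n))
    Filter.atTop Filter.atTop

/-- `α` is the complexity exponent of the decoder: optimally chosen admissible parameters give
running time `2^(αn(1+o(1)))` and no admissible parameters give a smaller exponent. -/
def IsComplexityExponent (k : ℕ → ℕ) (e : ∀ n, Word n) (α : ℝ) : Prop :=
  (∃ p : ∀ n, Params n (k n), Admissible e p ∧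
    Filter.Tendsto (fun n : ℕ => Real.logb 2 (p n).time / n) Filter.atTop (nhds α)) ∧
  ∀ p : ∀ n, Params n (k n), Admissible e p →
    ∀ ε > 0, ∀ᶠ n : ℕ in Filter.atTop, α - ε ≤ Real.logb 2 (p n).time / n

end RLPN

end

noncomputable section

namespace RLPN

open Filter Topology

/-! ### The perspective of the binary entropy -/

/-! The running time is the number of iterations times the average cost of one. The cost is, up to a
polynomial factor, the largest of 2^s, the sizes of the two lists and the expected number of
collisions. The bets condition makes the number of iterations at least of order 1/P_succ, where
P_succ is hypergeometric. Binomial coefficients turn into entropies, and since binom(n, |e|) has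
rate h(τ) = 1 - R, the exponent of the time is β of the limiting rates. What has to be understood is
which rates allow N δ² to exceed n.

A nonzero word is a parity-check of the random code with probability about 2^(-k): at most this by a
union bound, at least a quarter of it by a second moment argument (`dualCount_le`, `le_dualCount`).
Hence N is essentially the number of words of the right shape divided by 2^k. A bias is a Krawtchouk
value K_w(u) over binom(m, w), so N δ² is governed by the quantities K_w(u)²/binom(m, w) on the two
blocks, divided by 2^(m₁ + l) (`Params.expectedChecks_mul_bias_sq`).

On N₁ the weight w₁ costs nothing and may be optimised. By orthogonality the sum over w of
K_w(u)²/binom(m, w) is 2^m/binom(m, u), so the best weight reaches this up to a factor m + 1. This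
is also the exponent at ω = 1/2, which is why the region may fix ω₁ at half the length. On N₂ the
weight matters. Above the first root the orthogonality bound gives the exponent. Below it, Cauchy's
estimate on the circle of radius z bounds the coefficients of (1 - X)^u (1 + X)^(m - u). Conversely,
the dominant term at this radius attains the bound up to m + 1, and its index must have rate ω
because z is a saddle point (`le_krExp_of_rate`, `exists_weights`). So the sample condition reads
`slack ≥ 0` in the limit.

For the lower bound, rates of a hypothetical better choice converge along an ultrafilter to a tuple
of nonnegative slack. Decreasing ω₂ until the slack vanishes does not increase β and leads into the
region (`lower_bound`, `alphaDumer89_le_beta`). For the upper bound, a minimiser, which exists by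
compactness, is perturbed to a tuple with positive slack strictly below the first root
(`exists_strictlyFeasible`). That such a perturbation exists at or above the root is where the
Gilbert–Varshamov distance enters, through concavity of the entropy. Rounding the perturbed rates
gives admissible parameters, and a diagonal argument removes the ε. -/

/-- The perspective `(a, b) ↦ a h(b/a)` of the binary entropy. -/
def scaledEntropy (a b : ℝ) : ℝ :=
  (Real.negMulLog b + Real.negMulLog (a - b) - Real.negMulLog a) / Real.log 2

theorem log_two_pos : 0 < Real.log 2 := Real.log_pos (by norm_num)

/-- The right side is jointly continuous, also at a = 0, so all the degenerate blocks (σ = 0 or R -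
λ - σ = 0) are covered without case distinctions. At a = 0 the evenness of the logarithm makes the
two remaining terms cancel. -/
theorem mul_h_div (a b : ℝ) : a * h (b / a) = scaledEntropy a b := by
  rcases eq_or_ne a 0 with rfl | ha
  · simp [scaledEntropy, Real.negMulLog]
  · have h1 : Real.negMulLog b = (b / a) * Real.negMulLog a + a * Real.negMulLog (b / a) := by
      rw [← Real.negMulLog_mul]; congr 1; field_simp
    have h2 : Real.negMulLog (a - b) =
        (1 - b / a) * Real.negMulLog a + a * Real.negMulLog (1 - b / a) := by
      rw [← Real.negMulLog_mul]; congr 1; field_simp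
    rw [h, scaledEntropy, Real.binEntropy_eq_negMulLog_add_negMulLog_one_sub, h1, h2]
    ring

theorem continuous_scaledEntropy : Continuous fun v : ℝ × ℝ => scaledEntropy v.1 v.2 := by
  unfold scaledEntropy
  fun_prop

theorem continuous_scaledEntropy_comp {X : Type*} [TopologicalSpace X] {f g : X → ℝ}
    (hf : Continuous f) (hg : Continuous g) : Continuous fun x => scaledEntropy (f x) (g x) :=
  continuous_scaledEntropy.comp (hf.prodMk hg)

theorem scaledEntropy_sub (a b : ℝ) : scaledEntropy a (a - b) = scaledEntropy a b := by
  simp only [scaledEntropy, sub_sub_cancel]; ring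

theorem scaledEntropy_mul (c a b : ℝ) : scaledEntropy (c * a) (c * b) = c * scaledEntropy a b := by
  simp only [scaledEntropy, ← mul_sub, Real.negMulLog_mul]; ring

theorem h_continuous : Continuous h := by
  unfold h; fun_prop

theorem h_zero : h 0 = 0 := by simp [h]

theorem h_half : h (1 / 2) = 1 := by
  rw [h, one_div, Real.binEntropy_two_inv, div_self log_two_pos.ne']

theorem h_nonneg {x : ℝ} (h0 : 0 ≤ x) (h1 : x ≤ 1) : 0 ≤ h x :=
  div_nonneg (Real.binEntropy_nonneg h0 h1) log_two_pos.le

theorem h_pos {x : ℝ} (h0 : 0 < x) (h1 : x < 1) : 0 < h x :=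
  div_pos (Real.binEntropy_pos h0 h1) log_two_pos

theorem h_strictMonoOn : StrictMonoOn h (Set.Icc 0 (1 / 2)) := by
  intro x hx y hy hxy
  rw [one_div] at hx hy
  exact div_lt_div_of_pos_right (Real.binEntropy_strictMonoOn hx hy hxy) log_two_pos

theorem h_strictConcaveOn : StrictConcaveOn ℝ (Set.Icc 0 1) h := by
  refine ⟨convex_Icc 0 1, fun x hx y hy hxy a b ha hb hab => ?_⟩
  have := Real.strictConcave_binEntropy.2 hx hy hxy ha hb hab
  simp only [h, smul_eq_mul] at *
  rw [lt_div_iff₀ log_two_pos]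
  have h2 := log_two_pos.ne'
  field_simp
  exact this

theorem scaledEntropy_nonneg {a b : ℝ} (hb : 0 ≤ b) (hba : b ≤ a) : 0 ≤ scaledEntropy a b := by
  rw [← mul_h_div]
  have ha : 0 ≤ a := hb.trans hba
  exact mul_nonneg ha (h_nonneg (div_nonneg hb ha) (div_le_one_of_le₀ hba ha))

theorem scaledEntropy_pos {a b : ℝ} (hb : 0 < b) (hba : b < a) : 0 < scaledEntropy a b := by
  rw [← mul_h_div]
  have ha : 0 < a := hb.trans hba
  exact mul_pos ha (h_pos (div_pos hb ha) ((div_lt_one ha).2 hba))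

/-- Gibbs' inequality: the entropy lies below its tangent at x. It follows from log t ≤ t - 1,
applied to each of the two parts. -/
theorem scaledEntropy_le_mul_add {a b x : ℝ} (hx0 : 0 < x) (hx1 : x < 1) (hb : 0 ≤ b)
    (hba : b ≤ a) :
    scaledEntropy a b ≤ -(b * Real.log x + (a - b) * Real.log (1 - x)) / Real.log 2 := by
  have key : ∀ t y : ℝ, 0 ≤ t → 0 < y → 0 < a → Real.negMulLog t ≤ -t * Real.log (a * y) +
      (a * y - t) := by
    intro t y ht hy ha
    rcases ht.eq_or_lt with rfl | ht
    · simp; positivity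
    · have := Real.log_le_sub_one_of_pos (x := a * y / t) (by positivity)
      rw [Real.log_div (by positivity) ht.ne'] at this
      have h2 := mul_le_mul_of_nonneg_left this ht.le
      have h3 : t * (a * y / t - 1) = a * y - t := by field_simp
      rw [Real.negMulLog]
      linarith
  rcases (hb.trans hba).eq_or_lt with ha | ha
  · obtain rfl : b = 0 := by linarith
    simp [scaledEntropy, ← ha]
  · unfold scaledEntropy
    gcongr
    have h1 := key b x hb hx0 ha
    have h2 := key (a - b) (1 - x) (by linarith) (by linarith) ha
    rw [Real.log_mul (by positivity) (by linarith)] at h1 h2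
    have h3 : Real.negMulLog a = -a * Real.log a := rfl
    rw [h3]
    nlinarith

/-! ### The Gilbert–Varshamov distance -/

theorem deltaGV_spec {R : ℝ} (hR₀ : 0 < R) (hR₁ : R < 1) :
    deltaGV R ∈ Set.Icc (0 : ℝ) (1 / 2) ∧ h (deltaGV R) = 1 - R := by
  have hex : ∃ x ∈ Set.Icc (0 : ℝ) (1 / 2), h x = 1 - R := by
    have := intermediate_value_Icc (by norm_num : (0 : ℝ) ≤ 1 / 2) h_continuous.continuousOn
    rw [h_zero, h_half] at this
    exact this ⟨by linarith, by linarith⟩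
  exact ⟨Function.invFunOn_mem hex, Function.invFunOn_eq hex⟩

theorem deltaGV_pos {R : ℝ} (hR₀ : 0 < R) (hR₁ : R < 1) : 0 < deltaGV R := by
  obtain ⟨⟨h0, -⟩, h1⟩ := deltaGV_spec hR₀ hR₁
  rcases h0.eq_or_lt with h0 | h0
  · rw [← h0, h_zero] at h1; linarith
  · exact h0

/-- By strict concavity h lies above its chord 2x on the open interval (0, 1/2). The bound keeps the
relative error weight on N₂ below 1/2, and does so uniformly. -/
theorem deltaGV_lt {R : ℝ} (hR₀ : 0 < R) (hR₁ : R < 1) : deltaGV R < (1 - R) / 2 := by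
  obtain ⟨⟨-, h0⟩, h1⟩ := deltaGV_spec hR₀ hR₁
  have hp := deltaGV_pos hR₀ hR₁
  set x := deltaGV R
  have hx : x < 1 / 2 := by
    rcases h0.eq_or_lt with h0 | h0
    · rw [h0, h_half] at h1; linarith
    · exact h0
  have := h_strictConcaveOn.2 (show (0 : ℝ) ∈ Set.Icc 0 1 by simp)
    (show (1 / 2 : ℝ) ∈ Set.Icc 0 1 by norm_num) (by norm_num)
    (show 0 < 1 - 2 * x by linarith) (show 0 < 2 * x by linarith) (by ring)
  simp only [smul_eq_mul, h_zero, h_half] at this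
  ring_nf at this
  rw [h1] at this
  linarith

theorem scaledEntropy_le_slope {R a b : ℝ} (hR₀ : 0 < R) (hR₁ : R < 1) (hb : 0 ≤ b)
    (hba : b ≤ a) : scaledEntropy a b ≤
      -(b * Real.log (deltaGV R) + (a - b) * Real.log (1 - deltaGV R)) / Real.log 2 :=
  scaledEntropy_le_mul_add (deltaGV_pos hR₀ hR₁)
    (by linarith [deltaGV_lt hR₀ hR₁]) hb hba

theorem one_sub_eq_slope {R : ℝ} (hR₀ : 0 < R) (hR₁ : R < 1) : 1 - R =
    -(deltaGV R * Real.log (deltaGV R) + (1 - deltaGV R) * Real.log (1 - deltaGV R)) /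
      Real.log 2 := by
  rw [← (deltaGV_spec hR₀ hR₁).2]
  simp only [h, Real.binEntropy_eq_negMulLog_add_negMulLog_one_sub, Real.negMulLog]
  ring

/-- The exponent of a probability is nonnegative: concavity of the entropy at `δ_GV`. -/
theorem scaledEntropy_add_le {R s a b u v w : ℝ} (hR₀ : 0 < R) (hR₁ : R < 1) (hsum : s + a + b = 1)
    (huvw : u + v + w = deltaGV R) (hu : 0 ≤ u) (hus : u ≤ s) (hv : 0 ≤ v) (hva : v ≤ a)
    (hw : 0 ≤ w) (hwb : w ≤ b) :
    scaledEntropy s u + scaledEntropy a v + scaledEntropy b w ≤ 1 - R := by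
  have h1 := scaledEntropy_le_slope hR₀ hR₁ hu hus
  have h2 := scaledEntropy_le_slope hR₀ hR₁ hv hva
  have h3 := scaledEntropy_le_slope hR₀ hR₁ hw hwb
  rw [one_sub_eq_slope hR₀ hR₁]
  refine (add_le_add_three h1 h2 h3).trans (le_of_eq ?_)
  rw [← add_div, ← add_div, ← huvw]
  obtain rfl : s = 1 - a - b := by linarith
  ring

/-! ### Exponential rates of binomial coefficients -/

/-- Stirling's formula up to an error 1 + log n, which is all that exponential rates require. Both
halves come from log t ≤ t - 1 at a ratio of consecutive integers. -/
theorem le_log_factorial (n : ℕ) : n * Real.log n - n ≤ Real.log (n.factorial) := by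
  induction n with
  | zero => simp
  | succ n ih =>
    rw [Nat.factorial_succ, Nat.cast_mul, Real.log_mul (by positivity) (by positivity)]
    rcases Nat.eq_zero_or_pos n with rfl | hn
    · simp
    have hn' : (0 : ℝ) < n := by exact_mod_cast hn
    have := Real.log_le_sub_one_of_pos (x := ((n + 1 : ℕ) : ℝ) / n) (by positivity)
    rw [Real.log_div (by positivity) (by positivity)] at this
    have h2 := mul_le_mul_of_nonneg_left this hn'.le
    have h3 : (n : ℝ) * (((n + 1 : ℕ) : ℝ) / n - 1) = 1 := by push_cast; field_simp; ring
    rw [h3] at h2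
    push_cast at *
    linarith

theorem log_factorial_le (n : ℕ) :
    Real.log (n.factorial) ≤ n * Real.log n - n + (1 + Real.log n) := by
  induction n with
  | zero => simp
  | succ n ih =>
    rw [Nat.factorial_succ, Nat.cast_mul, Real.log_mul (by positivity) (by positivity)]
    rcases Nat.eq_zero_or_pos n with rfl | hn
    · simp
    have hn' : (0 : ℝ) < n := by exact_mod_cast hn
    have := Real.log_le_sub_one_of_pos (x := n / ((n + 1 : ℕ) : ℝ)) (by positivity)
    rw [Real.log_div (by positivity) (by positivity)] at this
    have h2 := mul_le_mul_of_nonneg_left this (by positivity : (0 : ℝ) ≤ n + 1)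
    have h3 : ((n : ℝ) + 1) * ((n : ℝ) / ((n + 1 : ℕ) : ℝ) - 1) = -1 := by
      push_cast; field_simp; ring
    rw [h3] at h2
    push_cast at *
    linarith

variable {F : Filter ℕ}

theorem tendsto_natCast_atTop_of_le (hF : F ≤ atTop) :
    Tendsto (fun n : ℕ => (n : ℝ)) F atTop :=
  tendsto_natCast_atTop_atTop.mono_left hF

theorem tendsto_log_div (hF : F ≤ atTop) :
    Tendsto (fun n : ℕ => Real.log n / n) F (𝓝 0) :=
  (Real.isLittleO_log_id_atTop.tendsto_div_nhds_zero).comp (tendsto_natCast_atTop_of_le hF)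

theorem tendsto_const_div (hF : F ≤ atTop) (c : ℝ) :
    Tendsto (fun n : ℕ => c / (n : ℝ)) F (𝓝 0) :=
  (tendsto_natCast_atTop_of_le hF).const_div_atTop c

/-- A sequence of at most linear growth does not affect an exponent. Indices with a n = 0 do no harm
because log 0 = 0. -/
theorem tendsto_log_natCast_div (hF : F ≤ atTop) {a : ℕ → ℕ} {α : ℝ}
    (ha : Tendsto (fun n => (a n : ℝ) / n) F (𝓝 α)) :
    Tendsto (fun n => Real.log (a n) / n) F (𝓝 0) := by
  have hup : Tendsto (fun n : ℕ => Real.log (|α| + 1) / n + Real.log n / n) F (𝓝 0) := by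
    simpa using (tendsto_const_div hF (Real.log (|α| + 1))).add (tendsto_log_div hF)
  refine tendsto_of_tendsto_of_tendsto_of_le_of_le' tendsto_const_nhds hup ?_ ?_
  · exact Eventually.of_forall fun n => div_nonneg (Real.log_natCast_nonneg _) (Nat.cast_nonneg _)
  · filter_upwards [ha.eventually_lt_const (lt_of_le_of_lt (le_abs_self α) (lt_add_one _)),
      hF (eventually_ge_atTop 1)] with n h1 h2
    have hn : (0 : ℝ) < n := by exact_mod_cast h2
    rw [← add_div]
    gcongr
    rcases Nat.eq_zero_or_pos (a n) with h0 | h0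
    · rw [h0]
      simp only [Nat.cast_zero, Real.log_zero]
      exact add_nonneg (Real.log_nonneg (by linarith [abs_nonneg α])) (Real.log_natCast_nonneg _)
    · rw [← Real.log_mul (by positivity) hn.ne']
      apply Real.log_le_log (by exact_mod_cast h0)
      rw [div_lt_iff₀ hn] at h1
      exact h1.le

theorem tendsto_log_factorial (hF : F ≤ atTop) {a : ℕ → ℕ} {α : ℝ}
    (ha : Tendsto (fun n => (a n : ℝ) / n) F (𝓝 α)) :
    Tendsto (fun n => (Real.log ((a n).factorial) - a n * Real.log n) / n) F
      (𝓝 (-Real.negMulLog α - α)) := by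
  have hlow : Tendsto (fun n : ℕ => -Real.negMulLog ((a n : ℝ) / n) - (a n : ℝ) / n) F
      (𝓝 (-Real.negMulLog α - α)) :=
    ((Real.continuous_negMulLog.tendsto α).comp ha).neg.sub ha
  have hup := hlow.add ((tendsto_const_div hF 1).add (tendsto_log_natCast_div hF ha))
  rw [add_zero, add_zero] at hup
  have key : ∀ n : ℕ, 1 ≤ n → -Real.negMulLog ((a n : ℝ) / n) - (a n : ℝ) / n =
      (a n * Real.log (a n) - a n - a n * Real.log n) / n := by
    intro n hn
    have hn : (0 : ℝ) < n := by exact_mod_cast hn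
    rcases Nat.eq_zero_or_pos (a n) with h0 | h0
    · simp [h0]
    · have : (0 : ℝ) < a n := by exact_mod_cast h0
      rw [Real.negMulLog, Real.log_div this.ne' hn.ne']
      ring
  refine tendsto_of_tendsto_of_tendsto_of_le_of_le' hlow hup ?_ ?_
  · filter_upwards [hF (eventually_ge_atTop 1)] with n hn
    rw [key n hn]
    gcongr
    exact le_log_factorial _
  · filter_upwards [hF (eventually_ge_atTop 1)] with n hn
    rw [key n hn, ← add_div, ← add_div]
    gcongr
    linarith [log_factorial_le (a n)]

/-- The terms log n subtracted in `tendsto_log_factorial` cancel, since a = b + (a - b). The filter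
is arbitrary below `atTop` so that the same statement serves along ultrafilters in the lower bound
and along `atTop` in the construction. -/
theorem tendsto_logb_choose (hF : F ≤ atTop) {a b : ℕ → ℕ} {α β : ℝ}
    (ha : Tendsto (fun n => (a n : ℝ) / n) F (𝓝 α))
    (hb : Tendsto (fun n => (b n : ℝ) / n) F (𝓝 β)) (hle : ∀ᶠ n in F, b n ≤ a n) :
    Tendsto (fun n => Real.logb 2 ((a n).choose (b n)) / n) F (𝓝 (scaledEntropy α β)) := by
  have hc : Tendsto (fun n => ((a n - b n : ℕ) : ℝ) / n) F (𝓝 (α - β)) := by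
    refine (ha.sub hb).congr' ?_
    filter_upwards [hle] with n hn
    rw [Nat.cast_sub hn, sub_div]
  have hlim := (((tendsto_log_factorial hF ha).sub (tendsto_log_factorial hF hb)).sub
    (tendsto_log_factorial hF hc)).div_const (Real.log 2)
  have e : ((-Real.negMulLog α - α - (-Real.negMulLog β - β) -
      (-Real.negMulLog (α - β) - (α - β))) / Real.log 2) = scaledEntropy α β := by
    rw [scaledEntropy]; ring
  rw [e] at hlim
  refine hlim.congr' ?_
  filter_upwards [hle] with n hn
  have h1 : ((a n).choose (b n) : ℝ) * (b n).factorial * (a n - b n).factorial =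
      (a n).factorial := by exact_mod_cast Nat.choose_mul_factorial_mul_factorial hn
  have h0 : (0 : ℝ) < (a n).choose (b n) := by exact_mod_cast Nat.choose_pos hn
  rw [Real.logb, ← h1, Real.log_mul (by positivity) (by positivity),
    Real.log_mul (by positivity) (by positivity), Nat.cast_sub hn]
  ring

theorem tendsto_half_div (hF : F ≤ atTop) {a : ℕ → ℕ} {α : ℝ}
    (ha : Tendsto (fun n => (a n : ℝ) / n) F (𝓝 α)) :
    Tendsto (fun n => ((a n / 2 : ℕ) : ℝ) / n) F (𝓝 (1 / 2 * α)) := by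
  have h1 : Tendsto (fun n : ℕ => 1 / 2 * ((a n : ℝ) / n) - 1 / n) F (𝓝 (1 / 2 * α)) := by
    have := (ha.const_mul (1 / 2)).sub (tendsto_const_div hF 1)
    rwa [sub_zero] at this
  refine tendsto_of_tendsto_of_tendsto_of_le_of_le h1 (ha.const_mul (1 / 2)) ?_ ?_
  · intro n
    have : (a n : ℝ) ≤ 2 * ((a n / 2 : ℕ) : ℝ) + 1 := by exact_mod_cast (by omega)
    have h2 : (1 / 2 * ((a n : ℝ) / n) - 1 / n) = (a n / 2 - 1 : ℝ) / n := by ring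
    simp only [h2]
    gcongr
    linarith
  · intro n
    have : 2 * ((a n / 2 : ℕ) : ℝ) ≤ (a n : ℝ) := by exact_mod_cast (by omega)
    have h2 : (1 / 2 * ((a n : ℝ) / n)) = (a n / 2 : ℝ) / n := by ring
    simp only [h2]
    gcongr
    linarith

theorem tendsto_sub_half_div (hF : F ≤ atTop) {a : ℕ → ℕ} {α : ℝ}
    (ha : Tendsto (fun n => (a n : ℝ) / n) F (𝓝 α)) :
    Tendsto (fun n => ((a n - a n / 2 : ℕ) : ℝ) / n) F (𝓝 (1 / 2 * α)) := by
  have h1 := ha.sub (tendsto_half_div hF ha)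
  have e : α - 1 / 2 * α = 1 / 2 * α := by ring
  rw [e] at h1
  refine h1.congr fun n => ?_
  rw [Nat.cast_sub (Nat.div_le_self _ _), sub_div]

end RLPN

end

noncomputable section

namespace RLPN

open Filter Topology

/-! ### The root `z` and the exponent of the Krawtchouk polynomials -/

theorem le_omegaPerp_iff {x ω : ℝ} (hx : x ≤ 1 / 2) :
    x ≤ omegaPerp ω ↔ 4 * ω * (1 - ω) ≤ (1 - 2 * x) ^ 2 := by
  have : x ≤ omegaPerp ω ↔ √(ω * (1 - ω)) ≤ 1 / 2 - x := by
    rw [omegaPerp]; constructor <;> intro <;> linarith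
  rw [this, Real.sqrt_le_left (by linarith)]
  constructor <;> intro <;> nlinarith

theorem omegaPerp_le_iff {x ω : ℝ} (hx : x ≤ 1 / 2) (hω₀ : 0 ≤ ω) (hω₁ : ω ≤ 1 / 2) :
    omegaPerp ω ≤ x ↔ (1 - 2 * x) ^ 2 ≤ 4 * ω * (1 - ω) := by
  have : omegaPerp ω ≤ x ↔ 1 / 2 - x ≤ √(ω * (1 - ω)) := by
    rw [omegaPerp]; constructor <;> intro <;> linarith
  rw [this, Real.le_sqrt (show 0 ≤ 1 / 2 - x by linarith)]
  · constructor <;> intro <;> nlinarith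
  · exact mul_nonneg hω₀ (by linarith)

/-- Both sides say (1 - 2x)² + (1 - 2ω)² ≤ 1, which is symmetric in x and ω. -/
theorem omegaPerp_le_comm {x ω : ℝ} (hx₀ : 0 ≤ x) (hx : x ≤ 1 / 2) (hω₀ : 0 ≤ ω)
    (hω₁ : ω ≤ 1 / 2) : omegaPerp ω ≤ x ↔ omegaPerp x ≤ ω := by
  rw [omegaPerp_le_iff hx hω₀ hω₁, omegaPerp_le_iff hω₁ hx₀ hx]
  constructor <;> intro <;> nlinarith

theorem lt_omegaPerp_comm {x ω : ℝ} (hx₀ : 0 ≤ x) (hx : x ≤ 1 / 2) (hω₀ : 0 ≤ ω)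
    (hω₁ : ω ≤ 1 / 2) : x < omegaPerp ω ↔ ω < omegaPerp x := by
  rw [← not_le, ← not_le, omegaPerp_le_comm hx₀ hx hω₀ hω₁]

theorem omegaPerp_le_half (x : ℝ) : omegaPerp x ≤ 1 / 2 := by
  have := Real.sqrt_nonneg (x * (1 - x))
  rw [omegaPerp]; linarith

theorem omegaPerp_pos {x : ℝ} (hx₀ : 0 ≤ x) (hx : x < 1 / 2) : 0 < omegaPerp x := by
  rw [← not_le, omegaPerp_le_iff (by norm_num) hx₀ hx.le]
  nlinarith

theorem continuous_omegaPerp : Continuous omegaPerp := by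
  unfold omegaPerp; fun_prop

/-- The algebraic description of `z`: it is the smaller root of
`(1 - ω) z² - (1 - 2 x) z + ω`, and `S = √D`. -/
theorem exists_sqrt_disc {x ω : ℝ} (hx : x ≤ 1 / 2) (hω₀ : 0 ≤ ω) (hω₁ : ω ≤ 1 / 2)
    (hD : 4 * ω * (1 - ω) ≤ (1 - 2 * x) ^ 2) :
    ∃ S, 0 ≤ S ∧ S ≤ 1 - 2 * x ∧ S ^ 2 = (1 - 2 * x) ^ 2 - 4 * ω * (1 - ω) ∧
      2 * (1 - ω) * zKraw x ω = 1 - 2 * x - S ∧ zKraw x ω * (1 - 2 * x + S) = 2 * ω := by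
  refine ⟨√((1 - 2 * x) ^ 2 - 4 * ω * (1 - ω)), Real.sqrt_nonneg _, ?_, ?_, ?_, ?_⟩
  · rw [Real.sqrt_le_left (by linarith)]
    nlinarith
  · exact Real.sq_sqrt (by linarith)
  · rw [zKraw]
    have : 1 - ω ≠ 0 := by linarith
    field_simp
  · have h1 : 1 - ω ≠ 0 := by linarith
    have h2 := Real.sq_sqrt (show 0 ≤ (1 - 2 * x) ^ 2 - 4 * ω * (1 - ω) by linarith)
    rw [zKraw, div_mul_eq_mul_div, div_eq_iff (by simpa using h1)]
    linear_combination -h2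

theorem zKraw_quadratic {x ω : ℝ} (hx : x ≤ 1 / 2) (hω₀ : 0 ≤ ω) (hω₁ : ω ≤ 1 / 2)
    (hD : 4 * ω * (1 - ω) ≤ (1 - 2 * x) ^ 2) :
    (1 - ω) * zKraw x ω ^ 2 - (1 - 2 * x) * zKraw x ω + ω = 0 := by
  obtain ⟨S, -, -, -, h1, h2⟩ := exists_sqrt_disc hx hω₀ hω₁ hD
  linear_combination (zKraw x ω / 2) * h1 - h2 / 2

/-- In z (1 - 2x + S) = 2ω the bracket is at most 2. This bound and the next control ω log z and x
log(1 - z) where the logarithms blow up. -/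
theorem le_zKraw {x ω : ℝ} (hx₀ : 0 ≤ x) (hx : x < 1 / 2) (hω₀ : 0 ≤ ω) (hω₁ : ω ≤ 1 / 2)
    (hD : 4 * ω * (1 - ω) ≤ (1 - 2 * x) ^ 2) : ω ≤ zKraw x ω := by
  obtain ⟨S, hS, hS', -, h1, h2⟩ := exists_sqrt_disc hx.le hω₀ hω₁ hD
  have hz : 0 ≤ zKraw x ω := by
    by_contra hz
    nlinarith
  nlinarith

theorem two_mul_le_one_sub_zKraw_sq {x ω : ℝ} (hx₀ : 0 ≤ x) (hx : x < 1 / 2) (hω₀ : 0 ≤ ω)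
    (hω₁ : ω ≤ 1 / 2) (hD : 4 * ω * (1 - ω) ≤ (1 - 2 * x) ^ 2) :
    2 * x ≤ (1 - zKraw x ω) ^ 2 := by
  obtain ⟨S, hS, hS', hS2, h1, h2⟩ := exists_sqrt_disc hx.le hω₀ hω₁ hD
  have hq := zKraw_quadratic hx.le hω₀ hω₁ hD
  set z := zKraw x ω
  have hz1 : z ≤ 1 := by nlinarith
  have h3 : 2 * x = (1 - ω) * (1 - z) ^ 2 - S * (1 - z) := by linear_combination hq + (1 - z) * h1
  nlinarith [mul_nonneg hS (sub_nonneg.2 hz1), sq_nonneg (1 - z)]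

theorem zKraw_le_one {x ω : ℝ} (hx₀ : 0 ≤ x) (hx : x < 1 / 2) (hω₀ : 0 ≤ ω) (hω₁ : ω ≤ 1 / 2)
    (hD : 4 * ω * (1 - ω) ≤ (1 - 2 * x) ^ 2) : zKraw x ω ≤ 1 := by
  obtain ⟨S, hS, hS', hS2, h1, h2⟩ := exists_sqrt_disc hx.le hω₀ hω₁ hD
  nlinarith

theorem zKraw_lt_one {x ω : ℝ} (hx₀ : 0 ≤ x) (hx : x < 1 / 2) (hω₀ : 0 ≤ ω) (hω₁ : ω < 1 / 2)
    (hD : 4 * ω * (1 - ω) ≤ (1 - 2 * x) ^ 2) : zKraw x ω < 1 := by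
  obtain ⟨S, hS, hS', hS2, h1, h2⟩ := exists_sqrt_disc hx.le hω₀ hω₁.le hD
  nlinarith

/-- Below the first root, the disc of radius `z` lies in the region where the generating function
of the Krawtchouk polynomials is maximal on the positive axis. -/
theorem zKraw_facts {x ω : ℝ} (hx₀ : 0 ≤ x) (hx : x < 1 / 2) (hω₀ : 0 < ω) (hω₁ : ω ≤ 1 / 2)
    (hD : x < omegaPerp ω) :
    0 < zKraw x ω ∧ zKraw x ω < 1 ∧
      (1 - ω) * zKraw x ω ^ 2 - (1 - 2 * x) * zKraw x ω + ω = 0 ∧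
      (1 - ω) * zKraw x ω ^ 2 < ω ∧
      (1 + zKraw x ω) ^ 2 * x < (1 - zKraw x ω) ^ 2 * (1 - x) := by
  rw [← not_le, omegaPerp_le_iff hx.le hω₀.le hω₁, not_le] at hD
  have hω₂ : ω < 1 / 2 := by
    rcases hω₁.eq_or_lt with rfl | h
    · nlinarith
    · exact h
  have hz0 : 0 < zKraw x ω := hω₀.trans_le (le_zKraw hx₀ hx hω₀.le hω₁ hD.le)
  have hz1 := zKraw_lt_one hx₀ hx hω₀.le hω₂ hD.le
  have hq := zKraw_quadratic hx.le hω₀.le hω₁ hD.le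
  obtain ⟨S, hS, hS', hS2, h1, h2⟩ := exists_sqrt_disc hx.le hω₀.le hω₁ hD.le
  have hSpos : 0 < S := by
    rcases hS.eq_or_lt with rfl | h
    · nlinarith
    · exact h
  set z := zKraw x ω
  have h4 : (1 - ω) * z ^ 2 < ω := by nlinarith [mul_pos hz0 hSpos]
  refine ⟨hz0, hz1, hq, h4, ?_⟩
  -- The bracket on the left equals (1 - z)² (1 - x) - (1 + z)² x. On the right, positivity
  -- expresses that z is strictly the smaller of two roots with product ω/(1 - ω).
  have h5 : z * ((1 + z ^ 2) * (1 - 2 * x) - 2 * z) = (1 - z ^ 2) * (ω - (1 - ω) * z ^ 2) := by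
    linear_combination -(1 + z ^ 2) * hq
  have h6 : 0 < (1 - z ^ 2) * (ω - (1 - ω) * z ^ 2) := by
    apply mul_pos <;> nlinarith
  rw [← h5] at h6
  have h7 := (mul_pos_iff_of_pos_left hz0).1 h6
  nlinarith

/-- The exponent of the squared Krawtchouk polynomial divided by its squared norm. -/
def krExp (x ω : ℝ) : ℝ := h ω + deltaTilde x ω

/-- The branch of `krExp` below the first root. -/
def krExpLow (x ω : ℝ) : ℝ :=
  2 * (x * Real.logb 2 (1 - zKraw x ω) + (1 - x) * Real.logb 2 (1 + zKraw x ω)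
      - ω * Real.logb 2 (zKraw x ω)) - h ω

theorem krExp_of_le {x ω : ℝ} (hx₀ : 0 ≤ x) (hx : x ≤ omegaPerp ω) :
    krExp x ω = krExpLow x ω := by
  rw [krExp, krExpLow, deltaTilde, if_pos ⟨hx₀, hx⟩]; ring

theorem krExp_zero {x : ℝ} (hx₀ : 0 ≤ x) (hx : x ≤ 1 / 2) : krExp x 0 = 0 := by
  have hp : x ≤ omegaPerp 0 := by simpa [omegaPerp] using hx
  have hz : zKraw x 0 = 0 := by
    simp [zKraw, Real.sqrt_sq (show 0 ≤ 1 - 2 * x by linarith)]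
  simp [krExp_of_le hx₀ hp, krExpLow, hz, h_zero]

/-- The two branches of the exponent agree at the first root. -/
theorem krExpLow_eq {x ω : ℝ} (hx₀ : 0 ≤ x) (hx : x < 1 / 2) (hω₀ : 0 ≤ ω) (hω₁ : ω ≤ 1 / 2)
    (hxω : x = omegaPerp ω) : krExpLow x ω = 1 - h x := by
  have hD : 4 * ω * (1 - ω) = (1 - 2 * x) ^ 2 :=
    le_antisymm ((le_omegaPerp_iff hx.le).1 hxω.le) ((omegaPerp_le_iff hx.le hω₀ hω₁).1 hxω.ge)
  have hωpos : 0 < ω := by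
    rcases hω₀.eq_or_lt with rfl | h'
    · nlinarith
    · exact h'
  -- At the first root the discriminant vanishes. With a = √ω and b = √(1 - ω) one gets z = a/b, x =
  -- (b - a)²/2 and 1 - x = (b + a)²/2, and the logarithms become explicit.
  have ha : 0 < √ω := Real.sqrt_pos.2 hωpos
  have hb : 0 < √(1 - ω) := Real.sqrt_pos.2 (by linarith)
  have ha2 : √ω ^ 2 = ω := Real.sq_sqrt hω₀
  have hb2 : √(1 - ω) ^ 2 = 1 - ω := Real.sq_sqrt (by linarith)
  have hlog : ∀ y : ℝ, Real.log (y ^ 2) = 2 * Real.log y := fun y => by simp [Real.log_pow]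
  have hla : Real.log ω = 2 * Real.log (√ω) := by rw [← hlog, ha2]
  have hlb : Real.log (1 - ω) = 2 * Real.log (√(1 - ω)) := by rw [← hlog, hb2]
  have hab : 1 - 2 * x = 2 * (√ω * √(1 - ω)) := by
    rw [← Real.sqrt_mul hω₀, hxω, omegaPerp]; ring
  have hz : zKraw x ω = √ω / √(1 - ω) := by
    rw [zKraw, hD, sub_self, Real.sqrt_zero, sub_zero, hab, ← hb2, Real.sqrt_sq hb.le]
    field_simp
  set a := √ω
  set b := √(1 - ω)
  have hx2 : x = (b - a) ^ 2 / 2 := by linear_combination -hab / 2 - ha2 / 2 - hb2 / 2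
  have hx3 : 1 - x = (b + a) ^ 2 / 2 := by linear_combination hab / 2 - ha2 / 2 - hb2 / 2
  have hL := log_two_pos.ne'
  have l1 : 2 * (x * Real.log (1 - a / b)) = x * (Real.log 2 + Real.log x - 2 * Real.log b) := by
    rcases hx₀.eq_or_lt with h0 | h0
    · simp [← h0]
    · have hba : b - a ≠ 0 := by rintro h; rw [h] at hx2; simp at hx2; linarith
      have e1 : 1 - a / b = (b - a) / b := by field_simp
      have e2 : Real.log x = 2 * Real.log (b - a) - Real.log 2 := by
        rw [hx2, Real.log_div (pow_ne_zero 2 hba) (by norm_num), hlog]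
      rw [e1, Real.log_div hba hb.ne', e2]
      ring
  have l2 : 2 * Real.log (1 + a / b) = Real.log 2 + Real.log (1 - x) - 2 * Real.log b := by
    have e1 : 1 + a / b = (b + a) / b := by field_simp
    rw [e1, Real.log_div (by positivity) hb.ne', hx3, Real.log_div (by positivity) (by norm_num),
      hlog]
    ring
  rw [krExpLow, hz, h, h, Real.binEntropy_eq_negMulLog_add_negMulLog_one_sub,
    Real.binEntropy_eq_negMulLog_add_negMulLog_one_sub]
  simp only [Real.negMulLog, Real.logb]
  rw [hla, hlb, Real.log_div ha.ne' hb.ne']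
  generalize Real.log (1 - a / b) = A at l1 ⊢
  generalize Real.log (1 + a / b) = B at l2 ⊢
  field_simp
  linear_combination l1 + (1 - x) * l2

theorem krExp_of_ge {x ω : ℝ} (hx₀ : 0 ≤ x) (hx : x < 1 / 2) (hω₀ : 0 ≤ ω) (hω₁ : ω ≤ 1 / 2)
    (hxω : omegaPerp ω ≤ x) : krExp x ω = 1 - h x := by
  rcases hxω.eq_or_lt with h1 | h1
  · rw [krExp_of_le hx₀ h1.ge, krExpLow_eq hx₀ hx hω₀ hω₁ h1.symm]
  · rw [krExp, deltaTilde, if_neg (fun h2 => h1.not_ge h2.2)]; ring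

theorem deltaTilde_half {x : ℝ} (hx₀ : 0 ≤ x) : deltaTilde x (1 / 2) = -h x := by
  have hp : omegaPerp (1 / 2) = 0 := by
    have : (1 / 2 : ℝ) * (1 - 1 / 2) = (1 / 2) ^ 2 := by norm_num
    rw [omegaPerp, this, Real.sqrt_sq (by norm_num), sub_self]
  rcases hx₀.eq_or_lt with rfl | h0
  · have := krExp_of_ge le_rfl (by norm_num) (by norm_num) le_rfl hp.le
    rw [krExp, h_half, h_zero] at this
    rw [h_zero]; linarith
  · rw [deltaTilde, if_neg (by rw [hp]; exact fun h2 => h0.not_ge h2.2), h_half]; ring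

/-! ### Continuity and monotonicity of the Krawtchouk exponent. -/

theorem continuousWithinAt_of_abs_le {X : Type*} [TopologicalSpace X] {f g : X → ℝ} {s : Set X}
    {a : X} (hg : ContinuousWithinAt g s a) (hga : g a = 0) (ha : a ∈ s)
    (hfg : ∀ y ∈ s, |f y| ≤ g y) : ContinuousWithinAt f s a := by
  have hfa : f a = 0 := by
    have := hfg a ha
    rw [hga] at this
    exact abs_nonpos_iff.1 this
  rw [ContinuousWithinAt, hfa]
  rw [ContinuousWithinAt, hga] at hg
  exact squeeze_zero_norm' (by filter_upwards [self_mem_nhdsWithin] with y hy using hfg y hy) hg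

/-- The two branches live on closed sets, on which each is continuous, and they agree on the common
boundary. The only delicate points are z = 0 and z = 1, where a logarithm is singular but its
coefficient vanishes. -/
theorem continuousOn_krExp {c : ℝ} (hc : c < 1 / 2) :
    ContinuousOn (fun v : ℝ × ℝ => krExp v.1 v.2) (Set.Icc 0 c ×ˢ Set.Icc 0 (1 / 2)) := by
  have hperp : Continuous fun v : ℝ × ℝ => omegaPerp v.2 := continuous_omegaPerp.comp continuous_snd
  set T := (Set.Icc (0 : ℝ) c ×ˢ Set.Icc (0 : ℝ) (1 / 2)) ∩ {v | v.1 ≤ omegaPerp v.2} with hT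
  have hS : IsClosed (Set.Icc (0 : ℝ) c ×ˢ Set.Icc (0 : ℝ) (1 / 2)) := isClosed_Icc.prod isClosed_Icc
  have hTc : IsClosed T := hS.inter (isClosed_le continuous_fst hperp)
  have hU : IsClosed ((Set.Icc (0 : ℝ) c ×ˢ Set.Icc (0 : ℝ) (1 / 2)) ∩
      {v | omegaPerp v.2 ≤ v.1}) := hS.inter (isClosed_le hperp continuous_fst)
  have hTfacts : ∀ v ∈ T, 0 ≤ v.1 ∧ v.1 < 1 / 2 ∧ 0 ≤ v.2 ∧ v.2 ≤ 1 / 2 ∧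
      4 * v.2 * (1 - v.2) ≤ (1 - 2 * v.1) ^ 2 := by
    rintro ⟨x, ω⟩ ⟨⟨⟨h1, h2⟩, h3, h4⟩, h5⟩
    exact ⟨h1, h2.trans_lt hc, h3, h4, (le_omegaPerp_iff (h2.trans hc.le)).1 h5⟩
  have hz : ContinuousOn (fun v : ℝ × ℝ => zKraw v.1 v.2) T := by
    unfold zKraw
    refine ContinuousOn.div (by fun_prop) (by fun_prop) fun v hv => ?_
    have := (hTfacts v hv).2.2.2.1
    simp only [ne_eq, mul_eq_zero, not_or]
    exact ⟨by norm_num, by linarith⟩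
  have c1 : ContinuousOn (fun v : ℝ × ℝ => v.1 * Real.logb 2 (1 - zKraw v.1 v.2)) T := by
    intro v hv
    by_cases h1 : 1 - zKraw v.1 v.2 = 0
    · have hv0 : v.1 = 0 := by
        obtain ⟨a1, a2, a3, a4, a5⟩ := hTfacts v hv
        have := two_mul_le_one_sub_zKraw_sq a1 a2 a3 a4 a5
        rw [h1] at this
        linarith
      -- Here z = 1 and x = 0. Since 2x ≤ (1 - z)² ≤ 1, the term is dominated by |2x log(2x)|, which
      -- tends to zero.
      refine continuousWithinAt_of_abs_le
        (g := fun v : ℝ × ℝ => |2 * v.1 * Real.log (2 * v.1)| / Real.log 2) ?_ (by simp [hv0]) hv ?_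
      · have : Continuous fun v : ℝ × ℝ => 2 * v.1 * Real.log (2 * v.1) :=
          Real.continuous_mul_log.comp (by fun_prop : Continuous fun v : ℝ × ℝ => 2 * v.1)
        exact (this.abs.div_const _).continuousWithinAt
      · intro y hy
        obtain ⟨a1, a2, a3, a4, a5⟩ := hTfacts y hy
        have b1 := two_mul_le_one_sub_zKraw_sq a1 a2 a3 a4 a5
        have b2 := zKraw_le_one a1 a2 a3 a4 a5
        have b3 := a3.trans (le_zKraw a1 a2 a3 a4 a5)
        rcases a1.eq_or_lt with a1 | a1
        · simp [← a1]
        have b4 : 0 < 1 - zKraw y.1 y.2 := by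
          rcases (sub_nonneg.2 b2).eq_or_lt with b | b
          · rw [← b] at b1; linarith
          · exact b
        have b5 : Real.log (2 * y.1) ≤ 2 * Real.log (1 - zKraw y.1 y.2) := by
          have := Real.log_le_log (by linarith) b1
          rwa [Real.log_pow] at this
        have b6 : Real.log (1 - zKraw y.1 y.2) ≤ 0 := Real.log_nonpos b4.le (by linarith)
        rw [Real.logb, ← mul_div_assoc, abs_div, abs_of_pos log_two_pos, abs_mul, abs_mul,
          abs_of_nonpos b6, abs_of_nonpos (b5.trans (by linarith)), abs_of_pos a1,
          abs_of_pos (by linarith)]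
        gcongr ?_ / _
        nlinarith
    · exact continuousWithinAt_fst.mul
        (((continuousWithinAt_const.sub (hz v hv)).log h1).div_const _)
  have c2 : ContinuousOn (fun v : ℝ × ℝ => (1 - v.1) * Real.logb 2 (1 + zKraw v.1 v.2)) T := by
    refine ContinuousOn.mul (by fun_prop) (((continuousOn_const.add hz).log fun v hv => ?_).div_const _)
    obtain ⟨a1, a2, a3, a4, a5⟩ := hTfacts v hv
    have := a3.trans (le_zKraw a1 a2 a3 a4 a5)
    exact (by linarith : 0 < 1 + zKraw v.1 v.2).ne'
  have c3 : ContinuousOn (fun v : ℝ × ℝ => v.2 * Real.logb 2 (zKraw v.1 v.2)) T := by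
    intro v hv
    by_cases h1 : v.2 = 0
    -- From ω ≤ z ≤ 1 the term is dominated by |ω log ω|.
    · refine continuousWithinAt_of_abs_le
        (g := fun v : ℝ × ℝ => |v.2 * Real.log v.2| / Real.log 2) ?_ (by simp [h1]) hv ?_
      · have : Continuous fun v : ℝ × ℝ => v.2 * Real.log v.2 :=
          Real.continuous_mul_log.comp continuous_snd
        exact (this.abs.div_const _).continuousWithinAt
      · intro y hy
        obtain ⟨a1, a2, a3, a4, a5⟩ := hTfacts y hy
        have b2 := zKraw_le_one a1 a2 a3 a4 a5
        have b3 := le_zKraw a1 a2 a3 a4 a5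
        rcases a3.eq_or_lt with a3 | a3
        · simp [← a3]
        have b5 : Real.log y.2 ≤ Real.log (zKraw y.1 y.2) := Real.log_le_log a3 b3
        have b6 : Real.log (zKraw y.1 y.2) ≤ 0 := Real.log_nonpos (a3.le.trans b3) b2
        rw [Real.logb, ← mul_div_assoc, abs_div, abs_of_pos log_two_pos, abs_mul, abs_mul,
          abs_of_nonpos b6, abs_of_nonpos (b5.trans b6)]
        gcongr ?_ / _
        exact mul_le_mul_of_nonneg_left (by linarith) (abs_nonneg _)
    · refine continuousWithinAt_snd.mul (((hz v hv).log ?_).div_const _)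
      obtain ⟨a1, a2, a3, a4, a5⟩ := hTfacts v hv
      have := le_zKraw a1 a2 a3 a4 a5
      exact (lt_of_lt_of_le (lt_of_le_of_ne a3 (Ne.symm h1)) this).ne'
  have hlow : ContinuousOn (fun v : ℝ × ℝ => krExp v.1 v.2) T := by
    have : ContinuousOn (fun v : ℝ × ℝ => krExpLow v.1 v.2) T := by
      unfold krExpLow
      exact (continuousOn_const.mul ((c1.add c2).sub c3)).sub
        (h_continuous.comp continuous_snd).continuousOn
    exact this.congr fun v hv => krExp_of_le (hTfacts v hv).1 hv.2
  have hhigh : ContinuousOn (fun v : ℝ × ℝ => krExp v.1 v.2)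
      ((Set.Icc (0 : ℝ) c ×ˢ Set.Icc (0 : ℝ) (1 / 2)) ∩ {v | omegaPerp v.2 ≤ v.1}) := by
    have : Continuous fun v : ℝ × ℝ => 1 - h v.1 :=
      continuous_const.sub (h_continuous.comp continuous_fst)
    refine this.continuousOn.congr fun v hv => ?_
    exact krExp_of_ge hv.1.1.1 (hv.1.1.2.trans_lt hc) hv.1.2.1 hv.1.2.2 hv.2
  refine (hlow.union_of_isClosed hhigh hTc hU).mono fun v hv => ?_
  rcases le_total v.1 (omegaPerp v.2) with h1 | h1
  · exact Or.inl ⟨hv, h1⟩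
  · exact Or.inr ⟨hv, h1⟩

theorem continuousOn_krExp_right {x : ℝ} (hx₀ : 0 ≤ x) (hx : x < 1 / 2) :
    ContinuousOn (krExp x) (Set.Icc 0 (1 / 2)) :=
  (continuousOn_krExp hx).comp (f := fun ω : ℝ => (x, ω)) (by fun_prop)
    fun _ hω => ⟨⟨hx₀, le_rfl⟩, hω⟩

/-- An envelope argument: the quadratic equation for z says that z is a stationary point of x log(1
- z) + (1 - x) log(1 + z) - ω log z. Hence the derivative of z with respect to ω drops out and only
the explicit dependence on ω remains. -/
theorem hasDerivAt_krExpLow {x ω : ℝ} (hx₀ : 0 ≤ x) (hx : x < 1 / 2) (hω₀ : 0 < ω)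
    (hω₁ : ω < 1 / 2) (hD : x < omegaPerp ω) :
    HasDerivAt (krExpLow x)
      ((Real.log (ω / (1 - ω)) - 2 * Real.log (zKraw x ω)) / Real.log 2) ω := by
  obtain ⟨z0, z1, hq, -, -⟩ := zKraw_facts hx₀ hx hω₀ hω₁.le hD
  have hz : DifferentiableAt ℝ (fun y => zKraw x y) ω := by
    rw [← not_le, omegaPerp_le_iff hx.le hω₀.le hω₁.le, not_le] at hD
    unfold zKraw
    refine DifferentiableAt.div (((by fun_prop : DifferentiableAt ℝ _ ω).sub
      ((by fun_prop : DifferentiableAt ℝ _ ω).sqrt ?_))) (by fun_prop) ?_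
    · linarith
    · simp only [ne_eq, mul_eq_zero, not_or]; exact ⟨by norm_num, by linarith⟩
  have hz' := hz.hasDerivAt
  set z' := deriv (fun y => zKraw x y) ω
  have hh : HasDerivAt h ((Real.log (1 - ω) - Real.log ω) / Real.log 2) ω :=
    (Real.hasDerivAt_binEntropy hω₀.ne' (by linarith)).div_const _
  have d1 : HasDerivAt (fun y => Real.logb 2 (1 - zKraw x y))
      (-z' / (1 - zKraw x ω) / Real.log 2) ω := ((hz'.const_sub 1).log (by linarith)).div_const _
  have d2 : HasDerivAt (fun y => Real.logb 2 (1 + zKraw x y))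
      (z' / (1 + zKraw x ω) / Real.log 2) ω := ((hz'.const_add 1).log (by linarith)).div_const _
  have d3 : HasDerivAt (fun y => Real.logb 2 (zKraw x y)) (z' / zKraw x ω / Real.log 2) ω :=
    (hz'.log z0.ne').div_const _
  have := ((((d1.const_mul x).add (d2.const_mul (1 - x))).sub
    ((hasDerivAt_id ω).mul d3)).const_mul 2).sub hh
  refine this.congr_deriv ?_
  rw [Real.log_div hω₀.ne' (by linarith)]
  have hL := log_two_pos.ne'
  have n1 : 1 - zKraw x ω ≠ 0 := by linarith
  have n2 : 1 + zKraw x ω ≠ 0 := by linarith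
  have n3 := z0.ne'
  simp only [Real.logb, id]
  set z := zKraw x ω
  have hzero : x * (-z' / (1 - z)) + (1 - x) * (z' / (1 + z)) - ω * (z' / z) = 0 := by
    field_simp
    linear_combination -z' * hq
  have e : 2 * (x * (-z' / (1 - z) / Real.log 2) + (1 - x) * (z' / (1 + z) / Real.log 2) -
      (1 * (Real.log z / Real.log 2) + ω * (z' / z / Real.log 2))) -
      (Real.log (1 - ω) - Real.log ω) / Real.log 2 =
      2 * (x * (-z' / (1 - z)) + (1 - x) * (z' / (1 + z)) - ω * (z' / z)) / Real.log 2 +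
      (Real.log ω - Real.log (1 - ω) - 2 * Real.log z) / Real.log 2 := by ring
  rw [e, hzero]; ring

/-- The derivative is positive exactly when (1 - ω) z² < ω, and this holds because z is the smaller
root. -/
theorem krExp_strictMonoOn {x : ℝ} (hx₀ : 0 ≤ x) (hx : x < 1 / 2) :
    StrictMonoOn (krExp x) (Set.Icc 0 (omegaPerp x)) := by
  refine strictMonoOn_of_deriv_pos (convex_Icc _ _) ((continuousOn_krExp_right hx₀ hx).mono
    (Set.Icc_subset_Icc_right (omegaPerp_le_half x))) fun ω hω => ?_
  rw [interior_Icc] at hω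
  have hω₁ : ω < 1 / 2 := hω.2.trans_le (omegaPerp_le_half x)
  have hD := (lt_omegaPerp_comm hx₀ hx.le hω.1.le hω₁.le).2 hω.2
  have heq : krExp x =ᶠ[𝓝 ω] krExpLow x := by
    filter_upwards [continuous_omegaPerp.continuousAt.eventually_const_lt hD] with y hy
    exact krExp_of_le hx₀ hy.le
  rw [heq.deriv_eq, (hasDerivAt_krExpLow hx₀ hx hω.1 hω₁ hD).deriv]
  obtain ⟨z0, z1, -, hlt, -⟩ := zKraw_facts hx₀ hx hω.1 hω₁.le hD
  refine div_pos ?_ log_two_pos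
  have : Real.log (zKraw x ω ^ 2) < Real.log (ω / (1 - ω)) := by
    apply Real.log_lt_log (by positivity)
    rw [lt_div_iff₀ (by linarith)]
    linarith
  rw [Real.log_pow] at this
  push_cast at this
  linarith

end RLPN

end

noncomputable section

namespace RLPN

open Filter Topology

/-! ### The region and the minimum -/

/-- The linear constraints of the region. -/
def box (R : ℝ) : Set Rates :=
  {q | 0 ≤ q.σ ∧ 0 ≤ q.ν₁ ∧ 0 ≤ q.ν₂ ∧ 0 ≤ q.lam ∧ 0 ≤ q.ω₂ ∧
    q.σ ≤ R - q.lam ∧ q.ν₁ ≤ R - q.lam - q.σ ∧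
    deltaGV R - q.σ ≤ q.ν₁ + q.ν₂ ∧ q.ν₁ + q.ν₂ ≤ deltaGV R ∧
    q.ω₁ = (R - q.lam - q.σ) / 2 ∧ q.ω₂ ≤ (1 - R + q.lam) / 2}

/-- The exponent of `N δ²` for the best weight on `N₁`. -/
def slack (R : ℝ) (q : Rates) : ℝ :=
  (1 - R + q.lam) * krExp (q.ν₂ / (1 - R + q.lam)) (q.ω₂ / (1 - R + q.lam)) - q.lam -
    scaledEntropy (R - q.lam - q.σ) q.ν₁

/-- At relative weight 1/2 the exponent on N₁ is -h, so the equation defining the region becomes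
`slack = 0`. The constraint ν₂ ≤ 1 - R + λ is implied by ν₂ ≤ τ < (1 - R)/2 and may be dropped. -/
theorem mem_region_iff {R : ℝ} (hR₀ : 0 < R) (hR₁ : R < 1) (q : Rates) :
    q ∈ region R ↔ q ∈ box R ∧ slack R q = 0 := by
  have key : ∀ q ∈ box R, (R - q.lam - q.σ) *
      deltaTilde (q.ν₁ / (R - q.lam - q.σ)) (q.ω₁ / (R - q.lam - q.σ)) =
      -scaledEntropy (R - q.lam - q.σ) q.ν₁ := by
    rintro q ⟨h1, h2, h3, h4, h5, h6, h7, h8, h9, h10, h11⟩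
    rcases (sub_nonneg.2 h6).eq_or_lt with h0 | h0
    · rw [← h0, zero_mul, scaledEntropy]
      simp [Real.negMulLog]
    · have e : q.ω₁ / (R - q.lam - q.σ) = 1 / 2 := by rw [h10]; field_simp
      rw [e, deltaTilde_half (div_nonneg h2 h0.le), ← mul_h_div]; ring
  constructor
  · rintro ⟨h1, h2, h3, h4, h5, h6, h7, h8, h9, h10, h11, h12, h13, h14⟩
    have hb : q ∈ box R := ⟨h1, h2, h3, h4, h6, h7, h8, h10, h11, h12, h13⟩
    refine ⟨hb, ?_⟩
    have := key q hb
    rw [countExp] at h14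
    rw [slack, krExp]
    linarith
  · rintro ⟨hb, hs⟩
    have := key q hb
    obtain ⟨h1, h2, h3, h4, h5, h6, h7, h8, h9, h10, h11⟩ := hb
    have := deltaGV_lt hR₀ hR₁
    refine ⟨h1, h2, h3, h4, by linarith, h5, h6, h7, by linarith, h8, h9, h10, h11, ?_⟩
    rw [countExp]
    rw [slack, krExp] at hs
    linarith

theorem beta_eq (R : ℝ) (q : Rates) : beta R q =
    max q.σ (max (1 / 2 * scaledEntropy (1 - R + q.lam) q.ω₂)
      (scaledEntropy (1 - R + q.lam) q.ω₂ - q.lam)) +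
    (1 - R - scaledEntropy q.σ (deltaGV R - q.ν₁ - q.ν₂) -
      scaledEntropy (R - q.lam - q.σ) q.ν₁ - scaledEntropy (1 - R + q.lam) q.ν₂) := by
  have e : (1 - R + q.lam) / 2 * h (q.ω₂ / (1 - R + q.lam)) =
      1 / 2 * scaledEntropy (1 - R + q.lam) q.ω₂ := by rw [← mul_h_div]; ring
  simp only [beta, nuExp, countExp, piExp, e]
  simp only [mul_h_div]

/-- Four free rates and the weight on `N₂` determine a tuple. -/
def toRates (R : ℝ) (v : ℝ × ℝ × ℝ × ℝ × ℝ) : Rates :=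
  ⟨v.1, v.2.1, v.2.2.1, v.2.2.2.1, (R - v.2.2.2.1 - v.1) / 2, v.2.2.2.2⟩

theorem continuous_beta_toRates (R : ℝ) : Continuous fun v => beta R (toRates R v) := by
  simp only [beta_eq, toRates]
  have h1 : Continuous fun v : ℝ × ℝ × ℝ × ℝ × ℝ =>
      scaledEntropy (1 - R + v.2.2.2.1) v.2.2.2.2 :=
    continuous_scaledEntropy_comp (by fun_prop) (by fun_prop)
  have h2 : Continuous fun v : ℝ × ℝ × ℝ × ℝ × ℝ =>
      scaledEntropy v.1 (deltaGV R - v.2.1 - v.2.2.1) :=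
    continuous_scaledEntropy_comp (by fun_prop) (by fun_prop)
  have h3 : Continuous fun v : ℝ × ℝ × ℝ × ℝ × ℝ =>
      scaledEntropy (R - v.2.2.2.1 - v.1) v.2.1 :=
    continuous_scaledEntropy_comp (by fun_prop) (by fun_prop)
  have h4 : Continuous fun v : ℝ × ℝ × ℝ × ℝ × ℝ =>
      scaledEntropy (1 - R + v.2.2.2.1) v.2.2.1 :=
    continuous_scaledEntropy_comp (by fun_prop) (by fun_prop)
  fun_prop

theorem box_ratios {R : ℝ} (hR₀ : 0 < R) (hR₁ : R < 1) {q : Rates} (hq : q ∈ box R) :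
    0 < 1 - R + q.lam ∧ 0 ≤ q.ν₂ / (1 - R + q.lam) ∧
      q.ν₂ / (1 - R + q.lam) ≤ deltaGV R / (1 - R) ∧ q.ν₂ / (1 - R + q.lam) < 1 / 2 ∧
      0 ≤ q.ω₂ / (1 - R + q.lam) ∧ q.ω₂ / (1 - R + q.lam) ≤ 1 / 2 := by
  obtain ⟨h1, h2, h3, h4, h5, h6, h7, h8, h9, h10, h11⟩ := hq
  have := deltaGV_lt hR₀ hR₁
  have hp := deltaGV_pos hR₀ hR₁
  have hM : 0 < 1 - R + q.lam := by linarith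
  refine ⟨hM, by positivity, ?_, ?_, by positivity, ?_⟩
  · apply div_le_div₀ <;> linarith
  · rw [div_lt_iff₀ hM]; linarith
  · rw [div_le_iff₀ hM]; linarith

theorem deltaGV_div_lt {R : ℝ} (hR₀ : 0 < R) (hR₁ : R < 1) : deltaGV R / (1 - R) < 1 / 2 := by
  rw [div_lt_iff₀ (by linarith)]
  linarith [deltaGV_lt hR₀ hR₁]

theorem continuousOn_slack_toRates {R : ℝ} (hR₀ : 0 < R) (hR₁ : R < 1) :
    ContinuousOn (fun v => slack R (toRates R v)) (toRates R ⁻¹' box R) := by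
  have h3 : Continuous fun v : ℝ × ℝ × ℝ × ℝ × ℝ =>
      scaledEntropy (R - v.2.2.2.1 - v.1) v.2.1 :=
    continuous_scaledEntropy_comp (by fun_prop) (by fun_prop)
  have h4 : ContinuousOn (fun v : ℝ × ℝ × ℝ × ℝ × ℝ =>
      (v.2.2.1 / (1 - R + v.2.2.2.1), v.2.2.2.2 / (1 - R + v.2.2.2.1)))
      (toRates R ⁻¹' box R) := by
    refine ContinuousOn.prodMk (ContinuousOn.div (by fun_prop) (by fun_prop) ?_)
      (ContinuousOn.div (by fun_prop) (by fun_prop) ?_) <;>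
    exact fun v hv => (box_ratios hR₀ hR₁ hv).1.ne'
  have h5 := (continuousOn_krExp (deltaGV_div_lt hR₀ hR₁)).comp h4 (by
    intro v hv
    obtain ⟨-, h1, h2, -, h3, h4⟩ := box_ratios hR₀ hR₁ hv
    exact ⟨⟨h1, h2⟩, h3, h4⟩)
  simp only [slack, toRates]
  refine ((ContinuousOn.mul (by fun_prop) h5).sub (by fun_prop)).sub h3.continuousOn

theorem isCompact_box {R : ℝ} (hR₀ : 0 < R) (hR₁ : R < 1) :
    IsCompact (toRates R ⁻¹' box R) := by
  refine IsCompact.of_isClosed_subset (isCompact_Icc (a := (0 : ℝ × ℝ × ℝ × ℝ × ℝ)) (b := 1)) ?_ ?_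
  · simp only [box, toRates, Set.preimage_ofPred_eq]
    repeat' first
      | refine IsClosed.and ?_ ?_
      | exact isClosed_const
      | exact isClosed_le (by fun_prop) (by fun_prop)
  · rintro ⟨a, b, c, d, e⟩ ⟨h1, h2, h3, h4, h5, h6, h7, h8, h9, h10, h11⟩
    have := deltaGV_lt hR₀ hR₁
    simp only [toRates] at *
    refine ⟨⟨h1, h2, h3, h4, h5⟩, ?_, ?_, ?_, ?_, ?_⟩ <;> simp <;> linarith

theorem toRates_of_mem_box {R : ℝ} {q : Rates} (hq : q ∈ box R) :
    toRates R (q.σ, q.ν₁, q.ν₂, q.lam, q.ω₂) = q := by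
  obtain ⟨h1, h2, h3, h4, h5, h6, h7, h8, h9, h10, h11⟩ := hq
  cases q
  simp only [toRates] at *
  rw [h10]

theorem region_nonempty {R : ℝ} (hR₀ : 0 < R) (hR₁ : R < 1) : (region R).Nonempty := by
  have hp := deltaGV_pos hR₀ hR₁
  have hlt := deltaGV_lt hR₀ hR₁
  -- With σ = R and λ = 0 the block N₁ is empty, and with ω₂ = 0 every term of the slack is zero.
  refine ⟨⟨R, 0, deltaGV R, 0, 0, 0⟩, (mem_region_iff hR₀ hR₁ _).2 ⟨?_, ?_⟩⟩
  · refine ⟨?_, ?_, ?_, ?_, ?_, ?_, ?_, ?_, ?_, ?_, ?_⟩ <;> simp <;> linarith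
  · have h1 : deltaGV R / (1 - R) ≤ 1 / 2 := (deltaGV_div_lt hR₀ hR₁).le
    simp only [slack, add_zero, zero_div]
    rw [krExp_zero (div_nonneg hp.le (by linarith)) h1]
    simp [scaledEntropy]

/-- In the five free coordinates the region is a closed subset of a compact polytope, by continuity
of the slack, and β is continuous. -/
theorem isLeast_alphaDumer89 {R : ℝ} (hR₀ : 0 < R) (hR₁ : R < 1) :
    IsLeast (beta R '' region R) (alphaDumer89 R) := by
  have himg : beta R '' region R = (fun v => beta R (toRates R v)) ''
      (toRates R ⁻¹' box R ∩ (fun v => slack R (toRates R v)) ⁻¹' {0}) := by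
    ext y
    constructor
    · rintro ⟨q, hq, rfl⟩
      rw [mem_region_iff hR₀ hR₁] at hq
      have e := toRates_of_mem_box hq.1
      refine ⟨_, ⟨?_, ?_⟩, by dsimp only; rw [e]⟩
      · rw [Set.mem_preimage, e]; exact hq.1
      · rw [Set.mem_preimage, e]; exact hq.2
    · rintro ⟨v, hv, rfl⟩
      exact ⟨toRates R v, (mem_region_iff hR₀ hR₁ _).2 hv, rfl⟩
  have hc : IsCompact (toRates R ⁻¹' box R ∩ (fun v => slack R (toRates R v)) ⁻¹' {0}) :=
    (isCompact_box hR₀ hR₁).of_isClosed_subset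
      ((continuousOn_slack_toRates hR₀ hR₁).preimage_isClosed_of_isClosed
        (isCompact_box hR₀ hR₁).isClosed isClosed_singleton) Set.inter_subset_left
  have hne : (beta R '' region R).Nonempty := (region_nonempty hR₀ hR₁).image _
  rw [himg] at hne
  have := (hc.image (continuous_beta_toRates R)).isLeast_sInf hne
  rw [alphaDumer89, himg]
  exact this

theorem scaledEntropy_mono {a b c : ℝ} (ha : 0 ≤ a) (hb : 0 ≤ b) (hbc : b ≤ c) (hc : c ≤ a / 2) :
    scaledEntropy a b ≤ scaledEntropy a c := by
  rw [← mul_h_div, ← mul_h_div]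
  rcases ha.eq_or_lt with rfl | ha
  · simp
  · refine mul_le_mul_of_nonneg_left (h_strictMonoOn.monotoneOn ?_ ?_ (by gcongr)) ha.le
    · exact ⟨by positivity, by rw [div_le_iff₀ ha]; linarith⟩
    · exact ⟨div_nonneg (hb.trans hbc) ha.le, by rw [div_le_iff₀ ha]; linarith⟩

theorem beta_mono {R : ℝ} (hR₁ : R < 1) {a b c d e e' : ℝ} (hd : 0 ≤ d)
    (he : 0 ≤ e) (hee : e ≤ e') (he' : e' ≤ (1 - R + d) / 2) :
    beta R (toRates R (a, b, c, d, e)) ≤ beta R (toRates R (a, b, c, d, e')) := by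
  have := scaledEntropy_mono (by linarith) he hee he'
  simp only [beta_eq, toRates]
  gcongr

/-- Tuples with more samples than needed are no better than those of the region. -/
theorem alphaDumer89_le_beta {R : ℝ} (hR₀ : 0 < R) (hR₁ : R < 1) {q : Rates} (hq : q ∈ box R)
    (hs : 0 ≤ slack R q) : alphaDumer89 R ≤ beta R q := by
  have e := toRates_of_mem_box hq
  obtain ⟨hM, x0, -, x1, -, -⟩ := box_ratios hR₀ hR₁ hq
  have hbox : ∀ w ∈ Set.Icc 0 q.ω₂, toRates R (q.σ, q.ν₁, q.ν₂, q.lam, w) ∈ box R := by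
    obtain ⟨h1, h2, h3, h4, h5, h6, h7, h8, h9, h10, h11⟩ := hq
    rintro w ⟨hw0, hw1⟩
    exact ⟨h1, h2, h3, h4, hw0, h6, h7, h8, h9, rfl, hw1.trans h11⟩
  have hc : ContinuousOn (fun w => slack R (toRates R (q.σ, q.ν₁, q.ν₂, q.lam, w)))
      (Set.Icc 0 q.ω₂) :=
    (continuousOn_slack_toRates hR₀ hR₁).comp (by fun_prop) hbox
  obtain ⟨h1, h2, h3, h4, h5, h6, h7, h8, h9, h10, h11⟩ := hq
  -- With ω₂ = 0 nothing is gained on N₂ and the slack is nonpositive. The intermediate value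
  -- theorem then finds a smaller ω₂ with slack zero.
  have h0 : slack R (toRates R (q.σ, q.ν₁, q.ν₂, q.lam, 0)) ≤ 0 := by
    simp only [slack, toRates, zero_div]
    rw [krExp_zero x0 x1.le]
    linarith [scaledEntropy_nonneg h2 h7]
  obtain ⟨w, hw, hw'⟩ := intermediate_value_Icc h5 hc ⟨h0, by rw [e]; exact hs⟩
  calc alphaDumer89 R ≤ beta R (toRates R (q.σ, q.ν₁, q.ν₂, q.lam, w)) :=
        (isLeast_alphaDumer89 hR₀ hR₁).2
          ⟨_, (mem_region_iff hR₀ hR₁ _).2 ⟨hbox w hw, hw'⟩, rfl⟩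
    _ ≤ beta R (toRates R (q.σ, q.ν₁, q.ν₂, q.lam, q.ω₂)) :=
        beta_mono hR₁ h4 hw.1 hw.2 h11
    _ = beta R q := by rw [e]

/-! ### Perturbation into the interior -/

/-- Strict feasibility: all constraints hold with room to spare, and the weight on `N₂` is
below the first root of the Krawtchouk polynomial. -/
structure StrictlyFeasible (R : ℝ) (q : Rates) : Prop where
  σ_pos : 0 < q.σ
  ν₁_pos : 0 < q.ν₁
  ν₂_pos : 0 < q.ν₂
  lam_pos : 0 < q.lam
  sum_lt : q.σ + q.lam < R
  ν₁_lt : q.ν₁ < R - q.lam - q.σ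
  lt_sum : deltaGV R - q.σ < q.ν₁ + q.ν₂
  ν_sum_lt : q.ν₁ + q.ν₂ < deltaGV R
  ω₂_pos : 0 < q.ω₂
  ω₂_lt : q.ω₂ / (1 - R + q.lam) < omegaPerp (q.ν₂ / (1 - R + q.lam))
  slack_pos : 0 < slack R q

/-- The tuple at parameter `θ` on the segment from `q` to a proportional split, with
relative weight `ω` on `N₂`. -/
def segment (R : ℝ) (q : Rates) (θ ω : ℝ) : ℝ × ℝ × ℝ × ℝ × ℝ :=
  ((1 - θ) * q.σ + θ * (R / 3), (1 - θ) * q.ν₁ + θ * (deltaGV R * (R / 3)),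
    (1 - θ) * q.ν₂ + θ * (deltaGV R * (1 - R + R / 3)), (1 - θ) * q.lam + θ * (R / 3),
    ω * (1 - R + ((1 - θ) * q.lam + θ * (R / 3))))

theorem segment_zero {R : ℝ} (hR₀ : 0 < R) (hR₁ : R < 1) {q : Rates} (hq : q ∈ box R) :
    toRates R (segment R q 0 (q.ω₂ / (1 - R + q.lam))) = q := by
  have := (box_ratios hR₀ hR₁ hq).1.ne'
  rw [← toRates_of_mem_box hq]
  simp [segment, toRates]
  field_simp

/-- The far end of the segment has σ = λ = R - λ - σ = R/3 and errors spread in proportion to the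
block sizes. Each constraint holds there with room R/3, τR/3 or (1 - τ)R/3, and a proportion θ of
this room survives along the segment. -/
theorem segment_strict {R : ℝ} (hR₀ : 0 < R) (hR₁ : R < 1) {q : Rates} (hq : q ∈ box R) {θ ω : ℝ}
    (hθ₀ : 0 < θ) (hθ₁ : θ ≤ 1) :
    let q' := toRates R (segment R q θ ω)
    0 < q'.σ ∧ 0 < q'.ν₁ ∧ 0 < q'.ν₂ ∧ 0 < q'.lam ∧ q'.σ + q'.lam < R ∧
      q'.ν₁ < R - q'.lam - q'.σ ∧ deltaGV R - q'.σ < q'.ν₁ + q'.ν₂ ∧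
      q'.ν₁ + q'.ν₂ < deltaGV R := by
  obtain ⟨h1, h2, h3, h4, h5, h6, h7, h8, h9, h10, h11⟩ := hq
  have ht0 := deltaGV_pos hR₀ hR₁
  have ht1 : deltaGV R < 1 := by linarith [deltaGV_lt hR₀ hR₁]
  have hθ' : 0 ≤ 1 - θ := by linarith
  have hR' : 0 < 1 - R := by linarith
  have k1 : 0 < θ * R := by positivity
  have k2 : 0 < θ * R * deltaGV R := by positivity
  have k3 : 0 < θ * R * (1 - deltaGV R) := mul_pos k1 (by linarith)
  simp only [toRates, segment]
  refine ⟨by positivity, by positivity, by positivity, by positivity, ?_, ?_, ?_, ?_⟩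
  · nlinarith [mul_le_mul_of_nonneg_left h6 hθ']
  · nlinarith [mul_le_mul_of_nonneg_left h7 hθ']
  · nlinarith [mul_le_mul_of_nonneg_left h8 hθ']
  · nlinarith [mul_le_mul_of_nonneg_left h9 hθ']

theorem segment_mem_box {R : ℝ} (hR₀ : 0 < R) (hR₁ : R < 1) {q : Rates} (hq : q ∈ box R) {θ ω : ℝ}
    (hθ₀ : 0 ≤ θ) (hθ₁ : θ ≤ 1) (hω₀ : 0 ≤ ω) (hω₁ : ω ≤ 1 / 2) :
    toRates R (segment R q θ ω) ∈ box R := by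
  rcases hθ₀.eq_or_lt with rfl | hθ₀
  · have hM := (box_ratios hR₀ hR₁ hq).1
    obtain ⟨h1, h2, h3, h4, h5, h6, h7, h8, h9, h10, h11⟩ := hq
    simp only [box, toRates, segment, Set.mem_ofPred_eq]
    simp only [sub_zero, one_mul, zero_mul, add_zero]
    exact ⟨h1, h2, h3, h4, by positivity, h6, h7, h8, h9, trivial, by nlinarith⟩
  · obtain ⟨h1, h2, h3, h4, h5, h6, h7, h8⟩ := segment_strict hR₀ hR₁ hq hθ₀ hθ₁ (ω := ω)
    have hM : 0 < 1 - R + (toRates R (segment R q θ ω)).lam := by linarith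
    have e : (toRates R (segment R q θ ω)).ω₂ = ω * (1 - R + (toRates R (segment R q θ ω)).lam) :=
      rfl
    exact ⟨h1.le, h2.le, h3.le, h4.le, by rw [e]; positivity, by linarith, h6.le, h7.le, h8.le, rfl,
      by rw [e]; nlinarith⟩

/-- At the first root the exponent on N₂ is 1 - h(x), so the slack is 1 - R minus the entropies of
N₁ and N₂. Concavity at the Gilbert–Varshamov distance bounds the sum of the three block entropies
by 1 - R, which leaves at least the entropy of the secret block. -/
theorem slack_of_omegaPerp {R : ℝ} (hR₀ : 0 < R) (hR₁ : R < 1) {q : Rates} (hq : q ∈ box R)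
    (hω : omegaPerp (q.ν₂ / (1 - R + q.lam)) = q.ω₂ / (1 - R + q.lam)) :
    scaledEntropy q.σ (deltaGV R - q.ν₁ - q.ν₂) ≤ slack R q := by
  obtain ⟨hM, x0, -, x1, w0, w1⟩ := box_ratios hR₀ hR₁ hq
  obtain ⟨h1, h2, h3, h4, h5, h6, h7, h8, h9, h10, h11⟩ := hq
  have hlt := deltaGV_lt hR₀ hR₁
  rw [slack, krExp_of_ge x0 x1 w0 w1 ((omegaPerp_le_comm x0 x1.le w0 w1).2 hω.le), mul_sub,
    mul_h_div]
  have := scaledEntropy_add_le hR₀ hR₁ (s := q.σ) (a := R - q.lam - q.σ) (b := 1 - R + q.lam)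
    (u := deltaGV R - q.ν₁ - q.ν₂) (v := q.ν₁) (w := q.ν₂) (by ring) (by ring) (by linarith)
    (by linarith) h2 h7 h3 (by linarith)
  linarith

theorem tendsto_beta_segment (R : ℝ) (q : Rates) {ι : Type*} {F : Filter ι} {f g : ι → ℝ}
    {a b : ℝ} (hf : Tendsto f F (𝓝 a)) (hg : Tendsto g F (𝓝 b)) :
    Tendsto (fun i => beta R (toRates R (segment R q (f i) (g i)))) F
      (𝓝 (beta R (toRates R (segment R q a b)))) := by
  have hβ : Continuous fun v : ℝ × ℝ => beta R (toRates R (segment R q v.1 v.2)) :=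
    (continuous_beta_toRates R).comp (by unfold segment; fun_prop)
  have := Tendsto.comp (g := fun v : ℝ × ℝ => beta R (toRates R (segment R q v.1 v.2)))
    (hβ.tendsto (a, b)) (hf.prodMk_nhds hg)
  exact this

/-- Positive slack is gained in one of two ways. Below the first root the slack is strictly
increasing in ω₂, so a tiny increase suffices. At or above the root, lowering ω₂ to the root does
not increase β, and there the slack dominates an entropy that is positive in the interior.
Continuity then allows the remaining small moves. -/
theorem exists_strictlyFeasible {R : ℝ} (hR₀ : 0 < R) (hR₁ : R < 1) {q : Rates}
    (hq : q ∈ region R) {ε : ℝ} (hε : 0 < ε) :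
    ∃ q', StrictlyFeasible R q' ∧ beta R q' < beta R q + ε := by
  rw [mem_region_iff hR₀ hR₁] at hq
  obtain ⟨hq, hslack⟩ := hq
  obtain ⟨hM, x0, -, x1, w0, w1⟩ := box_ratios hR₀ hR₁ hq
  set 𝓕 : Filter ℝ := 𝓝[Set.Ioo 0 1] 0 with h𝓕
  have : 𝓕.NeBot := by
    rw [h𝓕, nhdsWithin_Ioo_eq_nhdsGT zero_lt_one]; infer_instance
  have hmem : ∀ᶠ θ in 𝓕, θ ∈ Set.Ioo (0 : ℝ) 1 := self_mem_nhdsWithin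
  have hid : Tendsto (fun θ : ℝ => θ) 𝓕 (𝓝 0) := tendsto_id.mono_left nhdsWithin_le_nhds
  let x : ℝ → ℝ := fun θ => ((1 - θ) * q.ν₂ + θ * (deltaGV R * (1 - R + R / 3))) /
    (1 - R + ((1 - θ) * q.lam + θ * (R / 3)))
  have hx_0 : x 0 = q.ν₂ / (1 - R + q.lam) := by simp [x]
  have hx : Tendsto x 𝓕 (𝓝 (q.ν₂ / (1 - R + q.lam))) := by
    rw [← hx_0]
    refine (ContinuousAt.div (by fun_prop) (by fun_prop) ?_).tendsto.mono_left nhdsWithin_le_nhds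
    simpa using hM.ne'
  have hs₁ : ∀ ω ∈ Set.Icc (0 : ℝ) (1 / 2),
      ContinuousOn (fun θ => slack R (toRates R (segment R q θ ω))) (Set.Icc 0 1) := fun ω hω =>
    (continuousOn_slack_toRates hR₀ hR₁).comp (f := fun θ => segment R q θ ω)
      (by unfold segment; fun_prop)
      fun θ hθ => segment_mem_box hR₀ hR₁ hq hθ.1 hθ.2 hω.1 hω.2
  have hs₂ : ∀ θ ∈ Set.Icc (0 : ℝ) 1,
      ContinuousOn (fun ω => slack R (toRates R (segment R q θ ω))) (Set.Icc 0 (1 / 2)) :=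
    fun θ hθ =>
    (continuousOn_slack_toRates hR₀ hR₁).comp (f := fun ω => segment R q θ ω)
      (by unfold segment; fun_prop)
      fun ω hω => segment_mem_box hR₀ hR₁ hq hθ.1 hθ.2 hω.1 hω.2
  have hratio : ∀ θ ∈ Set.Icc (0 : ℝ) 1, ∀ ω,
      (segment R q θ ω).2.2.2.2 / (1 - R + (segment R q θ ω).2.2.2.1) = ω := by
    intro θ hθ ω
    have : 0 < 1 - R + ((1 - θ) * q.lam + θ * (R / 3)) := by
      have := hq.2.2.2.1
      have := mul_nonneg (sub_nonneg.2 hθ.2) this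
      have := mul_nonneg hθ.1 hR₀.le
      linarith
    exact mul_div_cancel_right₀ ω this.ne'
  have build : ∀ θ ∈ Set.Ioo (0 : ℝ) 1, ∀ ω, 0 < ω → ω < omegaPerp (x θ) →
      0 < slack R (toRates R (segment R q θ ω)) →
      StrictlyFeasible R (toRates R (segment R q θ ω)) := by
    intro θ hθ ω hω hω' hpos
    obtain ⟨h1, h2, h3, h4, h5, h6, h7, h8⟩ := segment_strict hR₀ hR₁ hq hθ.1 hθ.2.le (ω := ω)
    refine ⟨h1, h2, h3, h4, h5, h6, h7, h8, ?_, ?_, hpos⟩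
    · exact mul_pos hω (by linarith : 0 < 1 - R + (toRates R (segment R q θ ω)).lam)
    · have e : (toRates R (segment R q θ ω)).ω₂ / (1 - R + (toRates R (segment R q θ ω)).lam) = ω :=
        hratio θ ⟨hθ.1.le, hθ.2.le⟩ ω
      rw [e]
      exact hω'
  rcases lt_or_ge (q.ω₂ / (1 - R + q.lam)) (omegaPerp (q.ν₂ / (1 - R + q.lam))) with hcase | hcase
  · -- below the first root: increase the weight on `N₂`
    have hβ0 : Tendsto (fun ω => beta R (toRates R (segment R q 0 ω)))
        (𝓝[>] (q.ω₂ / (1 - R + q.lam))) (𝓝 (beta R q)) := by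
      have := tendsto_beta_segment R q (tendsto_const_nhds (x := (0 : ℝ)))
        (tendsto_id.mono_left nhdsWithin_le_nhds :
          Tendsto id (𝓝[>] (q.ω₂ / (1 - R + q.lam))) (𝓝 (q.ω₂ / (1 - R + q.lam))))
      rwa [segment_zero hR₀ hR₁ hq] at this
    obtain ⟨ω, hω, hωβ⟩ := ((show ∀ᶠ ω in 𝓝[>] (q.ω₂ / (1 - R + q.lam)),
      ω ∈ Set.Ioo (q.ω₂ / (1 - R + q.lam)) (omegaPerp (q.ν₂ / (1 - R + q.lam))) from
      Ioo_mem_nhdsGT hcase).and (hβ0.eventually_lt_const (lt_add_of_pos_right _ hε))).exists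
    have hω1 : ω ≤ 1 / 2 := hω.2.le.trans (omegaPerp_le_half _)
    have hω0 : 0 < ω := w0.trans_lt hω.1
    have hpos : 0 < slack R (toRates R (segment R q 0 ω)) := by
      have hmono := krExp_strictMonoOn x0 x1 ⟨w0, hcase.le⟩ ⟨hω0.le, hω.2.le⟩ hω.1
      have h2 := hratio 0 (by simp) ω
      have e1 : slack R (toRates R (segment R q 0 ω)) = (1 - R + q.lam) *
          krExp (q.ν₂ / (1 - R + q.lam)) ω - q.lam - scaledEntropy (R - q.lam - q.σ) q.ν₁ := by
        simp only [slack, toRates, h2]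
        simp [segment]
      rw [e1]
      rw [slack] at hslack
      have := mul_lt_mul_of_pos_left hmono hM
      linarith
    have t1 : Tendsto (fun θ => beta R (toRates R (segment R q θ ω))) 𝓕
        (𝓝 (beta R (toRates R (segment R q 0 ω)))) :=
      tendsto_beta_segment R q hid tendsto_const_nhds
    have t2 : Tendsto (fun θ => slack R (toRates R (segment R q θ ω))) 𝓕
        (𝓝 (slack R (toRates R (segment R q 0 ω)))) :=
      (hs₁ ω ⟨hω0.le, hω1⟩ 0 (by simp)).mono_left (nhdsWithin_mono _ Set.Ioo_subset_Icc_self)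
    have t3 := (continuous_omegaPerp.tendsto _).comp hx
    obtain ⟨θ, hθ, a1, a2, a3⟩ := (hmem.and ((t1.eventually_lt_const hωβ).and
      ((t2.eventually_const_lt hpos).and (t3.eventually_const_lt hω.2)))).exists
    exact ⟨_, build θ hθ ω hω0 a3 a2, a1⟩
  · -- at or above the first root: go to the first root and below
    have hx1 : ∀ θ ∈ Set.Ioo (0 : ℝ) 1, 0 ≤ x θ ∧ x θ < 1 / 2 := by
      intro θ hθ
      obtain ⟨-, b0, -, b1, -, -⟩ := box_ratios hR₀ hR₁
        (segment_mem_box hR₀ hR₁ hq hθ.1.le hθ.2.le le_rfl (by norm_num : (0 : ℝ) ≤ 1 / 2))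
      exact ⟨b0, b1⟩
    have t3 := (continuous_omegaPerp.tendsto _).comp hx
    have t1 : Tendsto (fun θ => beta R (toRates R (segment R q θ (omegaPerp (x θ))))) 𝓕
        (𝓝 (beta R (toRates R (segment R q 0 (omegaPerp (q.ν₂ / (1 - R + q.lam))))))) := by
      exact tendsto_beta_segment R q hid t3
    have hle : beta R (toRates R (segment R q 0 (omegaPerp (q.ν₂ / (1 - R + q.lam))))) ≤
        beta R q := by
      conv_rhs => rw [← segment_zero hR₀ hR₁ hq]
      have hq4 := hq.2.2.2.1
      have hp := omegaPerp_pos x0 x1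
      simp only [segment, sub_zero, one_mul, zero_mul, add_zero]
      refine beta_mono hR₁ hq4 (by positivity) (by gcongr) ?_
      nlinarith
    obtain ⟨θ, hθ, hθβ⟩ := (hmem.and (t1.eventually_lt_const
      (hle.trans_lt (lt_add_of_pos_right _ hε)))).exists
    obtain ⟨y0, y1⟩ := hx1 θ hθ
    have hy := omegaPerp_pos y0 y1
    have hpos : 0 < slack R (toRates R (segment R q θ (omegaPerp (x θ)))) := by
      obtain ⟨h1, h2, h3, h4, h5, h6, h7, h8⟩ := segment_strict hR₀ hR₁ hq hθ.1 hθ.2.le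
        (ω := omegaPerp (x θ))
      refine lt_of_lt_of_le (scaledEntropy_pos ?_ ?_) (slack_of_omegaPerp hR₀ hR₁
        (segment_mem_box hR₀ hR₁ hq hθ.1.le hθ.2.le hy.le (omegaPerp_le_half _)) ?_)
      · linarith
      · linarith
      · exact (hratio θ ⟨hθ.1.le, hθ.2.le⟩ _).symm
    have t4 : Tendsto (fun ω => beta R (toRates R (segment R q θ ω)))
        (𝓝[Set.Ioo 0 (omegaPerp (x θ))] (omegaPerp (x θ)))
        (𝓝 (beta R (toRates R (segment R q θ (omegaPerp (x θ)))))) :=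
      tendsto_beta_segment R q tendsto_const_nhds
        (tendsto_id.mono_left nhdsWithin_le_nhds)
    have t5 : Tendsto (fun ω => slack R (toRates R (segment R q θ ω)))
        (𝓝[Set.Ioo 0 (omegaPerp (x θ))] (omegaPerp (x θ)))
        (𝓝 (slack R (toRates R (segment R q θ (omegaPerp (x θ)))))) := by
      exact (hs₂ θ ⟨hθ.1.le, hθ.2.le⟩ _ ⟨hy.le, omegaPerp_le_half _⟩).mono_left (nhdsWithin_mono _
        (Set.Ioo_subset_Icc_self.trans (Set.Icc_subset_Icc_right (omegaPerp_le_half _))))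
    have : (𝓝[Set.Ioo 0 (omegaPerp (x θ))] (omegaPerp (x θ))).NeBot := by
      rw [nhdsWithin_Ioo_eq_nhdsLT hy]; infer_instance
    obtain ⟨ω, hω, a1, a2⟩ := ((show ∀ᶠ ω in 𝓝[Set.Ioo 0 (omegaPerp (x θ))] (omegaPerp (x θ)),
      ω ∈ Set.Ioo 0 (omegaPerp (x θ)) from self_mem_nhdsWithin).and
      ((t4.eventually_lt_const hθβ).and (t5.eventually_const_lt hpos))).exists
    exact ⟨_, build θ hθ ω hω.1 hω.2 a2, a1⟩

end RLPN

end

noncomputable section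

namespace RLPN

open Polynomial

/-! ### Signs and characters -/

theorem zmod_two_cases (a : ZMod 2) : a = 0 ∨ a = 1 := by
  revert a; decide

theorem sgn_zero : sgn 0 = 1 := by simp [sgn]

theorem sgn_one : sgn 1 = -1 := by simp [sgn]

theorem sgn_add (a b : ZMod 2) : sgn (a + b) = sgn a * sgn b := by
  have h2 : (1 + 1 : ZMod 2) = 0 := by decide
  rcases zmod_two_cases a with rfl | rfl <;> rcases zmod_two_cases b with rfl | rfl <;>
    simp [sgn_zero, sgn_one, h2]

theorem sgn_mul_self (a : ZMod 2) : sgn a * sgn a = 1 := by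
  rcases zmod_two_cases a with rfl | rfl <;> simp [sgn_zero, sgn_one]

theorem abs_sgn (a : ZMod 2) : |sgn a| = 1 := by
  rcases zmod_two_cases a with rfl | rfl <;> simp [sgn_zero, sgn_one]

theorem sgn_sum {ι : Type*} (s : Finset ι) (f : ι → ZMod 2) :
    sgn (∑ i ∈ s, f i) = ∏ i ∈ s, sgn (f i) := by
  classical
  induction s using Finset.induction_on with
  | empty => simp [sgn_zero]
  | insert a s ha ih => rw [Finset.sum_insert ha, Finset.prod_insert ha, sgn_add, ih]

theorem sum_zmod_two {M : Type*} [AddCommMonoid M] (f : ZMod 2 → M) : ∑ b, f b = f 0 + f 1 :=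
  Fin.sum_univ_two f

theorem sum_words_prod {R : Type*} [CommSemiring R] {m : ℕ} (g : Fin m → ZMod 2 → R) :
    ∑ x : Word m, ∏ i, g i (x i) = ∏ i, (g i 0 + g i 1) := by
  have := Finset.prod_univ_sum (fun _ : Fin m => (Finset.univ : Finset (ZMod 2))) g
  rw [Fintype.piFinset_univ] at this
  rw [← this]
  exact Finset.prod_congr rfl fun i _ => sum_zmod_two _

/-! ### Krawtchouk polynomials -/

/-- The value at `u` of the binary Krawtchouk polynomial of order `m` and degree `w`. -/
def krawtchouk (m w u : ℕ) : ℝ := ((1 - X) ^ u * (1 + X) ^ (m - u) : ℝ[X]).coeff w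

theorem hammingNorm_eq_sum {m : ℕ} (x : Word m) :
    hammingNorm x = ∑ i, if x i = 0 then 0 else 1 := by
  rw [hammingNorm, Finset.card_filter]
  exact Finset.sum_congr rfl fun i _ => by by_cases h : x i = 0 <;> simp [h]

theorem hammingNorm_le {m : ℕ} (x : Word m) : hammingNorm x ≤ m := by
  simpa using hammingNorm_le_card_fintype (x := x)

/-- The generating function of the character sums over the words of given weight. -/
theorem sum_sgn_X_pow {m : ℕ} (y : Word m) :
    ∑ x : Word m, C (sgn (dotProduct y x)) * X ^ hammingNorm x =
      ((1 - X) ^ hammingNorm y * (1 + X) ^ (m - hammingNorm y) : ℝ[X]) := by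
  have h1 : ∀ x : Word m, (C (sgn (dotProduct y x)) * X ^ hammingNorm x : ℝ[X]) =
      ∏ i, (C (sgn (y i * x i)) * X ^ (if x i = 0 then 0 else 1)) := by
    intro x
    rw [Finset.prod_mul_distrib, Finset.prod_pow_eq_pow_sum, ← hammingNorm_eq_sum, dotProduct,
      sgn_sum, map_prod]
  simp only [h1]
  rw [sum_words_prod (fun i b => (C (sgn (y i * b)) * X ^ (if b = 0 then 0 else 1) : ℝ[X]))]
  have h2 : ∀ i, (C (sgn (y i * 0)) * X ^ (if (0 : ZMod 2) = 0 then 0 else 1) +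
      C (sgn (y i * 1)) * X ^ (if (1 : ZMod 2) = 0 then 0 else 1) : ℝ[X]) =
      if y i ≠ 0 then 1 - X else 1 + X := by
    intro i
    rcases zmod_two_cases (y i) with h | h <;> rw [h] <;> simp [sgn_zero, sgn_one]
    ring
  rw [Finset.prod_congr rfl fun i _ => h2 i, Finset.prod_ite, Finset.prod_const, Finset.prod_const]
  congr 2
  have h3 := Finset.card_filter_add_card_filter_not (s := (Finset.univ : Finset (Fin m)))
    (fun i => y i ≠ 0)
  rw [Finset.card_univ, Fintype.card_fin] at h3
  rw [hammingNorm]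
  omega

theorem sum_sgn_eq_krawtchouk {m : ℕ} (w : ℕ) (y : Word m) :
    ∑ x : Word m with hammingNorm x = w, sgn (dotProduct y x) =
      krawtchouk m w (hammingNorm y) := by
  rw [krawtchouk, ← sum_sgn_X_pow, finsetSum_coeff, Finset.sum_filter]
  refine Finset.sum_congr rfl fun x _ => ?_
  rw [coeff_C_mul, coeff_X_pow]
  by_cases h : hammingNorm x = w
  · simp [h]
  · simp [h, Ne.symm h]

theorem krawtchouk_zero (m w : ℕ) : krawtchouk m w 0 = m.choose w := by
  simp [krawtchouk, coeff_one_add_X_pow]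

theorem card_hammingNorm_eq (m w : ℕ) :
    (({x : Word m | hammingNorm x = w} : Finset (Word m)).card : ℝ) = m.choose w := by
  have := sum_sgn_eq_krawtchouk w (0 : Word m)
  rw [hammingNorm_zero, krawtchouk_zero] at this
  rw [← this]
  simp [sgn_zero]

/-- The word `1^u 0^(m-u)`. -/
def initialWord (m u : ℕ) : Word m := fun i => if (i : ℕ) < u then 1 else 0

theorem hammingNorm_initialWord {m u : ℕ} (hu : u ≤ m) : hammingNorm (initialWord m u) = u := by
  rw [hammingNorm]
  simp only [initialWord, ne_eq, ite_eq_right_iff, one_ne_zero, imp_false, not_not]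
  rw [Fin.card_filter_val_lt]
  exact min_eq_right hu

theorem wordBias_eq {m u : ℕ} (w : ℕ) (hu : u ≤ m) :
    wordBias m w u = krawtchouk m w u / m.choose w := by
  have h1 := sum_sgn_eq_krawtchouk w (initialWord m u)
  rw [hammingNorm_initialWord hu] at h1
  rw [wordBias, card_hammingNorm_eq, ← h1]
  rfl

theorem abs_krawtchouk_le {m u : ℕ} (w : ℕ) (hu : u ≤ m) :
    |krawtchouk m w u| ≤ m.choose w := by
  rw [← hammingNorm_initialWord hu, ← sum_sgn_eq_krawtchouk, ← card_hammingNorm_eq]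
  refine (Finset.abs_sum_le_sum_abs _ _).trans ?_
  simp [abs_sgn]

/-- Complementing all words multiplies every sign of the character sum by the same factor ±1. -/
theorem abs_krawtchouk_sub {m u w : ℕ} (hu : u ≤ m) (hw : w ≤ m) :
    |krawtchouk m (m - w) u| = |krawtchouk m w u| := by
  rw [← hammingNorm_initialWord hu, ← sum_sgn_eq_krawtchouk, ← sum_sgn_eq_krawtchouk]
  set y := initialWord m u
  have hflip : ∀ x : Word m, hammingNorm (x + 1) + hammingNorm x = m := by
    intro x
    have h3 := Finset.card_filter_add_card_filter_not (s := (Finset.univ : Finset (Fin m)))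
      (fun i => x i ≠ 0)
    rw [Finset.card_univ, Fintype.card_fin] at h3
    have h4 : hammingNorm (x + 1) = (Finset.univ.filter fun i => ¬x i ≠ 0).card := by
      rw [hammingNorm]
      congr 1
      ext i
      have h2 : (1 + 1 : ZMod 2) = 0 := by decide
      rcases zmod_two_cases (x i) with h | h <;> simp [h, h2]
    rw [h4, hammingNorm]
    omega
  have hone : (1 + 1 : Word m) = 0 := by
    funext i; exact (by decide : (1 + 1 : ZMod 2) = 0)
  have : ∑ x : Word m with hammingNorm x = m - w, sgn (dotProduct y x) =
      sgn (dotProduct y 1) * ∑ x : Word m with hammingNorm x = w, sgn (dotProduct y x) := by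
    rw [Finset.mul_sum]
    refine Finset.sum_bij' (fun x _ => x + 1) (fun x _ => x + 1) ?_ ?_ ?_ ?_ ?_
    · intro x hx
      simp only [Finset.mem_filter, Finset.mem_univ, true_and] at hx ⊢
      have := hflip x
      omega
    · intro x hx
      simp only [Finset.mem_filter, Finset.mem_univ, true_and] at hx ⊢
      have := hflip x
      omega
    · intro x _; rw [add_assoc, hone, add_zero]
    · intro x _; rw [add_assoc, hone, add_zero]
    · intro x _
      rw [dotProduct_add, sgn_add, mul_comm, mul_assoc, sgn_mul_self, mul_one]
  rw [this, abs_mul, abs_sgn, one_mul]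

/-! ### Orthogonality and reciprocity of the Krawtchouk values. -/

theorem sum_words_hammingNorm {m : ℕ} (f : ℕ → ℝ) :
    ∑ y : Word m, f (hammingNorm y) = ∑ u ∈ Finset.range (m + 1), m.choose u * f u := by
  rw [← Finset.sum_fiberwise_of_maps_to (t := Finset.range (m + 1)) (g := fun y => hammingNorm y)
    (fun y _ => Finset.mem_range.2 (Nat.lt_succ_of_le (hammingNorm_le y)))]
  refine Finset.sum_congr rfl fun u _ => ?_
  rw [← card_hammingNorm_eq, ← nsmul_eq_mul, ← Finset.sum_const]
  exact Finset.sum_congr rfl fun y hy => by rw [(Finset.mem_filter.1 hy).2]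

theorem sum_sgn_dotProduct {m : ℕ} (z : Word m) :
    ∑ y : Word m, sgn (dotProduct y z) = if z = 0 then 2 ^ m else 0 := by
  have h1 : ∀ y : Word m, sgn (dotProduct y z) = ∏ i, sgn (y i * z i) := fun y => by
    rw [dotProduct, sgn_sum]
  simp only [h1]
  rw [sum_words_prod (fun i b => sgn (b * z i))]
  split_ifs with hz
  · simp only [hz, Pi.zero_apply, mul_zero, sgn_zero]
    norm_num
  · obtain ⟨i, hi⟩ := Function.ne_iff.1 hz
    refine Finset.prod_eq_zero (Finset.mem_univ i) ?_
    rcases zmod_two_cases (z i) with h | h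
    · exact absurd h hi
    · simp [h, sgn_zero, sgn_one]

/-- Parseval's identity for the indicator of the words of weight w: in the expanded square only the
diagonal pairs survive the summation over y. -/
theorem sum_choose_mul_krawtchouk_sq (m w : ℕ) :
    ∑ u ∈ Finset.range (m + 1), m.choose u * krawtchouk m w u ^ 2 = 2 ^ m * m.choose w := by
  rw [← sum_words_hammingNorm (fun u => krawtchouk m w u ^ 2), ← card_hammingNorm_eq]
  simp only [← sum_sgn_eq_krawtchouk, sq, Finset.sum_mul_sum]
  rw [Finset.sum_comm]
  have hinner : ∀ x : Word m, ∑ y : Word m, ∑ x' : Word m with hammingNorm x' = w,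
      sgn (dotProduct y x) * sgn (dotProduct y x') =
      ∑ x' : Word m with hammingNorm x' = w, if x' = x then 2 ^ m else 0 := by
    intro x
    rw [Finset.sum_comm]
    refine Finset.sum_congr rfl fun x' _ => ?_
    simp only [← sgn_add, ← dotProduct_add, sum_sgn_dotProduct]
    have hself : x + x = 0 := by
      funext i
      rcases zmod_two_cases (x i) with h | h <;> simp [h]
      decide
    have : x + x' = 0 ↔ x' = x := by
      constructor
      · intro h
        have := congrArg (x + ·) h
        simpa [← add_assoc, hself] using this
      · rintro rfl; exact hself
    simp [this]
  simp only [hinner]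
  simp only [Finset.sum_ite_eq', Finset.mem_filter, Finset.mem_univ, true_and]
  rw [Finset.sum_congr rfl (g := fun _ => (2 : ℝ) ^ m)
    (fun x hx => by rw [if_pos (Finset.mem_filter.1 hx).2]), Finset.sum_const, nsmul_eq_mul]
  ring

/-- Both sides sum the sign of ⟨y, x⟩ over all y of weight u and x of weight w. -/
theorem choose_mul_krawtchouk {m u w : ℕ} :
    m.choose u * krawtchouk m w u = m.choose w * krawtchouk m u w := by
  have key : ∀ a b, ∑ y : Word m with hammingNorm y = a, ∑ x : Word m with hammingNorm x = b,
      sgn (dotProduct y x) = m.choose a * krawtchouk m b a := by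
    intro a b
    simp only [sum_sgn_eq_krawtchouk]
    rw [← card_hammingNorm_eq, ← nsmul_eq_mul, ← Finset.sum_const]
    exact Finset.sum_congr rfl fun y hy => by rw [(Finset.mem_filter.1 hy).2]
  rw [← key, ← key, Finset.sum_comm]
  simp only [dotProduct_comm]

/-- Orthogonality with the roles of degree and argument exchanged by reciprocity. Now the error
weight u is fixed and the parity-check weight w varies, so every single term is bounded by the sum
and the largest is at least a fraction 1/(m + 1) of it. -/
theorem sum_krawtchouk_sq_div {m u : ℕ} (hu : u ≤ m) :
    ∑ w ∈ Finset.range (m + 1), krawtchouk m w u ^ 2 / m.choose w = 2 ^ m / m.choose u := by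
  have h0 : (0 : ℝ) < m.choose u := by exact_mod_cast Nat.choose_pos hu
  have h1 := sum_choose_mul_krawtchouk_sq m u
  rw [eq_div_iff h0.ne', ← mul_left_inj' h0.ne', ← h1, mul_assoc, ← sq, Finset.sum_mul]
  refine Finset.sum_congr rfl fun w hw => ?_
  have hw0 : (0 : ℝ) < m.choose w := by
    exact_mod_cast Nat.choose_pos (Nat.lt_succ_iff.1 (Finset.mem_range.1 hw))
  rw [div_mul_eq_mul_div, ← mul_pow, mul_comm (krawtchouk m w u), choose_mul_krawtchouk,
    div_eq_iff hw0.ne']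
  ring

theorem krawtchouk_sq_div_le {m u w : ℕ} (hu : u ≤ m) (hw : w ≤ m) :
    krawtchouk m w u ^ 2 / m.choose w ≤ 2 ^ m / m.choose u := by
  rw [← sum_krawtchouk_sq_div hu]
  exact Finset.single_le_sum (f := fun w => krawtchouk m w u ^ 2 / m.choose w)
    (fun i _ => by positivity) (Finset.mem_range.2 (Nat.lt_succ_of_le hw))

theorem exists_krawtchouk_sq_div_ge {m u : ℕ} (hu : u ≤ m) :
    ∃ w ≤ m, 2 ^ m / m.choose u ≤ (m + 1) * (krawtchouk m w u ^ 2 / m.choose w) := by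
  obtain ⟨w, hw, hmax⟩ := Finset.exists_max_image (Finset.range (m + 1))
    (fun w => krawtchouk m w u ^ 2 / m.choose w) ⟨0, by simp⟩
  refine ⟨w, Nat.lt_succ_iff.1 (Finset.mem_range.1 hw), ?_⟩
  rw [← sum_krawtchouk_sq_div hu]
  have := Finset.sum_le_card_nsmul _ _ _ hmax
  simpa using this

/-! ### Bounds from the generating function -/

/-- The generating function at r is a sum of m + 1 terms, so the largest absolute value among them
is at least the average. -/
theorem exists_krawtchouk_mul_pow_ge {m u : ℕ} (hu : u ≤ m) {r : ℝ} (hr : 0 < r) :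
    ∃ w ≤ m, (1 - r) ^ u * (1 + r) ^ (m - u) ≤ (m + 1) * (|krawtchouk m w u| * r ^ w) := by
  obtain ⟨w, hw, hmax⟩ := Finset.exists_max_image (Finset.range (m + 1))
    (fun w => |krawtchouk m w u| * r ^ w) ⟨0, by simp⟩
  refine ⟨w, Nat.lt_succ_iff.1 (Finset.mem_range.1 hw), ?_⟩
  have hdeg : ((1 - X) ^ u * (1 + X) ^ (m - u) : ℝ[X]).natDegree < m + 1 := by
    rw [Nat.lt_succ_iff]
    refine natDegree_mul_le.trans ?_
    have h1 : ((1 - X) ^ u : ℝ[X]).natDegree ≤ u * 1 :=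
      natDegree_pow_le_of_le u ((natDegree_sub_le _ _).trans (by simp))
    have h2 : ((1 + X) ^ (m - u) : ℝ[X]).natDegree ≤ (m - u) * 1 :=
      natDegree_pow_le_of_le _ ((natDegree_add_le _ _).trans (by simp))
    omega
  have heval := eval_eq_sum_range' hdeg r
  simp only [eval_mul, eval_pow, eval_sub, eval_add, eval_one, eval_X] at heval
  rw [heval]
  have := Finset.sum_le_card_nsmul _ _ _ hmax
  rw [Finset.card_range, nsmul_eq_mul] at this
  push_cast at this
  refine le_trans (Finset.sum_le_sum fun i _ => ?_) this
  rw [krawtchouk]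
  gcongr
  exact le_abs_self _

theorem iteratedDeriv_polynomial (p : ℂ[X]) (n : ℕ) :
    iteratedDeriv n (fun z => p.eval z) = fun z => (derivative^[n] p).eval z := by
  induction n with
  | zero => simp
  | succ n ih =>
    rw [iteratedDeriv_succ, ih]
    funext z
    rw [Polynomial.deriv, Function.iterate_succ_apply']

/-- Cauchy's estimate for the derivatives at the centre of a circle. -/
theorem norm_coeff_mul_pow_le (p : ℂ[X]) (n : ℕ) {r B : ℝ} (hr : 0 < r)
    (hB : ∀ z : ℂ, ‖z‖ = r → ‖p.eval z‖ ≤ B) : ‖p.coeff n‖ * r ^ n ≤ B := by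
  have h1 := Complex.norm_iteratedDeriv_le_of_forall_mem_sphere_norm_le (c := 0) (C := B)
    (f := fun z => p.eval z) n hr (p.differentiable.diffContOnCl)
    (fun z hz => hB z (by simpa using hz))
  rw [iteratedDeriv_polynomial] at h1
  have h2 : (derivative^[n] p).eval 0 = n.factorial * p.coeff n := by
    rw [← coeff_zero_eq_eval_zero, coeff_iterate_derivative, zero_add, Nat.descFactorial_self,
      nsmul_eq_mul]
  simp only [h2, norm_mul, Complex.norm_natCast] at h1
  have h3 : (0 : ℝ) < n.factorial := by exact_mod_cast n.factorial_pos
  rw [mul_div_assoc] at h1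
  have h4 := le_of_mul_le_mul_left h1 h3
  rwa [le_div_iff₀ (by positivity)] at h4

/-- On the circle |1 - z|² = (1 - r)² + d and |1 + z|² = (1 + r)² - d with the same d ≥ 0. After 1 +
t ≤ exp t in both factors, the condition on r says precisely that the total exponent is nonpositive,
so the maximum is at the positive real point. -/
theorem norm_one_sub_pow_mul_le {m u : ℕ} {r : ℝ} (hr₀ : 0 < r) (hr₁ : r < 1) (hu : u ≤ m)
    (hcond : u * (1 + r) ^ 2 ≤ (m - u : ℝ) * (1 - r) ^ 2) {z : ℂ} (hz : ‖z‖ = r) :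
    ‖1 - z‖ ^ u * ‖1 + z‖ ^ (m - u) ≤ (1 - r) ^ u * (1 + r) ^ (m - u) := by
  have hsq : z.re ^ 2 + z.im ^ 2 = r ^ 2 := by
    rw [← hz, Complex.sq_norm, Complex.normSq_apply]; ring
  set d := 2 * (r - z.re) with hd
  have hre : z.re ≤ r := hz ▸ Complex.re_le_norm z
  have hd0 : 0 ≤ d := by linarith
  have e1 : ‖1 - z‖ ^ 2 = (1 - r) ^ 2 + d := by
    rw [Complex.sq_norm, Complex.normSq_apply]
    simp only [Complex.sub_re, Complex.one_re, Complex.sub_im, Complex.one_im]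
    linear_combination hsq
  have e2 : ‖1 + z‖ ^ 2 = (1 + r) ^ 2 - d := by
    rw [Complex.sq_norm, Complex.normSq_apply]
    simp only [Complex.add_re, Complex.one_re, Complex.add_im, Complex.one_im]
    linear_combination hsq
  have hA1 : 0 < 1 - r := by linarith
  have hA : 0 < (1 - r) ^ 2 := by positivity
  have hBp : 0 < (1 + r) ^ 2 := by positivity
  have b1 : ‖1 - z‖ ^ 2 ≤ (1 - r) ^ 2 * Real.exp (d / (1 - r) ^ 2) := by
    have := Real.add_one_le_exp (d / (1 - r) ^ 2)
    calc ‖1 - z‖ ^ 2 = (1 - r) ^ 2 * (d / (1 - r) ^ 2 + 1) := by rw [e1]; have := hA1.ne'; field_simp; ring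
      _ ≤ _ := by gcongr
  have b2 : ‖1 + z‖ ^ 2 ≤ (1 + r) ^ 2 * Real.exp (-d / (1 + r) ^ 2) := by
    have := Real.add_one_le_exp (-d / (1 + r) ^ 2)
    calc ‖1 + z‖ ^ 2 = (1 + r) ^ 2 * (-d / (1 + r) ^ 2 + 1) := by rw [e2]; field_simp; ring
      _ ≤ _ := by gcongr
  refine le_of_sq_le_sq ?_ (by positivity)
  calc (‖1 - z‖ ^ u * ‖1 + z‖ ^ (m - u)) ^ 2
      = (‖1 - z‖ ^ 2) ^ u * (‖1 + z‖ ^ 2) ^ (m - u) := by ring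
    _ ≤ ((1 - r) ^ 2 * Real.exp (d / (1 - r) ^ 2)) ^ u *
        ((1 + r) ^ 2 * Real.exp (-d / (1 + r) ^ 2)) ^ (m - u) := by gcongr
    _ = ((1 - r) ^ u * (1 + r) ^ (m - u)) ^ 2 *
        Real.exp (u * (d / (1 - r) ^ 2) + (m - u : ℕ) * (-d / (1 + r) ^ 2)) := by
        rw [Real.exp_add, Real.exp_nat_mul, Real.exp_nat_mul]
        generalize 1 - r = A
        generalize 1 + r = B
        ring
    _ ≤ ((1 - r) ^ u * (1 + r) ^ (m - u)) ^ 2 * 1 := by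
        gcongr
        rw [Real.exp_le_one_iff, Nat.cast_sub hu]
        have : u * (d / (1 - r) ^ 2) + (m - u : ℝ) * (-d / (1 + r) ^ 2) =
            d * (u * (1 + r) ^ 2 - (m - u) * (1 - r) ^ 2) / ((1 - r) ^ 2 * (1 + r) ^ 2) := by
          have := hA1.ne'
          field_simp
          ring
        rw [this]
        apply div_nonpos_of_nonpos_of_nonneg _ (by positivity)
        exact mul_nonpos_of_nonneg_of_nonpos hd0 (by linarith)
    _ = _ := mul_one _

theorem abs_krawtchouk_mul_pow_le {m u : ℕ} (w : ℕ) {r : ℝ} (hr₀ : 0 < r) (hr₁ : r < 1) (hu : u ≤ m)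
    (hcond : u * (1 + r) ^ 2 ≤ (m - u : ℝ) * (1 - r) ^ 2) :
    |krawtchouk m w u| * r ^ w ≤ (1 - r) ^ u * (1 + r) ^ (m - u) := by
  have h1 := norm_coeff_mul_pow_le
    (((1 - X) ^ u * (1 + X) ^ (m - u) : ℝ[X]).map Complex.ofRealHom) w hr₀
    (B := (1 - r) ^ u * (1 + r) ^ (m - u)) (by
      intro z hz
      simp only [Polynomial.map_mul, Polynomial.map_pow, Polynomial.map_sub, Polynomial.map_add,
        Polynomial.map_one, map_X, eval_mul, eval_pow, eval_sub, eval_add, eval_one, eval_X,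
        norm_mul, norm_pow]
      exact norm_one_sub_pow_mul_le hr₀ hr₁ hu hcond hz)
  rw [coeff_map] at h1
  simpa [krawtchouk] using h1

end RLPN

end

noncomputable section

namespace RLPN

/-! ### Counting words by their weights on blocks -/

/-- The support of a word. -/
def supp {n : ℕ} (d : Word n) : Finset (Fin n) := {i | d i ≠ 0}

theorem mem_supp {n : ℕ} {d : Word n} {i : Fin n} : i ∈ supp d ↔ d i ≠ 0 := by simp [supp]

theorem card_supp {n : ℕ} (d : Word n) : (supp d).card = hammingNorm d := rfl

/-- The word with support `S`. -/
def ofSupp {n : ℕ} (S : Finset (Fin n)) : Word n := fun i => if i ∈ S then 1 else 0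

theorem supp_ofSupp {n : ℕ} (S : Finset (Fin n)) : supp (ofSupp S) = S := by
  ext i; simp [mem_supp, ofSupp]

theorem ofSupp_supp {n : ℕ} (d : Word n) : ofSupp (supp d) = d := by
  funext i
  rcases zmod_two_cases (d i) with h | h <;> simp [ofSupp, mem_supp, h]

theorem card_words_supp {n : ℕ} (P : Finset (Fin n) → Prop) [DecidablePred P] :
    ({d : Word n | P (supp d)} : Finset (Word n)).card =
      ({S | P S} : Finset (Finset (Fin n))).card :=
  Finset.card_nbij' supp ofSupp (fun d hd => by simpa using hd)
    (fun S hS => by simpa [supp_ofSupp] using hS) (fun d _ => ofSupp_supp d)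
    (fun S _ => supp_ofSupp S)

theorem card_subsets_blocks {α κ : Type*} [Fintype α] [DecidableEq α] [Fintype κ] [DecidableEq κ]
    (c : α → κ) (T : κ → Finset (Finset α)) (hT : ∀ j, ∀ S ∈ T j, ∀ i ∈ S, c i = j) :
    ({S | ∀ j, S.filter (c · = j) ∈ T j} : Finset (Finset α)).card = ∏ j, (T j).card := by
  rw [← Fintype.card_piFinset]
  refine Finset.card_nbij' (fun S j => S.filter (c · = j))
    (fun f => Finset.univ.filter fun i => i ∈ f (c i)) ?_ ?_ ?_ ?_
  · intro S hS
    simpa using hS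
  · intro f hf
    replace hf := Fintype.mem_piFinset.1 (Finset.mem_coe.1 hf)
    simp only [Finset.coe_filter, Finset.mem_univ, true_and, Set.mem_ofPred_eq]
    intro j
    convert hf j using 1
    ext i
    simp only [Finset.mem_filter, Finset.mem_univ, true_and]
    constructor
    · rintro ⟨h1, rfl⟩; exact h1
    · intro h1
      have := hT j _ (hf j) i h1
      exact ⟨this ▸ h1, this⟩
  · intro S _
    ext i
    simp
  · intro f hf
    replace hf := Fintype.mem_piFinset.1 (Finset.mem_coe.1 hf)
    funext j
    ext i
    simp only [Finset.mem_filter, Finset.mem_univ, true_and]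
    constructor
    · rintro ⟨h1, rfl⟩; exact h1
    · intro h1
      have := hT j _ (hf j) i h1
      exact ⟨this ▸ h1, this⟩

/-- The number of subsets with prescribed sizes on some blocks. -/
theorem card_subsets_sizes {α κ : Type*} [Fintype α] [DecidableEq α] [Fintype κ] [DecidableEq κ]
    (c : α → κ) (a : κ → Option ℕ) :
    ({S | ∀ j, ∀ b ∈ a j, (S.filter (c · = j)).card = b} : Finset (Finset α)).card =
      ∏ j, (match a j with
        | none => 2 ^ (Finset.univ.filter (c · = j)).card
        | some b => (Finset.univ.filter (c · = j)).card.choose b) := by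
  set T : κ → Finset (Finset α) := fun j => match a j with
    | none => (Finset.univ.filter (c · = j)).powerset
    | some b => (Finset.univ.filter (c · = j)).powersetCard b with hTdef
  have hsub : ∀ (S : Finset α) j, S.filter (c · = j) ⊆ Finset.univ.filter (c · = j) :=
    fun S j => Finset.filter_subset_filter _ (Finset.subset_univ S)
  have hT : ∀ j, ∀ S ∈ T j, ∀ i ∈ S, c i = j := by
    intro j S hS i hi
    simp only [hTdef] at hS
    rcases h : a j with _ | b <;> rw [h] at hS
    · simpa using Finset.mem_powerset.1 hS hi
    · simpa using (Finset.mem_powersetCard.1 hS).1 hi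
  have h1 := card_subsets_blocks c T hT
  have h2 : (Finset.univ.filter fun S : Finset α => ∀ j, S.filter (c · = j) ∈ T j) =
      Finset.univ.filter fun S : Finset α => ∀ j, ∀ b ∈ a j, (S.filter (c · = j)).card = b := by
    ext S
    simp only [Finset.mem_filter, Finset.mem_univ, true_and]
    refine forall_congr' fun j => ?_
    simp only [hTdef]
    rcases h : a j with _ | b
    · simp [hsub]
    · simp [Finset.mem_powersetCard, hsub]
  rw [← h2, h1]
  refine Finset.prod_congr rfl fun j _ => ?_
  simp only [hTdef]
  rcases h : a j with _ | b
  · rw [Finset.card_powerset]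
  · rw [Finset.card_powersetCard]

theorem card_perm_Ico {n : ℕ} (perm : Equiv.Perm (Fin n)) {a b : ℕ} (hb : b ≤ n) :
    ({i | a ≤ (perm i : ℕ) ∧ (perm i : ℕ) < b} : Finset (Fin n)).card = b - a := by
  rw [← Nat.card_Ico]
  refine Finset.card_nbij (fun i => (perm i : ℕ)) (fun i hi => by simpa using hi) ?_ ?_
  · intro i _ j _ hij
    exact perm.injective (Fin.ext hij)
  · intro j hj
    simp only [Finset.coe_Ico, Set.mem_Ico] at hj
    exact ⟨perm.symm ⟨j, hj.2.trans_le hb⟩, by simpa using hj, by simp⟩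

namespace Params

variable {n k : ℕ} (p : Params n k)

theorem sum_sizes : p.s + p.m₁ + p.m₂ = n := by
  have h1 := p.size_le
  have h2 := p.dim_le
  simp only [m₁, m₂]
  omega

theorem mem_setN₁ (perm : Equiv.Perm (Fin n)) (i : Fin n) :
    i ∈ p.setN₁ perm ↔ p.s ≤ (perm i : ℕ) ∧ (perm i : ℕ) < p.s + p.m₁ := by
  simp [setN₁]

theorem mem_setN₂ (perm : Equiv.Perm (Fin n)) (i : Fin n) :
    i ∈ p.setN₂ perm ↔ p.s + p.m₁ ≤ (perm i : ℕ) := by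
  simp only [setN₂, setN₂a, setN₂b, Finset.mem_union, Finset.mem_filter, Finset.mem_univ, true_and]
  omega

/-- The block of a position: `P`, `N₁`, and the halves of `N₂`. -/
def block (perm : Equiv.Perm (Fin n)) (i : Fin n) : Fin 4 :=
  if (perm i : ℕ) < p.s then 0 else if (perm i : ℕ) < p.s + p.m₁ then 1
  else if (perm i : ℕ) < p.s + p.m₁ + p.m₂ / 2 then 2 else 3

theorem block_eq_zero (perm : Equiv.Perm (Fin n)) (i : Fin n) :
    p.block perm i = 0 ↔ (perm i : ℕ) < p.s := by
  unfold block; split_ifs <;> simp_all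

theorem block_eq_one (perm : Equiv.Perm (Fin n)) (i : Fin n) :
    p.block perm i = 1 ↔ i ∈ p.setN₁ perm := by
  simp only [setN₁, Finset.mem_filter, Finset.mem_univ, true_and]
  unfold block; split_ifs <;> simp <;> omega

theorem block_eq_two (perm : Equiv.Perm (Fin n)) (i : Fin n) :
    p.block perm i = 2 ↔ i ∈ p.setN₂a perm := by
  simp only [setN₂a, Finset.mem_filter, Finset.mem_univ, true_and]
  unfold block; split_ifs <;> simp <;> omega

theorem block_eq_three (perm : Equiv.Perm (Fin n)) (i : Fin n) :
    p.block perm i = 3 ↔ i ∈ p.setN₂b perm := by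
  simp only [setN₂b, Finset.mem_filter, Finset.mem_univ, true_and]
  unfold block; split_ifs <;> simp <;> omega

theorem card_setP (perm : Equiv.Perm (Fin n)) :
    ({i | (perm i : ℕ) < p.s} : Finset (Fin n)).card = p.s := by
  have := card_perm_Ico perm (a := 0) p.s_le
  simpa using this

theorem card_setN₁ (perm : Equiv.Perm (Fin n)) : (p.setN₁ perm).card = p.m₁ := by
  have := p.sum_sizes
  rw [setN₁, card_perm_Ico perm (by omega)]
  omega

theorem card_setN₂a (perm : Equiv.Perm (Fin n)) : (p.setN₂a perm).card = p.m₂ / 2 := by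
  have := p.sum_sizes
  rw [setN₂a, card_perm_Ico perm (by omega)]
  omega

theorem card_setN₂b (perm : Equiv.Perm (Fin n)) : (p.setN₂b perm).card = p.m₂ - p.m₂ / 2 := by
  have h := p.sum_sizes
  have := card_perm_Ico perm (a := p.s + p.m₁ + p.m₂ / 2) (le_refl n)
  simp only [Fin.is_lt, and_true] at this
  rw [setN₂b, this]
  omega

theorem weightOn_eq {A : Finset (Fin n)} (x : Word n) : weightOn A x = (supp x ∩ A).card := by
  rw [weightOn]
  congr 1
  ext i
  simp [mem_supp, and_comm]

/-- The number of words with prescribed weights on some of the blocks. -/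
theorem card_words_weights (perm : Equiv.Perm (Fin n)) (a b : ℕ) :
    ({d : Word n | weightOn (p.setN₂a perm) d = a ∧ weightOn (p.setN₂b perm) d = b} :
      Finset (Word n)).card =
      2 ^ (p.s + p.m₁) * ((p.m₂ / 2).choose a * (p.m₂ - p.m₂ / 2).choose b) := by
  have h := card_subsets_sizes (p.block perm) ![none, none, some a, some b]
  simp only [Fin.prod_univ_four, Fin.forall_fin_succ, Matrix.cons_val_zero, Matrix.cons_val_succ,
    Matrix.cons_val_one, Matrix.cons_val, IsEmpty.forall_iff, and_true, Option.mem_def,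
    reduceCtorEq, implies_true, true_and, Option.some.injEq, forall_eq', Fin.succ_zero_eq_one,
    Fin.succ_one_eq_two] at h
  have e3 : (Fin.succ 2 : Fin 4) = 3 := rfl
  simp only [e3, block_eq_zero, block_eq_one, block_eq_two, block_eq_three, card_setP,
    Finset.filter_mem_eq_inter, Finset.univ_inter, card_setN₁, card_setN₂a, card_setN₂b] at h
  simp only [weightOn_eq]
  rw [card_words_supp (fun S => (S ∩ p.setN₂a perm).card = a ∧ (S ∩ p.setN₂b perm).card = b), h]
  ring

theorem card_words_weights' (perm : Equiv.Perm (Fin n)) (w a b : ℕ) :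
    ({d : Word n | weightOn (p.setN₁ perm) d = w ∧ weightOn (p.setN₂a perm) d = a ∧
      weightOn (p.setN₂b perm) d = b} : Finset (Word n)).card =
      2 ^ p.s * p.m₁.choose w * ((p.m₂ / 2).choose a * (p.m₂ - p.m₂ / 2).choose b) := by
  have h := card_subsets_sizes (p.block perm) ![none, some w, some a, some b]
  simp only [Fin.prod_univ_four, Fin.forall_fin_succ, Matrix.cons_val_zero, Matrix.cons_val_succ,
    Matrix.cons_val_one, Matrix.cons_val, IsEmpty.forall_iff, and_true, Option.mem_def,
    reduceCtorEq, implies_true, true_and, Option.some.injEq, forall_eq', Fin.succ_zero_eq_one,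
    Fin.succ_one_eq_two] at h
  have e3 : (Fin.succ 2 : Fin 4) = 3 := rfl
  simp only [e3, block_eq_zero, block_eq_one, block_eq_two, block_eq_three, card_setP,
    Finset.filter_mem_eq_inter, Finset.univ_inter, card_setN₁, card_setN₂a, card_setN₂b] at h
  simp only [weightOn_eq]
  rw [card_words_supp (fun S => (S ∩ p.setN₁ perm).card = w ∧ (S ∩ p.setN₂a perm).card = a ∧
    (S ∩ p.setN₂b perm).card = b), h]
  ring

theorem card_words_supported {A : Finset (Fin n)} (w : ℕ) :
    ({x | (∀ i, i ∉ A → x i = 0) ∧ hammingNorm x = w} : Finset (Word n)).card =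
      A.card.choose w := by
  have h := card_words_supp (n := n) (fun S => S ⊆ A ∧ S.card = w)
  have e : (Finset.univ.filter fun x : Word n => (∀ i, i ∉ A → x i = 0) ∧ hammingNorm x = w) =
      Finset.univ.filter fun d : Word n => supp d ⊆ A ∧ (supp d).card = w := by
    ext x
    rw [Finset.mem_filter, Finset.mem_filter]
    simp only [Finset.mem_univ, true_and, card_supp]
    refine and_congr_left fun _ => ?_
    simp only [Finset.subset_iff, mem_supp]
    exact forall_congr' fun i => ⟨fun h hx => by_contra fun hi => hx (h hi),
      fun h hi => by_contra fun hx => hi (h hx)⟩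
  rw [e, h, ← Finset.card_powersetCard]
  congr 1
  ext S
  simp [Finset.mem_powersetCard]

theorem card_list₁ (perm : Equiv.Perm (Fin n)) :
    (p.list₁ perm).card = (p.m₂ / 2).choose (p.w₂ / 2) := by
  rw [list₁, card_words_supported, card_setN₂a]

theorem card_list₂ (perm : Equiv.Perm (Fin n)) :
    (p.list₂ perm).card = (p.m₂ - p.m₂ / 2).choose (p.w₂ - p.w₂ / 2) := by
  rw [list₂, card_words_supported, card_setN₂b]

/-- The words whose restriction to `N₂` is a sum of elements of the two lists. -/
def candidates (perm : Equiv.Perm (Fin n)) : Finset (Word n) :=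
  {d : Word n | weightOn (p.setN₂a perm) d = p.w₂ / 2 ∧
    weightOn (p.setN₂b perm) d = p.w₂ - p.w₂ / 2}

/-- The halves of N₂ are disjoint, so a sum of list elements determines each summand on its half.
The coordinates outside N₂ are unconstrained. -/
theorem mem_candidates_iff (perm : Equiv.Perm (Fin n)) (d : Word n) :
    (∃ x₁ ∈ p.list₁ perm, ∃ x₂ ∈ p.list₂ perm, ∀ i ∈ p.setN₂ perm, d i = x₁ i + x₂ i) ↔
      d ∈ p.candidates perm := by
  have hdisj : ∀ i, i ∈ p.setN₂a perm → i ∉ p.setN₂b perm := by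
    intro i hi hi'
    rw [← block_eq_two] at hi
    rw [← block_eq_three, hi] at hi'
    exact absurd hi' (by decide)
  have wt : ∀ (A : Finset (Fin n)) (x : Word n), (∀ i, i ∉ A → x i = 0) →
      weightOn A x = hammingNorm x := by
    intro A x hx
    rw [weightOn, hammingNorm]
    congr 1
    ext i
    simp only [Finset.mem_filter, Finset.mem_univ, true_and, and_iff_right_iff_imp]
    exact fun h => by_contra fun hi => h (hx i hi)
  have wc : ∀ (A : Finset (Fin n)) (x y : Word n), (∀ i ∈ A, x i = y i) →
      weightOn A x = weightOn A y := by
    intro A x y hxy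
    rw [weightOn, weightOn]
    congr 1
    exact Finset.filter_congr fun i hi => by rw [hxy i hi]
  simp only [candidates, list₁, list₂, Finset.mem_filter, Finset.mem_univ, true_and, setN₂,
    Finset.mem_union]
  constructor
  · rintro ⟨x₁, ⟨h1, h2⟩, x₂, ⟨h3, h4⟩, h5⟩
    constructor
    · rw [← h2, ← wt _ _ h1]
      refine wc _ _ _ fun i hi => ?_
      rw [h5 i (Or.inl hi), h3 i (hdisj i hi), add_zero]
    · rw [← h4, ← wt _ _ h3]
      refine wc _ _ _ fun i hi => ?_
      rw [h5 i (Or.inr hi), h1 i (fun h => hdisj i h hi), zero_add]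
  · rintro ⟨h1, h2⟩
    refine ⟨fun i => if i ∈ p.setN₂a perm then d i else 0, ⟨fun i hi => by simp [hi], ?_⟩,
      fun i => if i ∈ p.setN₂b perm then d i else 0, ⟨fun i hi => by simp [hi], ?_⟩, ?_⟩
    · rw [← h1, ← wt (p.setN₂a perm) _ (fun i hi => by simp [hi])]
      exact wc _ _ _ fun i hi => by simp [hi]
    · rw [← h2, ← wt (p.setN₂b perm) _ (fun i hi => by simp [hi])]
      exact wc _ _ _ fun i hi => by simp [hi]
    · rintro i (hi | hi)
      · simp [hi, hdisj i hi]
      · have : i ∉ p.setN₂a perm := fun h => hdisj i h hi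
        simp [hi, this]

theorem card_candidates (perm : Equiv.Perm (Fin n)) : (p.candidates perm).card =
    2 ^ (p.s + p.m₁) * ((p.m₂ / 2).choose (p.w₂ / 2) *
      (p.m₂ - p.m₂ / 2).choose (p.w₂ - p.w₂ / 2)) :=
  p.card_words_weights perm _ _

theorem card_candidates_filter (perm : Equiv.Perm (Fin n)) :
    ((p.candidates perm).filter (fun d => weightOn (p.setN₁ perm) d = p.w₁)).card =
    2 ^ p.s * p.m₁.choose p.w₁ * ((p.m₂ / 2).choose (p.w₂ / 2) *
      (p.m₂ - p.m₂ / 2).choose (p.w₂ - p.w₂ / 2)) := by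
  rw [← p.card_words_weights' perm]
  congr 1
  ext d
  simp only [candidates, Finset.mem_filter, Finset.mem_univ, true_and]
  tauto

end Params

/-! ### The success probability -/

/-- Composition with a permutation that carries S to S' is a bijection between the two sets. -/
theorem card_perm_map_eq {n : ℕ} (E S S' : Finset (Fin n)) (h : S.card = S'.card) :
    ({perm | E.map perm.toEmbedding = S} : Finset (Equiv.Perm (Fin n))).card =
      ({perm | E.map perm.toEmbedding = S'} : Finset (Equiv.Perm (Fin n))).card := by
  obtain ⟨g, hg⟩ : ∃ g : Equiv.Perm (Fin n), S.map g.toEmbedding = S' := by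
    let f : {x // x ∈ S} ≃ {x // x ∈ S'} := Finset.equivOfCardEq h
    refine ⟨f.extendSubtype, Finset.eq_of_subset_of_card_le ?_ (by rw [Finset.card_map, h])⟩
    intro x hx
    obtain ⟨y, hy, rfl⟩ := Finset.mem_map.1 hx
    exact f.extendSubtype_mem y hy
  have hg' : S'.map g.symm.toEmbedding = S := by
    rw [← hg, Finset.map_map]
    convert Finset.map_refl
    ext x
    simp
  refine Finset.card_nbij' (fun perm => perm.trans g) (fun perm => perm.trans g.symm) ?_ ?_ ?_ ?_
  · intro perm hp
    simp only [Finset.coe_filter, Finset.mem_univ, true_and, Set.mem_ofPred_eq] at hp ⊢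
    rw [← hg, ← hp, Finset.map_map]; rfl
  · intro perm hp
    simp only [Finset.coe_filter, Finset.mem_univ, true_and, Set.mem_ofPred_eq] at hp ⊢
    rw [← hg', ← hp, Finset.map_map]; rfl
  · intro perm _; ext x; simp
  · intro perm _; ext x; simp

/-- The image of a fixed set under a uniformly random permutation is uniform. -/
theorem card_perm_filter_map {n : ℕ} (E : Finset (Fin n)) (Q : Finset (Fin n) → Prop)
    [DecidablePred Q] :
    ({perm | Q (E.map perm.toEmbedding)} : Finset (Equiv.Perm (Fin n))).card * n.choose E.card =
      Fintype.card (Equiv.Perm (Fin n)) *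
        ({S | S.card = E.card ∧ Q S} : Finset (Finset (Fin n))).card := by
  set c := ({perm | E.map perm.toEmbedding = E} : Finset (Equiv.Perm (Fin n))).card
  have key : ∀ (Q : Finset (Fin n) → Prop) [DecidablePred Q],
      ({perm | Q (E.map perm.toEmbedding)} : Finset (Equiv.Perm (Fin n))).card =
      ({S | S.card = E.card ∧ Q S} : Finset (Finset (Fin n))).card * c := by
    intro Q _
    rw [Finset.card_eq_sum_card_fiberwise (f := fun perm : Equiv.Perm (Fin n) =>
      E.map perm.toEmbedding) (t := ({S | S.card = E.card ∧ Q S} : Finset (Finset (Fin n))))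
      (by intro perm hp
          simp only [Finset.coe_filter, Finset.mem_univ, true_and, Set.mem_ofPred_eq] at hp ⊢
          exact ⟨Finset.card_map _, hp⟩)]
    rw [Finset.sum_congr rfl (g := fun _ => c), Finset.sum_const, smul_eq_mul]
    intro S hS
    simp only [Finset.mem_filter, Finset.mem_univ, true_and] at hS
    rw [show c = _ from (card_perm_map_eq E S E hS.1).symm, Finset.filter_filter]
    congr 1
    ext perm
    simp only [Finset.mem_filter, Finset.mem_univ, true_and, and_iff_right_iff_imp]
    rintro rfl; exact hS.2
  have h1 := key Q
  have h2 := key (fun _ => True)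
  have h3 : ({S | S.card = E.card ∧ True} : Finset (Finset (Fin n))).card = n.choose E.card := by
    have := Finset.card_powersetCard E.card (Finset.univ : Finset (Fin n))
    rw [Finset.card_univ, Fintype.card_fin] at this
    rw [← this]
    congr 1
    ext S
    simp [Finset.mem_powersetCard]
  rw [h3] at h2
  simp only [Finset.filter_true, Finset.card_univ] at h2
  rw [h1, h2]
  ring

namespace Params

variable {n k : ℕ} (p : Params n k)

/-- The case distinction guards against truncated subtraction: for u₁ + u₂ > t the formula would
read a weight 0 on the secret block instead of giving 0. -/
theorem card_sizes (t : ℕ) : ({S : Finset (Fin n) | S.card = t ∧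
      (S ∩ p.setN₁ 1).card = p.u₁ ∧ (S ∩ p.setN₂ 1).card = p.u₂} :
      Finset (Finset (Fin n))).card =
    if p.u₁ + p.u₂ ≤ t then
      p.s.choose (t - p.u₁ - p.u₂) * p.m₁.choose p.u₁ * p.m₂.choose p.u₂ else 0 := by
  let c : Fin n → Fin 3 := fun i => if (i : ℕ) < p.s then 0
    else if (i : ℕ) < p.s + p.m₁ then 1 else 2
  have c0 : ∀ i, c i = 0 ↔ (i : ℕ) < p.s := by
    intro i; simp only [c]; split_ifs <;> simp_all
  have c1 : ∀ i, c i = 1 ↔ i ∈ p.setN₁ 1 := by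
    intro i
    rw [mem_setN₁, Equiv.Perm.one_apply]
    simp only [c]
    split_ifs <;> simp <;> omega
  have c2 : ∀ i, c i = 2 ↔ i ∈ p.setN₂ 1 := by
    intro i
    rw [mem_setN₂, Equiv.Perm.one_apply]
    simp only [c]
    split_ifs <;> simp <;> omega
  have n2 : (p.setN₂ 1).card = p.m₂ := by
    rw [setN₂, Finset.card_union_of_disjoint, card_setN₂a, card_setN₂b]
    · omega
    · rw [Finset.disjoint_left]
      intro i hi hi'
      simp only [setN₂a, setN₂b, Finset.mem_filter, Finset.mem_univ, true_and] at hi hi'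
      omega
  have n0 : ({i : Fin n | (i : ℕ) < p.s} : Finset (Fin n)).card = p.s := by
    rw [Fin.card_filter_val_lt]
    exact min_eq_right p.s_le
  have hsum : ∀ S : Finset (Fin n), S.card = (S.filter fun i : Fin n => (i : ℕ) < p.s).card +
      (S ∩ p.setN₁ 1).card + (S ∩ p.setN₂ 1).card := by
    intro S
    have := Finset.card_eq_sum_card_fiberwise (f := c) (s := S) (t := Finset.univ) (by simp)
    rw [this, Fin.sum_univ_three]
    simp only [c0, c1, c2, Finset.filter_mem_eq_inter]
  split_ifs with h
  · have hc := card_subsets_sizes c ![some (t - p.u₁ - p.u₂), some p.u₁, some p.u₂]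
    simp only [Fin.prod_univ_three, Fin.forall_fin_succ, Matrix.cons_val_zero, Matrix.cons_val_succ,
      Matrix.cons_val_one, Matrix.cons_val, IsEmpty.forall_iff, and_true, Option.mem_def,
      Option.some.injEq, forall_eq', Fin.succ_zero_eq_one, Fin.succ_one_eq_two, c0, c1, c2, Finset.filter_mem_eq_inter, Finset.univ_inter, n0, n2,
      card_setN₁] at hc
    rw [← hc]
    congr 1
    ext S
    simp only [Finset.mem_filter, Finset.mem_univ, true_and]
    have := hsum S
    omega
  · rw [Finset.card_eq_zero, Finset.filter_eq_empty_iff]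
    intro S _
    have := hsum S
    omega

theorem succProb_eq (e : Word n) :
    p.succProb e = (if p.u₁ + p.u₂ ≤ hammingNorm e then
      ((p.s.choose (hammingNorm e - p.u₁ - p.u₂) : ℝ) * p.m₁.choose p.u₁ * p.m₂.choose p.u₂)
      else 0) / n.choose (hammingNorm e) := by
  have h := card_perm_filter_map (supp e) (fun S : Finset (Fin n) =>
    (S ∩ p.setN₁ 1).card = p.u₁ ∧ (S ∩ p.setN₂ 1).card = p.u₂)
  rw [card_supp, p.card_sizes] at h
  have e1 : ∀ perm : Equiv.Perm (Fin n), ((supp e).map perm.toEmbedding ∩ p.setN₁ 1).card =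
      weightOn (p.setN₁ perm) e := by
    intro perm
    rw [weightOn_eq, ← Finset.card_map perm.toEmbedding (s := supp e ∩ _)]
    congr 1
    ext i
    simp only [mem_setN₁, Finset.mem_inter, Finset.mem_map_equiv, Equiv.Perm.one_apply,
      Equiv.apply_symm_apply]
  have e2 : ∀ perm : Equiv.Perm (Fin n), ((supp e).map perm.toEmbedding ∩ p.setN₂ 1).card =
      weightOn (p.setN₂ perm) e := by
    intro perm
    rw [weightOn_eq, ← Finset.card_map perm.toEmbedding (s := supp e ∩ _)]
    congr 1
    ext i
    simp only [mem_setN₂, Finset.mem_inter, Finset.mem_map_equiv, Equiv.Perm.one_apply,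
      Equiv.apply_symm_apply]
  simp only [e1, e2] at h
  have hc : (0 : ℝ) < n.choose (hammingNorm e) := by
    exact_mod_cast Nat.choose_pos (hammingNorm_le e)
  have hn : (0 : ℝ) < Fintype.card (Equiv.Perm (Fin n)) := by exact_mod_cast Fintype.card_pos
  rw [succProb, div_eq_div_iff hn.ne' hc.ne']
  have h' := congrArg (Nat.cast : ℕ → ℝ) h
  push_cast at h'
  rw [h']
  ring

end Params

end RLPN

end

noncomputable section

namespace RLPN

open Matrix

/-! ### Random parity-check matrices -/

theorem card_fiber_mul_card {G M : Type*} [AddCommGroup G] [Fintype G] [AddCommGroup M] [Fintype M]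
    [DecidableEq M] (f : G →+ M) (hf : Function.Surjective f) (y : M) :
    ({g | f g = y} : Finset G).card * Fintype.card M = Fintype.card G := by
  have h := Finset.card_eq_sum_card_fiberwise (f := f) (s := (Finset.univ : Finset G))
    (t := Finset.univ) (by simp)
  rw [Finset.card_univ] at h
  rw [h, Finset.sum_congr rfl (g := fun _ => ({g | f g = y} : Finset G).card)]
  · rw [Finset.sum_const, Finset.card_univ, smul_eq_mul, mul_comm]
  · intro z _
    exact AddMonoidHom.card_fiber_eq_of_mem_range f (hf z) (hf y)

section Counting

variable {r n : ℕ}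

theorem card_vecMul_eq {a : Word r} (ha : a ≠ 0) (d : Word n) :
    ({H : Matrix (Fin r) (Fin n) (ZMod 2) | a ᵥ* H = d} : Finset _).card * 2 ^ n =
      Fintype.card (Matrix (Fin r) (Fin n) (ZMod 2)) := by
  let f : Matrix (Fin r) (Fin n) (ZMod 2) →+ Word n :=
    ⟨⟨fun H => a ᵥ* H, vecMul_zero a⟩, fun A B => vecMul_add A B a⟩
  have hf : Function.Surjective f := by
    intro q
    obtain ⟨i, hi⟩ := Function.ne_iff.1 ha
    refine ⟨vecMulVec (Pi.single i 1) q, ?_⟩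
    change a ᵥ* vecMulVec (Pi.single i 1) q = q
    rw [vecMul_vecMulVec, dotProduct_single, mul_one, (zmod_two_cases (a i)).resolve_left hi,
      one_smul]
  have := card_fiber_mul_card f hf d
  have e : (Finset.univ.filter fun H => f H = d) =
      Finset.univ.filter fun H : Matrix (Fin r) (Fin n) (ZMod 2) => a ᵥ* H = d := by
    ext H
    rw [Finset.mem_filter, Finset.mem_filter]
    rfl
  rw [e] at this
  simpa using this

/-- Pairwise independence of the messages: over F₂ distinct nonzero a and b are linearly
independent, so H ↦ (aH, bH) is surjective and all its fibres have the same size. A coordinate where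
a and b differ is 1 in one of them and 0 in the other, which gives preimages explicitly. -/
theorem card_vecMul_eq_and {a b : Word r} (ha : a ≠ 0) (hb : b ≠ 0) (hab : a ≠ b) (d : Word n) :
    ({H : Matrix (Fin r) (Fin n) (ZMod 2) | a ᵥ* H = d ∧ b ᵥ* H = d} : Finset _).card *
      (2 ^ n * 2 ^ n) = Fintype.card (Matrix (Fin r) (Fin n) (ZMod 2)) := by
  let f : Matrix (Fin r) (Fin n) (ZMod 2) →+ Word n × Word n :=
    ⟨⟨fun H => (a ᵥ* H, b ᵥ* H), by simp⟩, fun A B => by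
      change (a ᵥ* (A + B), b ᵥ* (A + B)) = (a ᵥ* A, b ᵥ* A) + (a ᵥ* B, b ᵥ* B)
      rw [vecMul_add, vecMul_add, Prod.mk_add_mk]⟩
  have key : ∀ a b : Word r, b ≠ 0 → ∀ i, a i = 1 → b i = 0 → ∀ p q : Word n,
      ∃ H : Matrix (Fin r) (Fin n) (ZMod 2), a ᵥ* H = p ∧ b ᵥ* H = q := by
    intro a b hb i hai hbi p q
    obtain ⟨j, hj⟩ := Function.ne_iff.1 hb
    have hbj : b j = 1 := (zmod_two_cases (b j)).resolve_left hj
    refine ⟨vecMulVec (Pi.single j 1) q + vecMulVec (Pi.single i 1) (p - a j • q), ?_, ?_⟩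
    · simp [vecMul_add, vecMul_vecMulVec, hai]
    · simp [vecMul_add, vecMul_vecMulVec, hbi, hbj]
  have hf : Function.Surjective f := by
    rintro ⟨p, q⟩
    obtain ⟨i, hi⟩ := Function.ne_iff.1 hab
    rcases zmod_two_cases (a i) with h1 | h1
    · have h2 : b i = 1 := (zmod_two_cases (b i)).resolve_left fun h => hi (h1.trans h.symm)
      obtain ⟨H, h3, h4⟩ := key b a ha i h2 h1 q p
      exact ⟨H, Prod.ext h4 h3⟩
    · have h2 : b i = 0 := (zmod_two_cases (b i)).resolve_right fun h => hi (h1.trans h.symm)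
      obtain ⟨H, h3, h4⟩ := key a b hb i h1 h2 p q
      exact ⟨H, Prod.ext h3 h4⟩
  have := card_fiber_mul_card f hf (d, d)
  have e : (Finset.univ.filter fun H => f H = (d, d)) =
      Finset.univ.filter fun H : Matrix (Fin r) (Fin n) (ZMod 2) => a ᵥ* H = d ∧ b ᵥ* H = d := by
    ext H
    rw [Finset.mem_filter, Finset.mem_filter]
    exact and_congr_right fun _ => Prod.mk_inj
  rw [e] at this
  simpa using this

end Counting

/-- The dual code is the row space. -/
theorem mem_dual_code_iff {n k : ℕ} (H : PCMatrix n k) (d : Word n) :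
    d ∈ dual (code H) ↔ ∃ a, a ᵥ* H = d := by
  constructor
  · intro hd
    let φ : Module.Dual (ZMod 2) (Word n) := dotProductBilin (ZMod 2) (ZMod 2) d
    have hφ : ∀ x, φ x = dotProduct d x := fun x => rfl
    have hmem : φ ∈ (LinearMap.ker H.mulVecLin).dualAnnihilator := by
      rw [Submodule.mem_dualAnnihilator]
      intro c hc
      rw [hφ, dotProduct_comm]
      exact hd c (by simpa [code] using hc)
    rw [← LinearMap.range_dualMap_eq_dualAnnihilator_ker] at hmem
    obtain ⟨ψ, hψ⟩ := hmem
    refine ⟨fun i => ψ (Pi.single i 1), ?_⟩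
    funext j
    have h1 : φ (Pi.single j 1) = d j := by rw [hφ, dotProduct_single, mul_one]
    rw [← h1, ← hψ, LinearMap.dualMap_apply, mulVecLin_apply, mulVec_single_one]
    have h2 : H.col j = ∑ i, H i j • (Pi.single i 1 : Word (n - k)) := by
      funext i
      simp [Finset.sum_apply, Pi.single_apply]
    rw [h2, map_sum]
    simp only [map_smul, smul_eq_mul, vecMul, dotProduct]
    exact Finset.sum_congr rfl fun i _ => mul_comm _ _
  · rintro ⟨a, rfl⟩ c hc
    rw [dotProduct_comm, ← dotProduct_mulVec]
    have : H *ᵥ c = 0 := hc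
    rw [this, dotProduct_zero]

open Classical in
/-- The number of parity-check matrices of which `d` is a parity-check. -/
def dualCount (n k : ℕ) (d : Word n) : ℕ :=
  ({H : PCMatrix n k | d ∈ dual (code H)} : Finset _).card

theorem card_pcMatrix_pos (n k : ℕ) : (0 : ℝ) < Fintype.card (PCMatrix n k) := by
  exact_mod_cast Fintype.card_pos

/-- Union bound: at most 2^(n - k) messages, each of which encodes to d with probability 2^(-n).
Since d ≠ 0, the zero message is excluded. -/
theorem dualCount_le {n k : ℕ} (hk : k ≤ n) {d : Word n} (hd : d ≠ 0) :
    (dualCount n k d : ℝ) ≤ Fintype.card (PCMatrix n k) / 2 ^ k := by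
  classical
  have h1 : dualCount n k d ≤ ∑ a : Word (n - k) with a ≠ 0,
      ({H : PCMatrix n k | a ᵥ* H = d} : Finset _).card := by
    refine le_trans (Finset.card_le_card ?_) Finset.card_biUnion_le
    intro H hH
    obtain ⟨a, ha⟩ := (mem_dual_code_iff H d).1 (Finset.mem_filter.1 hH).2
    refine Finset.mem_biUnion.2 ⟨a, ?_, by simpa using ha⟩
    simp only [Finset.mem_filter, Finset.mem_univ, true_and]
    rintro rfl
    rw [zero_vecMul] at ha
    exact hd ha.symm
  have h2 : (∑ a : Word (n - k) with a ≠ 0, ({H : PCMatrix n k | a ᵥ* H = d} : Finset _).card) *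
      2 ^ n ≤ 2 ^ (n - k) * Fintype.card (PCMatrix n k) := by
    rw [Finset.sum_mul, Finset.sum_congr rfl (fun a ha =>
      card_vecMul_eq (Finset.mem_filter.1 ha).2 d), Finset.sum_const, smul_eq_mul]
    refine Nat.mul_le_mul_right _ ((Finset.card_le_univ _).trans ?_)
    simp
  have h3 : dualCount n k d * 2 ^ k ≤ Fintype.card (PCMatrix n k) := by
    have e : 2 ^ n = 2 ^ (n - k) * 2 ^ k := by rw [← pow_add]; congr 1; omega
    have := (Nat.mul_le_mul_right (2 ^ n) h1).trans h2
    rw [e] at this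
    refine Nat.le_of_mul_le_mul_left ?_ (Nat.two_pow_pos (n - k))
    calc 2 ^ (n - k) * (dualCount n k d * 2 ^ k) = dualCount n k d * (2 ^ (n - k) * 2 ^ k) := by
          ring
      _ ≤ _ := this
  rw [le_div_iff₀ (by positivity)]
  exact_mod_cast h3

/-- Second moment method for the number X of nonzero messages a with aH = d. By Cauchy–Schwarz the
probability of X > 0 is at least μ/(1 + μ), where μ is the mean. The factor 4 pays for 2^(n - k) - 1
≥ 2^(n - k)/2, which needs k < n, and for 1 + μ ≤ 2. -/
theorem le_dualCount {n k : ℕ} (hk : k < n) (d : Word n) :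
    (Fintype.card (PCMatrix n k) : ℝ) / 2 ^ k / 4 ≤ dualCount n k d := by
  classical
  set c : ℝ := (Fintype.card (PCMatrix n k) : ℝ) with hc
  have hcpos : 0 < c := card_pcMatrix_pos n k
  set A : Finset (Word (n - k)) := {a | a ≠ 0} with hA
  set D : Finset (PCMatrix n k) := {H | d ∈ dual (code H)} with hD
  have hAcard : (A.card : ℝ) = 2 ^ (n - k) - 1 := by
    have : A = Finset.univ.erase 0 := by ext a; simp [hA]
    rw [this, Finset.card_erase_of_mem (Finset.mem_univ _), Finset.card_univ,
      Nat.cast_sub Fintype.card_pos]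
    simp
  set q : ℝ := 2 ^ n with hq
  have hqpos : 0 < q := by positivity
  set μ : ℝ := A.card / q with hμ
  let X : PCMatrix n k → ℝ := fun H => ∑ a ∈ A, if a ᵥ* H = d then 1 else 0
  have hX0 : ∀ H, H ∉ D → X H = 0 := by
    intro H hH
    refine Finset.sum_eq_zero fun a _ => if_neg fun h => hH ?_
    simp only [hD, Finset.mem_filter, Finset.mem_univ, true_and]
    exact (mem_dual_code_iff H d).2 ⟨a, h⟩
  have hsum1 : ∑ H ∈ D, X H = c * μ := by
    rw [Finset.sum_subset (Finset.subset_univ D) (fun H _ h => hX0 H h), Finset.sum_comm]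
    rw [Finset.sum_congr rfl (g := fun _ => c / q), Finset.sum_const, nsmul_eq_mul, hμ]
    · ring
    · intro a ha
      have h := card_vecMul_eq (Finset.mem_filter.1 ha).2 d
      rw [eq_div_iff hqpos.ne', Finset.sum_boole, hc, ← h]
      push_cast; rfl
  have hsum2 : ∑ H ∈ D, X H ^ 2 ≤ c * μ + c * μ ^ 2 := by
    calc ∑ H ∈ D, X H ^ 2 ≤ ∑ H, X H ^ 2 :=
          Finset.sum_le_sum_of_subset_of_nonneg (Finset.subset_univ D) fun _ _ _ => sq_nonneg _
      _ = ∑ a ∈ A, ∑ b ∈ A, ∑ H : PCMatrix n k,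
            (if a ᵥ* H = d then (1 : ℝ) else 0) * (if b ᵥ* H = d then 1 else 0) := by
          simp only [X, sq, Finset.sum_mul_sum]
          rw [Finset.sum_comm]
          exact Finset.sum_congr rfl fun a _ => Finset.sum_comm
      _ ≤ ∑ a ∈ A, ∑ b ∈ A, ((if b = a then c / q else 0) + c / q ^ 2) := by
          refine Finset.sum_le_sum fun a ha => Finset.sum_le_sum fun b hb => ?_
          have ha' := (Finset.mem_filter.1 ha).2
          have hb' := (Finset.mem_filter.1 hb).2
          split_ifs with hba
          · subst hba
            have h := card_vecMul_eq ha' d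
            have : ∑ H : PCMatrix n k, (if b ᵥ* H = d then (1 : ℝ) else 0) *
                (if b ᵥ* H = d then 1 else 0) = c / q := by
              rw [eq_div_iff hqpos.ne']
              simp only [mul_ite, mul_one, mul_zero, ← ite_and, and_self]
              rw [Finset.sum_boole, hc, ← h]
              push_cast; rfl
            rw [this]
            have : 0 ≤ c / q ^ 2 := by positivity
            linarith
          · have h := card_vecMul_eq_and ha' hb' (Ne.symm hba) d
            refine le_of_eq ?_
            rw [zero_add, eq_div_iff (by positivity)]
            have : ∀ H : PCMatrix n k, (if a ᵥ* H = d then (1 : ℝ) else 0) *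
                (if b ᵥ* H = d then 1 else 0) = if a ᵥ* H = d ∧ b ᵥ* H = d then 1 else 0 := by
              intro H; split_ifs <;> simp_all
            simp only [this]
            rw [Finset.sum_boole, hc, ← h, sq]
            push_cast; rfl
      _ = c * μ + c * μ ^ 2 := by
          simp only [Finset.sum_add_distrib, Finset.sum_ite_eq', Finset.sum_const, nsmul_eq_mul]
          rw [Finset.sum_congr rfl (g := fun _ => c / q) (fun a ha => if_pos ha), Finset.sum_const,
            nsmul_eq_mul, hμ]
          field_simp
  have hCS := sq_sum_le_card_mul_sum_sq (s := D) (f := X)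
  rw [hsum1] at hCS
  have hM : (2 : ℝ) ≤ 2 ^ (n - k) := by
    calc (2 : ℝ) = 2 ^ 1 := by norm_num
      _ ≤ 2 ^ (n - k) := by gcongr <;> [norm_num; omega]
  have hqe : q = 2 ^ (n - k) * 2 ^ k := by rw [hq, ← pow_add]; congr 1; omega
  have hμlow : 1 / 2 ^ k / 2 ≤ μ := by
    rw [hμ, hAcard, hqe, le_div_iff₀ (by positivity)]
    have : (1 : ℝ) / 2 ^ k / 2 * (2 ^ (n - k) * 2 ^ k) = 2 ^ (n - k) / 2 := by field_simp
    rw [this]; linarith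
  have hμpos : 0 < μ := lt_of_lt_of_le (by positivity) hμlow
  have hμ1 : μ ≤ 1 := by
    rw [hμ, div_le_one hqpos, hAcard, hq]
    have : (2 : ℝ) ^ (n - k) ≤ 2 ^ n := pow_le_pow_right₀ (by norm_num) (by omega)
    linarith
  have hmain : c * μ ≤ D.card * (1 + μ) := by
    have h1 : (c * μ) ^ 2 ≤ D.card * (c * μ + c * μ ^ 2) :=
      hCS.trans (mul_le_mul_of_nonneg_left hsum2 (Nat.cast_nonneg _))
    have h2 : 0 < c * μ := by positivity
    refine le_of_mul_le_mul_left (a := c * μ) ?_ h2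
    calc c * μ * (c * μ) = (c * μ) ^ 2 := by ring
      _ ≤ D.card * (c * μ + c * μ ^ 2) := h1
      _ = _ := by ring
  have hDn : (0 : ℝ) ≤ D.card := Nat.cast_nonneg _
  have hfin : c * (1 / 2 ^ k / 2) ≤ D.card * 2 :=
    (mul_le_mul_of_nonneg_left hμlow hcpos.le).trans (hmain.trans
      (mul_le_mul_of_nonneg_left (by linarith) hDn))
  have e : c / 2 ^ k / 4 = c * (1 / 2 ^ k / 2) / 2 := by ring
  rw [e]
  change _ ≤ (D.card : ℝ)
  linarith

open Classical in
theorem sum_card_filter_dual {n k : ℕ} (D : Finset (Word n)) :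
    ∑ H : PCMatrix n k, ((D.filter fun d => d ∈ dual (code H)).card : ℝ) =
      ∑ d ∈ D, (dualCount n k d : ℝ) := by
  simp only [Finset.card_filter, dualCount, Nat.cast_sum]
  exact Finset.sum_comm

open Classical in
theorem sum_card_filter_dual_le {n k : ℕ} (hk : k ≤ n) (D : Finset (Word n)) (hD : 0 ∉ D) :
    ∑ H : PCMatrix n k, ((D.filter fun d => d ∈ dual (code H)).card : ℝ) ≤
      Fintype.card (PCMatrix n k) * (D.card / 2 ^ k) := by
  rw [sum_card_filter_dual]
  refine (Finset.sum_le_card_nsmul D (fun d => (dualCount n k d : ℝ))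
    ((Fintype.card (PCMatrix n k) : ℝ) / 2 ^ k) fun d hd =>
    dualCount_le hk fun h => hD (h ▸ hd)).trans (le_of_eq ?_)
  rw [nsmul_eq_mul]; ring

open Classical in
-- The additional 1 accounts for the zero word, which is always a parity-check.
theorem sum_card_filter_dual_le_add_one {n k : ℕ} (hk : k ≤ n) (D : Finset (Word n)) :
    ∑ H : PCMatrix n k, ((D.filter fun d => d ∈ dual (code H)).card : ℝ) ≤
      Fintype.card (PCMatrix n k) * (D.card / 2 ^ k + 1) := by
  rw [sum_card_filter_dual, mul_add, mul_one]
  have h0 : ∑ d ∈ D, (dualCount n k d : ℝ) ≤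
      ∑ d ∈ D, ((Fintype.card (PCMatrix n k) : ℝ) / 2 ^ k +
        if d = 0 then (Fintype.card (PCMatrix n k) : ℝ) else 0) := by
    refine Finset.sum_le_sum fun d _ => ?_
    have := card_pcMatrix_pos n k
    split_ifs with hd
    · have h1 : (dualCount n k d : ℝ) ≤ Fintype.card (PCMatrix n k) := by
        exact_mod_cast Finset.card_le_univ _
      have : 0 ≤ (Fintype.card (PCMatrix n k) : ℝ) / 2 ^ k := by positivity
      linarith
    · rw [add_zero]; exact dualCount_le hk hd
  refine h0.trans ?_
  rw [Finset.sum_add_distrib, Finset.sum_const, nsmul_eq_mul, Finset.sum_ite_eq']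
  have := card_pcMatrix_pos n k
  refine add_le_add (le_of_eq (by ring)) ?_
  split_ifs <;> linarith

open Classical in
theorem le_sum_card_filter_dual {n k : ℕ} (hk : k < n) (D : Finset (Word n)) :
    Fintype.card (PCMatrix n k) * (D.card / 2 ^ k / 4) ≤
    ∑ H : PCMatrix n k, ((D.filter fun d => d ∈ dual (code H)).card : ℝ) := by
  rw [sum_card_filter_dual]
  refine le_trans (le_of_eq ?_) (Finset.card_nsmul_le_sum D
    (fun d => (dualCount n k d : ℝ)) ((Fintype.card (PCMatrix n k) : ℝ) / 2 ^ k / 4) fun d _ => le_dualCount hk d)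
  rw [nsmul_eq_mul]; ring

/-! ### Running time and number of parity-checks -/

theorem fft_steps : ∀ (s : ℕ) (f : Word s → ℝ), (fft s f).steps = (s + 1) * 2 ^ s
  | 0, f => by simp [fft]
  | s + 1, f => by
    simp only [fft]
    rw [fft_steps s, fft_steps s]
    ring

theorem average_le {α β : Type*} [Fintype α] [Fintype β] [Nonempty α] [Nonempty β] (X : α → β → ℝ)
    (B : ℝ) (h : ∀ b, ∑ a, X a b ≤ Fintype.card α * B) :
    (∑ a, ∑ b, X a b) / (Fintype.card α * Fintype.card β : ℝ) ≤ B := by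
  have ha : (0 : ℝ) < Fintype.card α := by exact_mod_cast Fintype.card_pos
  have hb : (0 : ℝ) < Fintype.card β := by exact_mod_cast Fintype.card_pos
  rw [div_le_iff₀ (by positivity), Finset.sum_comm]
  refine (Finset.sum_le_card_nsmul _ _ _ fun b _ => h b).trans (le_of_eq ?_)
  rw [nsmul_eq_mul, Finset.card_univ]; ring

theorem le_average {α β : Type*} [Fintype α] [Fintype β] [Nonempty α] [Nonempty β] (X : α → β → ℝ)
    (B : ℝ) (h : ∀ b, Fintype.card α * B ≤ ∑ a, X a b) :
    B ≤ (∑ a, ∑ b, X a b) / (Fintype.card α * Fintype.card β : ℝ) := by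
  have ha : (0 : ℝ) < Fintype.card α := by exact_mod_cast Fintype.card_pos
  have hb : (0 : ℝ) < Fintype.card β := by exact_mod_cast Fintype.card_pos
  rw [le_div_iff₀ (by positivity), Finset.sum_comm]
  refine le_trans (le_of_eq ?_) (Finset.card_nsmul_le_sum _ _ _ fun b _ => h b)
  rw [nsmul_eq_mul, Finset.card_univ]; ring

theorem sum_coins {β : Type*} [Fintype β] [DecidableEq β] [Nonempty β] (N : ℕ) (f : β → ℝ) :
    (∑ coins : Fin N → β, ∑ j, f (coins j)) / Fintype.card (Fin N → β) =
      N * ((∑ b, f b) / Fintype.card β) := by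
  have hb : (0 : ℝ) < Fintype.card β := by exact_mod_cast Fintype.card_pos
  rw [Finset.sum_comm, Finset.sum_div]
  rw [Finset.sum_congr rfl (g := fun _ => (∑ b, f b) / Fintype.card β), Finset.sum_const,
    Finset.card_univ, Fintype.card_fin, nsmul_eq_mul]
  intro j _
  have hpos : (0 : ℝ) < Fintype.card (Fin N → β) := by exact_mod_cast Fintype.card_pos
  have h1 : ∑ coins : Fin N → β, f (coins j) =
      ∑ x : β × ({i // i ≠ j} → β), f x.1 :=
    Fintype.sum_equiv (Equiv.funSplitAt j β) _ _ fun c => rfl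
  have h2 : Fintype.card (Fin N → β) = Fintype.card β * Fintype.card ({i // i ≠ j} → β) := by
    rw [← Fintype.card_prod]; exact Fintype.card_congr (Equiv.funSplitAt j β)
  have hpos' : (0 : ℝ) < Fintype.card ({i // i ≠ j} → β) := by exact_mod_cast Fintype.card_pos
  rw [h1, h2, Fintype.sum_prod_type]
  simp only [Finset.sum_const, Finset.card_univ, nsmul_eq_mul]
  rw [← Finset.mul_sum]
  push_cast
  field_simp

namespace Params

variable {n k : ℕ} (p : Params n k)

/-- The product of the sizes of the two lists. -/
def pairs : ℝ :=
  ((p.m₂ / 2).choose (p.w₂ / 2) : ℝ) * ((p.m₂ - p.m₂ / 2).choose (p.w₂ - p.w₂ / 2) : ℝ)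

open Classical in
theorem merged_eq (H : PCMatrix n k) (perm : Equiv.Perm (Fin n)) :
    p.merged H perm = (p.candidates perm).filter fun d => d ∈ dual (code H) := by
  ext d
  simp only [merged, Finset.mem_filter, Finset.mem_univ, true_and, mem_candidates_iff]
  exact and_comm

open Classical in
theorem create_val_eq (H : PCMatrix n k) (perm : Equiv.Perm (Fin n)) :
    (p.create H perm).val = ((p.candidates perm).filter
      (fun d => weightOn (p.setN₁ perm) d = p.w₁)).filter fun d => d ∈ dual (code H) := by
  simp only [create, merged_eq]
  rw [Finset.filter_comm]

/-- The number of steps of one iteration; it does not depend on the received word. -/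
def stepCount (H : PCMatrix n k) (perm : Equiv.Perm (Fin n)) : ℕ :=
  (p.create H perm).steps + (p.create H perm).val.card + (p.s + 1) * 2 ^ p.s + 2 ^ p.s

theorem iteration_steps (H : PCMatrix n k) (y : Word n) (perm : Equiv.Perm (Fin n)) :
    (p.iteration H y perm).steps = p.stepCount H perm := by
  simp only [iteration, fft_steps, stepCount]

/-- The expected number of steps of one iteration. -/
def stepAverage : ℝ :=
  (∑ H : PCMatrix n k, ∑ perm : Equiv.Perm (Fin n), (p.stepCount H perm : ℝ)) /
    (Fintype.card (PCMatrix n k) * Fintype.card (Equiv.Perm (Fin n)) : ℝ)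

/-- The cost of an iteration does not depend on the received word, so the supremum is over a
constant, and the iterations use independent permutations of the same law. -/
theorem time_eq : p.time = p.iter * p.stepAverage := by
  have h : ∀ y : Word n, (∑ H : PCMatrix n k, ∑ coins : Fin p.iter → Equiv.Perm (Fin n),
        ((p.decode H y coins).steps : ℝ)) /
      (Fintype.card (PCMatrix n k) * Fintype.card (Fin p.iter → Equiv.Perm (Fin n)) : ℝ) =
      p.iter * p.stepAverage := by
    intro y
    have hc : (0 : ℝ) < Fintype.card (Fin p.iter → Equiv.Perm (Fin n)) := by
      exact_mod_cast Fintype.card_pos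
    have hH : ∀ H : PCMatrix n k, ∑ coins : Fin p.iter → Equiv.Perm (Fin n),
        ((p.decode H y coins).steps : ℝ) = Fintype.card (Fin p.iter → Equiv.Perm (Fin n)) *
        (p.iter * ((∑ perm, (p.stepCount H perm : ℝ)) / Fintype.card (Equiv.Perm (Fin n)))) := by
      intro H
      rw [← sum_coins p.iter (fun perm => (p.stepCount H perm : ℝ)), mul_div_cancel₀ _ hc.ne']
      simp only [decode, iteration_steps, Nat.cast_sum]
    simp only [hH]
    rw [← Finset.mul_sum, ← Finset.mul_sum, ← Finset.sum_div, stepAverage]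
    field_simp
  rw [time]
  simp only [h, ciSup_const]

theorem le_stepAverage (B : ℝ) (h : ∀ H perm, B ≤ p.stepCount H perm) : B ≤ p.stepAverage := by
  refine le_average _ _ fun perm => ?_
  have := Finset.card_nsmul_le_sum Finset.univ (fun H => (p.stepCount H perm : ℝ)) B
    fun H _ => h H perm
  rwa [nsmul_eq_mul, Finset.card_univ] at this

theorem two_pow_le_stepAverage : (2 : ℝ) ^ p.s ≤ p.stepAverage := by
  refine p.le_stepAverage _ fun H perm => ?_
  have : 2 ^ p.s ≤ p.stepCount H perm := Nat.le_add_left _ _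
  exact_mod_cast this

theorem list_le_stepAverage :
    ((p.m₂ - p.m₂ / 2).choose (p.w₂ - p.w₂ / 2) : ℝ) ≤ p.stepAverage := by
  refine p.le_stepAverage _ fun H perm => ?_
  have : (p.m₂ - p.m₂ / 2).choose (p.w₂ - p.w₂ / 2) ≤ p.stepCount H perm := by
    rw [← p.card_list₂ perm, stepCount, create]
    dsimp only
    generalize 2 ^ p.s = x
    generalize (p.s + 1) * x = y
    omega
  exact_mod_cast this

theorem two_pow_k : (2 : ℝ) ^ k = 2 ^ (p.s + p.m₁) * 2 ^ p.l := by
  rw [← pow_add]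
  congr 1
  have := p.size_le
  simp only [m₁]
  omega

theorem card_candidates_div (perm : Equiv.Perm (Fin n)) :
    ((p.candidates perm).card : ℝ) / 2 ^ k = p.pairs / 2 ^ p.l := by
  rw [card_candidates, p.two_pow_k, pairs]
  push_cast
  field_simp

theorem collisions_le_stepAverage (hk : k < n) : p.pairs / 2 ^ p.l / 4 ≤ p.stepAverage := by
  classical
  refine le_average _ _ fun perm => ?_
  rw [← p.card_candidates_div perm]
  refine (le_sum_card_filter_dual hk (p.candidates perm)).trans (Finset.sum_le_sum fun H _ => ?_)
  have : ((p.candidates perm).filter fun d => d ∈ dual (code H)).card ≤ p.stepCount H perm := by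
    rw [← merged_eq, stepCount, create]
    dsimp only
    generalize 2 ^ p.s = x
    generalize (p.s + 1) * x = y
    omega
  exact_mod_cast this

/-- The factor 2 covers writing down the collisions and processing those kept. The Fourier transform
costs (s + 1) 2^s and the search for the maximum another 2^s. -/
theorem stepAverage_le : p.stepAverage ≤
    (p.m₂ / 2).choose (p.w₂ / 2) + (p.m₂ - p.m₂ / 2).choose (p.w₂ - p.w₂ / 2) +
      2 * (p.pairs / 2 ^ p.l + 1) + (p.s + 2) * 2 ^ p.s := by
  classical
  refine average_le _ _ fun perm => ?_
  have h1 := sum_card_filter_dual_le_add_one p.dim_le (p.candidates perm)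
  rw [p.card_candidates_div perm] at h1
  calc ∑ H : PCMatrix n k, (p.stepCount H perm : ℝ)
      ≤ ∑ H : PCMatrix n k, (((p.m₂ / 2).choose (p.w₂ / 2) +
          (p.m₂ - p.m₂ / 2).choose (p.w₂ - p.w₂ / 2) + (p.s + 2) * 2 ^ p.s : ℝ) +
          2 * (((p.candidates perm).filter fun d => d ∈ dual (code H)).card : ℝ)) := by
        refine Finset.sum_le_sum fun H _ => ?_
        have hle : (p.create H perm).val.card ≤
            ((p.candidates perm).filter fun d => d ∈ dual (code H)).card := by
          rw [create_val_eq]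
          exact Finset.card_le_card (Finset.filter_subset_filter _ (Finset.filter_subset _ _))
        have e : p.stepCount H perm = (p.m₂ / 2).choose (p.w₂ / 2) +
            (p.m₂ - p.m₂ / 2).choose (p.w₂ - p.w₂ / 2) +
            ((p.candidates perm).filter fun d => d ∈ dual (code H)).card +
            (p.create H perm).val.card + (p.s + 1) * 2 ^ p.s + 2 ^ p.s := by
          rw [stepCount, ← merged_eq, ← p.card_list₁ perm, ← p.card_list₂ perm]
          rfl
        have hle' : ((p.create H perm).val.card : ℝ) ≤
            (((p.candidates perm).filter fun d => d ∈ dual (code H)).card : ℝ) := by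
          exact_mod_cast hle
        rw [e]
        push_cast
        linarith
    _ ≤ _ := by
        rw [Finset.sum_add_distrib, Finset.sum_const, nsmul_eq_mul, Finset.card_univ,
          ← Finset.mul_sum]
        linarith

/-- The number of words of the shape of the parity-checks, divided by `2^k`. -/
def expectedChecks : ℝ := 2 ^ p.s * p.m₁.choose p.w₁ * p.pairs / 2 ^ k

theorem card_kept_div (perm : Equiv.Perm (Fin n)) :
    (((p.candidates perm).filter (fun d => weightOn (p.setN₁ perm) d = p.w₁)).card : ℝ) / 2 ^ k =
      p.expectedChecks := by
  rw [card_candidates_filter, expectedChecks, pairs]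
  push_cast
  ring

theorem le_numChecks (hk : k < n) : p.expectedChecks / 4 ≤ p.numChecks := by
  classical
  refine le_average _ _ fun perm => ?_
  simp only [create_val_eq]
  rw [← p.card_kept_div perm]
  exact le_sum_card_filter_dual hk _

theorem numChecks_le (hw : ¬(p.w₁ = 0 ∧ p.w₂ = 0)) : p.numChecks ≤ p.expectedChecks := by
  classical
  refine average_le _ _ fun perm => ?_
  simp only [create_val_eq]
  rw [← p.card_kept_div perm]
  refine sum_card_filter_dual_le p.dim_le _ fun h0 => hw ?_
  simp only [candidates, Finset.mem_filter, Finset.mem_univ, true_and] at h0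
  have hz : ∀ A : Finset (Fin n), weightOn A (0 : Word n) = 0 := fun A => by simp [weightOn]
  rw [hz, hz, hz] at h0
  omega

/-- For both weights zero the zero word is always kept, so the bound by `expectedChecks` is not
available. The number is still bounded, which rules this choice out as a source of many samples. -/
theorem numChecks_le_two (h1 : p.w₁ = 0) (h2 : p.w₂ = 0) : p.numChecks ≤ 2 := by
  classical
  have h : p.numChecks ≤ p.expectedChecks + 1 := by
    refine average_le _ _ fun perm => ?_
    simp only [create_val_eq]
    rw [← p.card_kept_div perm]
    exact sum_card_filter_dual_le_add_one p.dim_le _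
  have h3 : p.expectedChecks ≤ 1 := by
    rw [expectedChecks, pairs, h1, h2, div_le_one (by positivity)]
    have hs := p.size_le
    simpa using pow_le_pow_right₀ (by norm_num : (1 : ℝ) ≤ 2) (by omega : p.s ≤ k)
  linarith

end Params

end RLPN

end

noncomputable section

namespace RLPN

open Filter Topology

/-! ### Exponential rates -/

section Rates

variable {F : Filter ℕ}

theorem tendsto_logb_pow {a : ℕ → ℕ} {α : ℝ} (c : ℝ)
    (ha : Tendsto (fun n => (a n : ℝ) / n) F (𝓝 α)) :
    Tendsto (fun n => Real.logb 2 (c ^ a n) / n) F (𝓝 (α * Real.logb 2 c)) := by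
  refine (ha.mul_const (Real.logb 2 c)).congr fun n => ?_
  rw [Real.logb_pow]; ring

theorem tendsto_logb_two_pow {a : ℕ → ℕ} {α : ℝ}
    (ha : Tendsto (fun n => (a n : ℝ) / n) F (𝓝 α)) :
    Tendsto (fun n => Real.logb 2 (2 ^ a n) / n) F (𝓝 α) := by
  have := tendsto_logb_pow 2 ha
  rwa [Real.logb_self_eq_one (by norm_num), mul_one] at this

theorem tendsto_logb_mul {a b : ℕ → ℝ} {α β : ℝ}
    (ha : Tendsto (fun n => Real.logb 2 (a n) / n) F (𝓝 α))
    (hb : Tendsto (fun n => Real.logb 2 (b n) / n) F (𝓝 β))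
    (ha0 : ∀ᶠ n in F, 0 < a n) (hb0 : ∀ᶠ n in F, 0 < b n) :
    Tendsto (fun n => Real.logb 2 (a n * b n) / n) F (𝓝 (α + β)) := by
  refine (ha.add hb).congr' ?_
  filter_upwards [ha0, hb0] with n h1 h2
  rw [Real.logb_mul h1.ne' h2.ne', add_div]

theorem tendsto_logb_div {a b : ℕ → ℝ} {α β : ℝ}
    (ha : Tendsto (fun n => Real.logb 2 (a n) / n) F (𝓝 α))
    (hb : Tendsto (fun n => Real.logb 2 (b n) / n) F (𝓝 β))
    (ha0 : ∀ᶠ n in F, 0 < a n) (hb0 : ∀ᶠ n in F, 0 < b n) :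
    Tendsto (fun n => Real.logb 2 (a n / b n) / n) F (𝓝 (α - β)) := by
  refine (ha.sub hb).congr' ?_
  filter_upwards [ha0, hb0] with n h1 h2
  rw [Real.logb_div h1.ne' h2.ne', sub_div]

theorem tendsto_logb_sq {a : ℕ → ℝ} {α : ℝ}
    (ha : Tendsto (fun n => Real.logb 2 (a n) / n) F (𝓝 α)) :
    Tendsto (fun n => Real.logb 2 (a n ^ 2) / n) F (𝓝 (2 * α)) := by
  refine (ha.const_mul 2).congr fun n => ?_
  rw [Real.logb_pow]; push_cast; ring

theorem tendsto_logb_natCast (hF : F ≤ atTop) {a : ℕ → ℕ} {α : ℝ}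
    (ha : Tendsto (fun n => (a n : ℝ) / n) F (𝓝 α)) :
    Tendsto (fun n => Real.logb 2 (a n) / n) F (𝓝 0) := by
  have := (tendsto_log_natCast_div hF ha).div_const (Real.log 2)
  rw [zero_div] at this
  refine this.congr fun n => ?_
  rw [Real.logb]; ring

theorem tendsto_logb_const (hF : F ≤ atTop) (c : ℝ) :
    Tendsto (fun n : ℕ => Real.logb 2 c / n) F (𝓝 0) := tendsto_const_div hF _

theorem tendsto_self_div (hF : F ≤ atTop) :
    Tendsto (fun n : ℕ => (n : ℝ) / n) F (𝓝 1) := by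
  refine tendsto_const_nhds.congr' ?_
  filter_upwards [hF (eventually_ge_atTop 1)] with n hn
  rw [div_self]
  exact_mod_cast (by omega : n ≠ 0)

theorem tendsto_add_const_div (hF : F ≤ atTop) {a : ℕ → ℕ} {α : ℝ}
    (ha : Tendsto (fun n => (a n : ℝ) / n) F (𝓝 α)) (c : ℕ) :
    Tendsto (fun n => ((a n + c : ℕ) : ℝ) / n) F (𝓝 α) := by
  have := ha.add (tendsto_const_div hF c)
  rw [add_zero] at this
  refine this.congr fun n => ?_
  push_cast; ring

theorem tendsto_natSub_div {a b : ℕ → ℕ} {α β : ℝ}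
    (ha : Tendsto (fun n => (a n : ℝ) / n) F (𝓝 α))
    (hb : Tendsto (fun n => (b n : ℝ) / n) F (𝓝 β)) (hle : ∀ᶠ n in F, b n ≤ a n) :
    Tendsto (fun n => ((a n - b n : ℕ) : ℝ) / n) F (𝓝 (α - β)) := by
  refine (ha.sub hb).congr' ?_
  filter_upwards [hle] with n hn
  rw [Nat.cast_sub hn, sub_div]

theorem tendsto_natAdd_div {a b : ℕ → ℕ} {α β : ℝ}
    (ha : Tendsto (fun n => (a n : ℝ) / n) F (𝓝 α))
    (hb : Tendsto (fun n => (b n : ℝ) / n) F (𝓝 β)) :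
    Tendsto (fun n => ((a n + b n : ℕ) : ℝ) / n) F (𝓝 (α + β)) := by
  refine (ha.add hb).congr fun n => ?_
  push_cast; ring

theorem le_of_rates [F.NeBot] {a b : ℕ → ℝ} {α β : ℝ}
    (ha : Tendsto (fun n => Real.logb 2 (a n) / n) F (𝓝 α))
    (hb : Tendsto (fun n => Real.logb 2 (b n) / n) F (𝓝 β))
    (ha0 : ∀ᶠ n in F, 0 < a n) (hab : ∀ᶠ n in F, a n ≤ b n) : α ≤ β := by
  refine le_of_tendsto_of_tendsto ha hb ?_
  filter_upwards [ha0, hab] with n h1 h2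
  exact div_le_div_of_nonneg_right (Real.logb_le_logb_of_le (by norm_num) h1 h2)
    (Nat.cast_nonneg n)

end Rates

theorem scaledEntropy_zero_right (a : ℝ) : scaledEntropy a 0 = 0 := by
  simp [scaledEntropy]

theorem scaledEntropy_one (x : ℝ) : scaledEntropy 1 x = h x := by
  rw [← mul_h_div, div_one, one_mul]

theorem mul_krExpLow {M ν ω : ℝ} (hM : 0 < M) :
    M * krExpLow (ν / M) (ω / M) = 2 * (ν * Real.logb 2 (1 - zKraw (ν / M) (ω / M)) +
      (M - ν) * Real.logb 2 (1 + zKraw (ν / M) (ω / M)) -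
      ω * Real.logb 2 (zKraw (ν / M) (ω / M))) - scaledEntropy M ω := by
  rw [krExpLow, ← mul_h_div]
  field_simp

/-- Rates of lower bounds of the squared normalised Krawtchouk polynomials. -/
theorem le_krExp_of_rate {F : Filter ℕ} [F.NeBot] (hF : F ≤ atTop) {m u w : ℕ → ℕ} {M ν ω A : ℝ}
    {a : ℕ → ℝ} (hm : Tendsto (fun n => (m n : ℝ) / n) F (𝓝 M))
    (hu : Tendsto (fun n => (u n : ℝ) / n) F (𝓝 ν))
    (hw : Tendsto (fun n => (w n : ℝ) / n) F (𝓝 ω))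
    (hum : ∀ᶠ n in F, u n ≤ m n) (hwm : ∀ᶠ n in F, w n ≤ m n) (hM : 0 < M) (hν₀ : 0 ≤ ν)
    (hν : ν / M < 1 / 2) (hω₀ : 0 ≤ ω) (hω : ω / M ≤ 1 / 2)
    (hA : Tendsto (fun n => Real.logb 2 (a n) / n) F (𝓝 A)) (ha0 : ∀ᶠ n in F, 0 < a n)
    (ha : ∀ᶠ n in F, a n ≤ krawtchouk (m n) (w n) (u n) ^ 2 / (m n).choose (w n)) :
    A ≤ M * krExp (ν / M) (ω / M) := by
  have hx0 : 0 ≤ ν / M := div_nonneg hν₀ hM.le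
  have hy0 : 0 ≤ ω / M := div_nonneg hω₀ hM.le
  have hCw : ∀ᶠ n in F, (0 : ℝ) < (m n).choose (w n) := by
    filter_upwards [hwm] with n hn
    exact_mod_cast Nat.choose_pos hn
  have hCu : ∀ᶠ n in F, (0 : ℝ) < (m n).choose (u n) := by
    filter_upwards [hum] with n hn
    exact_mod_cast Nat.choose_pos hn
  rcases le_or_gt (omegaPerp (ω / M)) (ν / M) with hcase | hcase
  -- Above the first root the orthogonality bound is already the exponent.
  · rw [krExp_of_ge hx0 hν hy0 hω hcase, mul_sub, mul_one, mul_h_div]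
    refine le_of_rates hA (tendsto_logb_div (tendsto_logb_two_pow hm)
      (tendsto_logb_choose hF hm hu hum) (Eventually.of_forall fun n => by positivity) hCu) ha0 ?_
    filter_upwards [ha, hum, hwm] with n h1 h2 h3
    exact h1.trans (krawtchouk_sq_div_le h2 h3)
  -- For ω = 0 the radius z would be 0; the trivial bound |K| ≤ binom(m, w) has rate 0 and suffices.
  rcases hω₀.eq_or_lt with rfl | hω₀
  · rw [zero_div, krExp_zero hx0 hν.le, mul_zero, ← scaledEntropy_zero_right M]
    refine le_of_rates hA (tendsto_logb_choose hF hm hw hwm) ha0 ?_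
    filter_upwards [ha, hum, hCw] with n h1 h2 h3
    refine h1.trans ?_
    rw [div_le_iff₀ h3, ← sq_abs, ← sq]
    exact pow_le_pow_left₀ (abs_nonneg _) (abs_krawtchouk_le _ h2) 2
  · have hy : 0 < ω / M := div_pos hω₀ hM
    obtain ⟨z0, z1, -, -, hcond⟩ := zKraw_facts hx0 hν hy hω hcase
    rw [krExp_of_le hx0 hcase.le, mul_krExpLow hM]
    set z := zKraw (ν / M) (ω / M)
    have hz1 : 0 < 1 - z := by linarith
    have hz2 : 0 < 1 + z := by linarith
    have hmu := tendsto_natSub_div hm hu hum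
    have hnum := tendsto_logb_div (tendsto_logb_mul (tendsto_logb_pow (1 - z) hu)
      (tendsto_logb_pow (1 + z) hmu) (Eventually.of_forall fun n => by positivity)
      (Eventually.of_forall fun n => by positivity)) (tendsto_logb_pow z hw)
      (Eventually.of_forall fun n => by positivity) (Eventually.of_forall fun n => by positivity)
    refine le_of_rates hA (tendsto_logb_div (tendsto_logb_sq hnum)
      (tendsto_logb_choose hF hm hw hwm) (Eventually.of_forall fun n => by positivity) hCw) ha0 ?_
    have hcond' : ν * (1 + z) ^ 2 < (M - ν) * (1 - z) ^ 2 := by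
      have := mul_lt_mul_of_pos_left hcond hM
      have e1 : M * ((1 + z) ^ 2 * (ν / M)) = ν * (1 + z) ^ 2 := by field_simp
      have e2 : M * ((1 - z) ^ 2 * (1 - ν / M)) = (M - ν) * (1 - z) ^ 2 := by field_simp
      rwa [e1, e2] at this
    -- The condition of Cauchy's estimate is strict for the limiting rates, hence holds for the
    -- integer parameters eventually.
    have hev : ∀ᶠ n in F, (u n : ℝ) / n * (1 + z) ^ 2 < ((m n : ℝ) / n - u n / n) * (1 - z) ^ 2 :=
      (hu.mul_const _).eventually_lt ((hm.sub hu).mul_const _) hcond'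
    filter_upwards [ha, hum, hCw, hev, hF (eventually_ge_atTop 1)] with n h1 h2 h3 h4 h5
    refine h1.trans (div_le_div_of_nonneg_right ?_ h3.le)
    rw [← sq_abs (krawtchouk _ _ _)]
    refine pow_le_pow_left₀ (abs_nonneg _) ?_ 2
    rw [le_div_iff₀ (by positivity)]
    refine abs_krawtchouk_mul_pow_le _ z0 z1 h2 ?_
    have hn : (0 : ℝ) < n := by exact_mod_cast h5
    have := mul_le_mul_of_nonneg_left h4.le hn.le
    have e1 : (n : ℝ) * ((u n : ℝ) / n * (1 + z) ^ 2) = u n * (1 + z) ^ 2 := by field_simp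
    have e2 : (n : ℝ) * (((m n : ℝ) / n - u n / n) * (1 - z) ^ 2) =
        (m n - u n) * (1 - z) ^ 2 := by field_simp
    rwa [e1, e2] at this

/-! ### No admissible choice beats the exponent -/

namespace Params

variable {n k : ℕ} (p : Params n k)

theorem pairs_le : p.pairs ≤ p.m₂.choose p.w₂ := by
  have h := Nat.add_choose_eq (p.m₂ / 2) (p.m₂ - p.m₂ / 2) p.w₂
  rw [Nat.add_sub_cancel' (Nat.div_le_self _ _)] at h
  have hmem : (p.w₂ / 2, p.w₂ - p.w₂ / 2) ∈ Finset.HasAntidiagonal.antidiagonal p.w₂ :=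
    Finset.HasAntidiagonal.mem_antidiagonal.2 (Nat.add_sub_cancel' (Nat.div_le_self _ _))
  have h2 : (p.m₂ / 2).choose (p.w₂ / 2) * (p.m₂ - p.m₂ / 2).choose (p.w₂ - p.w₂ / 2) ≤
      p.m₂.choose p.w₂ := by
    rw [h]
    exact Finset.single_le_sum
      (f := fun ij : ℕ × ℕ => (p.m₂ / 2).choose ij.1 * (p.m₂ - p.m₂ / 2).choose ij.2)
      (fun _ _ => Nat.zero_le _) hmem
  rw [pairs]
  exact_mod_cast h2

theorem abs_wordBias_le {m w u : ℕ} (hu : u ≤ m) : |wordBias m w u| ≤ 1 := by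
  rw [wordBias_eq w hu, abs_div, Nat.abs_cast]
  exact div_le_one_of_le₀ (abs_krawtchouk_le w hu) (Nat.cast_nonneg _)

theorem wordBias_ne_zero {m w u : ℕ} (hu : u ≤ m) (h : wordBias m w u ≠ 0) : w ≤ m := by
  by_contra hw
  rw [wordBias_eq w hu, Nat.choose_eq_zero_of_lt (by omega)] at h
  simp at h

/-- The factor 2^s cancels against 2^k = 2^(s + m₁ + l). The quotient of `pairs` by the binomial
coefficient is the loss from splitting the weight evenly. It is at most 1, and the construction
later gives it rate 0. -/
theorem expectedChecks_mul_bias_sq (hu₁ : p.u₁ ≤ p.m₁) (hu₂ : p.u₂ ≤ p.m₂) (hw₁ : p.w₁ ≤ p.m₁)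
    (hw₂ : p.w₂ ≤ p.m₂) : p.expectedChecks * p.bias ^ 2 = p.pairs / p.m₂.choose p.w₂ *
      ((krawtchouk p.m₁ p.w₁ p.u₁ ^ 2 / p.m₁.choose p.w₁) *
        (krawtchouk p.m₂ p.w₂ p.u₂ ^ 2 / p.m₂.choose p.w₂) / (2 ^ p.m₁ * 2 ^ p.l)) := by
  have c1 : (0 : ℝ) < p.m₁.choose p.w₁ := by exact_mod_cast Nat.choose_pos hw₁
  have c2 : (0 : ℝ) < p.m₂.choose p.w₂ := by exact_mod_cast Nat.choose_pos hw₂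
  rw [expectedChecks, bias, wordBias_eq _ hu₁, wordBias_eq _ hu₂, p.two_pow_k, pow_add]
  field_simp

/-- What it takes to have enough parity-checks. -/
theorem samples_bound (hu₁ : p.u₁ ≤ p.m₁) (hu₂ : p.u₂ ≤ p.m₂)
    (hN : 3 ≤ p.numChecks * p.bias ^ 2) : p.w₂ ≤ p.m₂ ∧
    (p.m₁.choose p.u₁ : ℝ) * 2 ^ p.l ≤
      krawtchouk p.m₂ p.w₂ p.u₂ ^ 2 / p.m₂.choose p.w₂ := by
  have hb0 : p.bias ≠ 0 := by rintro h; rw [h] at hN; norm_num at hN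
  have hw₁ : p.w₁ ≤ p.m₁ := wordBias_ne_zero hu₁ (left_ne_zero_of_mul hb0)
  have hw₂ : p.w₂ ≤ p.m₂ := wordBias_ne_zero hu₂ (right_ne_zero_of_mul hb0)
  refine ⟨hw₂, ?_⟩
  have hbsq : p.bias ^ 2 ≤ 1 := by
    rw [← sq_abs, bias, abs_mul]
    exact pow_le_one₀ (by positivity) (mul_le_one₀ (abs_wordBias_le hu₁) (abs_nonneg _)
      (abs_wordBias_le hu₂))
  -- With both weights zero one would have N δ² ≤ 2; the threshold 3 in the hypothesis is chosen to
  -- exclude this.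
  have hnot : ¬(p.w₁ = 0 ∧ p.w₂ = 0) := by
    rintro ⟨h1, h2⟩
    have h3 := p.numChecks_le_two h1 h2
    have h4 : p.numChecks * p.bias ^ 2 ≤ 2 * 1 :=
      (mul_le_mul_of_nonneg_right h3 (sq_nonneg _)).trans
        (mul_le_mul_of_nonneg_left hbsq (by norm_num))
    linarith
  have h1 : 1 ≤ p.expectedChecks * p.bias ^ 2 := by
    have := mul_le_mul_of_nonneg_right (p.numChecks_le hnot) (sq_nonneg p.bias)
    linarith
  have c1 : (0 : ℝ) < p.m₁.choose p.w₁ := by exact_mod_cast Nat.choose_pos hw₁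
  have c2 : (0 : ℝ) < p.m₂.choose p.w₂ := by exact_mod_cast Nat.choose_pos hw₂
  have c3 : (0 : ℝ) < p.m₁.choose p.u₁ := by exact_mod_cast Nat.choose_pos hu₁
  have h2 := p.expectedChecks_mul_bias_sq hu₁ hu₂ hw₁ hw₂
  set K2 := krawtchouk p.m₂ p.w₂ p.u₂
  have h3 : p.pairs / p.m₂.choose p.w₂ ≤ 1 := div_le_one_of_le₀ (p.pairs_le) c2.le
  have h4 := krawtchouk_sq_div_le hu₁ hw₁
  have h5 : 1 ≤ (2 ^ p.m₁ / p.m₁.choose p.u₁) * (K2 ^ 2 / p.m₂.choose p.w₂) /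
      (2 ^ p.m₁ * 2 ^ p.l) := by
    rw [h2] at h1
    refine h1.trans ((mul_le_mul_of_nonneg_right h3 (by positivity)).trans ?_)
    rw [one_mul]
    gcongr
  have h6 : (2 ^ p.m₁ / p.m₁.choose p.u₁) * (K2 ^ 2 / p.m₂.choose p.w₂) / (2 ^ p.m₁ * 2 ^ p.l) =
      (K2 ^ 2 / p.m₂.choose p.w₂) / (p.m₁.choose p.u₁ * 2 ^ p.l) := by field_simp
  rw [h6, le_div_iff₀ (by positivity), one_mul] at h5
  exact h5

theorem succProb_facts {e : Word n} (h : 0 < p.succProb e) :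
    p.u₁ + p.u₂ ≤ hammingNorm e ∧ hammingNorm e - p.u₁ - p.u₂ ≤ p.s ∧ p.u₁ ≤ p.m₁ ∧
      p.u₂ ≤ p.m₂ ∧ p.succProb e = (p.s.choose (hammingNorm e - p.u₁ - p.u₂) : ℝ) *
        p.m₁.choose p.u₁ * p.m₂.choose p.u₂ / n.choose (hammingNorm e) := by
  rw [succProb_eq] at h ⊢
  split_ifs at h ⊢ with hle
  · have aux : ∀ a b : ℕ, a.choose b ≠ 0 → b ≤ a := fun a b hab => by
      by_contra hlt
      exact hab (Nat.choose_eq_zero_of_lt (by omega))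
    refine ⟨hle, aux _ _ ?_, aux _ _ ?_, aux _ _ ?_, rfl⟩ <;>
    · intro h0
      rw [h0] at h
      simp at h
  · simp at h

end Params

theorem exists_tendsto_of_mem_Icc (U : Ultrafilter ℕ) (a : ℕ → ℝ)
    (ha : ∀ᶠ n in (U : Filter ℕ), a n ∈ Set.Icc (0 : ℝ) 1) :
    ∃ x, Tendsto a U (𝓝 x) := by
  obtain ⟨x, -, hx⟩ := (isCompact_Icc (a := (0 : ℝ)) (b := 1)).ultrafilter_le_nhds' (U.map a) ha
  exact ⟨x, hx⟩

theorem natCast_div_mem_Icc {a n : ℕ} (h : a ≤ n) : (a : ℝ) / n ∈ Set.Icc (0 : ℝ) 1 :=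
  ⟨by positivity, div_le_one_of_le₀ (by exact_mod_cast h) (Nat.cast_nonneg _)⟩

theorem le_of_tendsto_natCast {F : Filter ℕ} [F.NeBot] {a b : ℕ → ℕ} {α β : ℝ}
    (ha : Tendsto (fun n => (a n : ℝ) / n) F (𝓝 α))
    (hb : Tendsto (fun n => (b n : ℝ) / n) F (𝓝 β)) (h : ∀ᶠ n in F, a n ≤ b n) : α ≤ β := by
  refine le_of_tendsto_of_tendsto ha hb ?_
  filter_upwards [h] with n hn
  exact div_le_div_of_nonneg_right (by exact_mod_cast hn) (Nat.cast_nonneg n)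

theorem nonneg_of_tendsto_natCast {F : Filter ℕ} [F.NeBot] {a : ℕ → ℕ} {α : ℝ}
    (ha : Tendsto (fun n => (a n : ℝ) / n) F (𝓝 α)) : 0 ≤ α :=
  ge_of_tendsto' ha fun n => by positivity

/-- If the time were too small infinitely often, an ultrafilter would concentrate on those n. Along
it all bounded rates converge without passing to subsequences. The limits form a tuple in the box
with nonnegative slack and β ≤ α - ε, which contradicts `alphaDumer89_le_beta`. -/
theorem lower_bound {R : ℝ} (hR₀ : 0 < R) (hR₁ : R < 1) {k : ℕ → ℕ} {e : ∀ n, Word n}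
    (hk : Tendsto (fun n : ℕ => (k n : ℝ) / n) atTop (𝓝 R))
    (he : Tendsto (fun n : ℕ => (hammingNorm (e n) : ℝ) / n) atTop (𝓝 (deltaGV R)))
    {p : ∀ n, Params n (k n)} (hp : Admissible e p) {ε : ℝ} (hε : 0 < ε) :
    ∀ᶠ n : ℕ in atTop, alphaDumer89 R - ε ≤ Real.logb 2 (p n).time / n := by
  by_contra hcon
  rw [not_eventually] at hcon
  have hne : (atTop ⊓ 𝓟 {n : ℕ | ¬alphaDumer89 R - ε ≤ Real.logb 2 (p n).time / n}).NeBot :=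
    frequently_mem_iff_neBot.1 hcon
  set U := Ultrafilter.of
    (atTop ⊓ 𝓟 {n : ℕ | ¬alphaDumer89 R - ε ≤ Real.logb 2 (p n).time / n}) with hU
  have hUle : (U : Filter ℕ) ≤ _ := Ultrafilter.of_le _
  have hF : (U : Filter ℕ) ≤ atTop := hUle.trans inf_le_left
  have hbad : ∀ᶠ n in (U : Filter ℕ), Real.logb 2 (p n).time / n < alphaDumer89 R - ε := by
    have : ∀ᶠ n in (U : Filter ℕ), ¬alphaDumer89 R - ε ≤ Real.logb 2 (p n).time / n :=
      hUle (mem_inf_of_right (mem_principal_self _))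
    filter_upwards [this] with n hn using not_le.1 hn
  have hbets : ∀ᶠ n in (U : Filter ℕ), 1 ≤ ((p n).iter : ℝ) * (p n).succProb (e n) :=
    hF (hp.bets.eventually_ge_atTop 1)
  have hpos : ∀ᶠ n in (U : Filter ℕ), 0 < (p n).succProb (e n) := by
    filter_upwards [hbets] with n hn
    by_contra h0
    have : 0 ≤ (p n).succProb (e n) := by rw [Params.succProb]; positivity
    have h1 : (p n).succProb (e n) = 0 := le_antisymm (not_lt.1 h0) this
    rw [h1, mul_zero] at hn
    linarith
  have hfacts := hpos.mono fun n hn => (p n).succProb_facts hn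
  have hsamples : ∀ᶠ n in (U : Filter ℕ), 3 ≤ (p n).numChecks * (p n).bias ^ 2 := by
    filter_upwards [hF (hp.samples.eventually_ge_atTop 3), hF (eventually_ge_atTop 1)] with n h1 h2
    have hn : (1 : ℝ) ≤ n := by exact_mod_cast h2
    rw [le_div_iff₀ (by linarith)] at h1
    linarith
  have hsb : ∀ᶠ n in (U : Filter ℕ), (p n).w₂ ≤ (p n).m₂ ∧
      ((p n).m₁.choose (p n).u₁ : ℝ) * 2 ^ (p n).l ≤
      krawtchouk (p n).m₂ (p n).w₂ (p n).u₂ ^ 2 / (p n).m₂.choose (p n).w₂ := by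
    filter_upwards [hsamples, hfacts] with n h1 h2
    exact (p n).samples_bound h2.2.2.1 h2.2.2.2.1 h1
  have hm₁n : ∀ n, (p n).m₁ ≤ n := fun n => by have := (p n).sum_sizes; omega
  have hm₂n : ∀ n, (p n).m₂ ≤ n := fun n => by have := (p n).sum_sizes; omega
  have hln : ∀ n, (p n).l ≤ n := fun n => by
    have := (p n).size_le; have := (p n).dim_le; omega
  -- the limits of the parameters
  obtain ⟨σ, hσ⟩ := exists_tendsto_of_mem_Icc U (fun n => ((p n).s : ℝ) / n)
    (Eventually.of_forall fun n => natCast_div_mem_Icc (p n).s_le)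
  obtain ⟨lam, hlam⟩ := exists_tendsto_of_mem_Icc U (fun n => ((p n).l : ℝ) / n)
    (Eventually.of_forall fun n => natCast_div_mem_Icc (hln n))
  obtain ⟨ν₁, hν₁⟩ := exists_tendsto_of_mem_Icc U (fun n => ((p n).u₁ : ℝ) / n)
    (hfacts.mono fun n h => natCast_div_mem_Icc (h.2.2.1.trans (hm₁n n)))
  obtain ⟨ν₂, hν₂⟩ := exists_tendsto_of_mem_Icc U (fun n => ((p n).u₂ : ℝ) / n)
    (hfacts.mono fun n h => natCast_div_mem_Icc (h.2.2.2.1.trans (hm₂n n)))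
  obtain ⟨ω, hω⟩ := exists_tendsto_of_mem_Icc U (fun n => ((p n).w₂ : ℝ) / n)
    (hsb.mono fun n h => natCast_div_mem_Icc (h.1.trans (hm₂n n)))
  have hkU := hk.mono_left hF
  have heU := he.mono_left hF
  have hm₁ : Tendsto (fun n => ((p n).m₁ : ℝ) / n) U (𝓝 (R - lam - σ)) :=
    tendsto_natSub_div (tendsto_natSub_div hkU hlam (Eventually.of_forall fun n => by
      have := (p n).size_le; omega)) hσ (Eventually.of_forall fun n => by
      have := (p n).size_le; omega)
  have hm₂ : Tendsto (fun n => ((p n).m₂ : ℝ) / n) U (𝓝 (1 - R + lam)) :=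
    tendsto_natAdd_div (tendsto_natSub_div (tendsto_self_div hF) hkU
      (Eventually.of_forall fun n => (p n).dim_le)) hlam
  have ht : Tendsto (fun n => ((hammingNorm (e n) - (p n).u₁ - (p n).u₂ : ℕ) : ℝ) / n) U
      (𝓝 (deltaGV R - ν₁ - ν₂)) :=
    tendsto_natSub_div (tendsto_natSub_div heU hν₁ (hfacts.mono fun n h => by omega)) hν₂
      (hfacts.mono fun n h => by omega)
  have lam0 := nonneg_of_tendsto_natCast hlam
  have ν₂0 := nonneg_of_tendsto_natCast hν₂
  have ω0 := nonneg_of_tendsto_natCast hω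
  have hM : 0 < 1 - R + lam := by linarith
  have hωM : ω ≤ 1 - R + lam := le_of_tendsto_natCast hω hm₂ (hsb.mono fun n h => h.1)
  -- reflect the weight on `N₂`
  set ω' := min ω (1 - R + lam - ω) with hω'
  have hωe : scaledEntropy (1 - R + lam) ω' = scaledEntropy (1 - R + lam) ω := by
    rcases min_choice ω (1 - R + lam - ω) with h1 | h1 <;> rw [hω', h1]
    exact scaledEntropy_sub _ _
  have hω'0 : 0 ≤ ω' := le_min ω0 (by linarith)
  have hω'1 : ω' ≤ (1 - R + lam) / 2 := by
    rcases le_total ω ((1 - R + lam) / 2) with h1 | h1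
    · exact (min_le_left _ _).trans h1
    · exact (min_le_right _ _).trans (by linarith)
  let q : Rates := ⟨σ, ν₁, ν₂, lam, (R - lam - σ) / 2, ω'⟩
  have hq : q ∈ box R := by
    have t0 := nonneg_of_tendsto_natCast ht
    have t1 := le_of_tendsto_natCast ht hσ (hfacts.mono fun n h => h.2.1)
    have t2 := nonneg_of_tendsto_natCast hm₁
    exact ⟨nonneg_of_tendsto_natCast hσ, nonneg_of_tendsto_natCast hν₁, ν₂0, lam0, hω'0,
      by linarith, le_of_tendsto_natCast hν₁ hm₁ (hfacts.mono fun n h => h.2.2.1),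
      by linarith, by linarith, rfl, hω'1⟩
  obtain ⟨-, -, -, x1, -, y1⟩ := box_ratios hR₀ hR₁ hq
  have hcu₁ : ∀ᶠ n in (U : Filter ℕ), (0 : ℝ) < (p n).m₁.choose (p n).u₁ :=
    hfacts.mono fun n h => by exact_mod_cast Nat.choose_pos h.2.2.1
  have hcu₂ : ∀ᶠ n in (U : Filter ℕ), (0 : ℝ) < (p n).m₂.choose (p n).u₂ :=
    hfacts.mono fun n h => by exact_mod_cast Nat.choose_pos h.2.2.2.1
  have hcs : ∀ᶠ n in (U : Filter ℕ),
      (0 : ℝ) < (p n).s.choose (hammingNorm (e n) - (p n).u₁ - (p n).u₂) :=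
    hfacts.mono fun n h => by exact_mod_cast Nat.choose_pos h.2.1
  have hcn : ∀ᶠ n in (U : Filter ℕ), (0 : ℝ) < n.choose (hammingNorm (e n)) :=
    Eventually.of_forall fun n => by exact_mod_cast Nat.choose_pos (hammingNorm_le (e n))
  have hu₁le := hfacts.mono fun n h => h.2.2.1
  have hu₂le := hfacts.mono fun n h => h.2.2.2.1
  -- enough samples
  have hslack : 0 ≤ slack R q := by
    -- The Krawtchouk exponent is described only up to relative weight 1/2, and K² is invariant
    -- under w ↦ m - w. The side is decided by the limit ω rather than by each w₂, so that w'
    -- converges.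
    let w' : ℕ → ℕ := fun n => if ω ≤ 1 - R + lam - ω then (p n).w₂ else (p n).m₂ - (p n).w₂
    have hw' : Tendsto (fun n => (w' n : ℝ) / n) U (𝓝 ω') := by
      by_cases hc : ω ≤ 1 - R + lam - ω
      · simp only [w', hc, if_true]
        rwa [hω', min_eq_left hc]
      · simp only [w', hc, if_false]
        rw [hω', min_eq_right (not_le.1 hc).le]
        exact tendsto_natSub_div hm₂ hω (hsb.mono fun n h => h.1)
    have hA := tendsto_logb_mul (tendsto_logb_choose hF hm₁ hν₁ hu₁le) (tendsto_logb_two_pow hlam)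
      hcu₁ (Eventually.of_forall fun n => by positivity)
    have := le_krExp_of_rate hF hm₂ hν₂ hw' hu₂le
      (by filter_upwards [hsb] with n h
          simp only [w']
          split_ifs
          · exact h.1
          · exact Nat.sub_le _ _) hM ν₂0 x1 hω'0 y1 hA
      (by filter_upwards [hcu₁] with n h; positivity)
      (by filter_upwards [hsb, hu₂le] with n h hu
          refine h.2.trans (le_of_eq ?_)
          simp only [w']
          split_ifs
          · rfl
          · rw [Nat.choose_symm h.1, ← sq_abs, ← abs_krawtchouk_sub hu h.1, sq_abs])
    change 0 ≤ (1 - R + lam) * krExp (ν₂ / (1 - R + lam)) (ω' / (1 - R + lam)) - lam -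
      scaledEntropy (R - lam - σ) ν₁
    linarith
  -- the rate of the success probability
  have hprob : Tendsto (fun n => Real.logb 2 ((p n).succProb (e n)) / n) U
      (𝓝 (scaledEntropy σ (deltaGV R - ν₁ - ν₂) + scaledEntropy (R - lam - σ) ν₁ +
        scaledEntropy (1 - R + lam) ν₂ - (1 - R))) := by
    have h1 := tendsto_logb_div (tendsto_logb_mul (tendsto_logb_mul
      (tendsto_logb_choose hF hσ ht (hfacts.mono fun n h => h.2.1))
      (tendsto_logb_choose hF hm₁ hν₁ hu₁le) hcs hcu₁)
      (tendsto_logb_choose hF hm₂ hν₂ hu₂le)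
      (by filter_upwards [hcs, hcu₁] with n a b using mul_pos a b) hcu₂)
      (tendsto_logb_choose hF (tendsto_self_div hF) heU
        (Eventually.of_forall fun n => hammingNorm_le (e n)))
      (by filter_upwards [hcs, hcu₁, hcu₂] with n a b c using mul_pos (mul_pos a b) c) hcn
    rw [scaledEntropy_one, (deltaGV_spec hR₀ hR₁).2] at h1
    refine h1.congr' ?_
    filter_upwards [hfacts] with n h
    rw [h.2.2.2.2]
  -- Every lower bound B for the cost of an iteration gives time ≥ B / P_succ. It is applied below
  -- to 2^s, to one list, and to the collisions, one for each entry of the maximum in β.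
  have key : ∀ (B : ℕ → ℝ) (b : ℝ), Tendsto (fun n => Real.logb 2 (B n) / n) U (𝓝 b) →
      (∀ᶠ n in (U : Filter ℕ), 0 < B n) → (∀ᶠ n in (U : Filter ℕ), B n ≤ (p n).stepAverage) →
      b + (1 - R - scaledEntropy σ (deltaGV R - ν₁ - ν₂) - scaledEntropy (R - lam - σ) ν₁ -
        scaledEntropy (1 - R + lam) ν₂) ≤ alphaDumer89 R - ε := by
    intro B b hB hB0 hBle
    have h1 := tendsto_logb_div hB hprob hB0 hpos
    have h2 : b - (scaledEntropy σ (deltaGV R - ν₁ - ν₂) + scaledEntropy (R - lam - σ) ν₁ +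
        scaledEntropy (1 - R + lam) ν₂ - (1 - R)) ≤ alphaDumer89 R - ε := by
      refine le_of_tendsto h1 ?_
      filter_upwards [hB0, hBle, hpos, hbets, hbad] with n a1 a2 a3 a4 a5
      refine le_trans (div_le_div_of_nonneg_right
        (Real.logb_le_logb_of_le (by norm_num) (div_pos a1 a3) ?_) (Nat.cast_nonneg n)) a5.le
      rw [Params.time_eq, div_le_iff₀ a3]
      have h3 : B n * 1 ≤ (p n).stepAverage * (((p n).iter : ℝ) * (p n).succProb (e n)) :=
        mul_le_mul a2 a4 zero_le_one (a1.le.trans a2)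
      linarith
    linarith
  have hw_half : ∀ᶠ n in (U : Filter ℕ), (p n).w₂ - (p n).w₂ / 2 ≤ (p n).m₂ - (p n).m₂ / 2 :=
    hsb.mono fun n h => by have := h.1; omega
  have hw_half' : ∀ᶠ n in (U : Filter ℕ), (p n).w₂ / 2 ≤ (p n).m₂ / 2 :=
    hsb.mono fun n h => by have := h.1; omega
  have hL2 := tendsto_logb_choose hF (tendsto_sub_half_div hF hm₂) (tendsto_sub_half_div hF hω)
    hw_half
  have hL1 := tendsto_logb_choose hF (tendsto_half_div hF hm₂) (tendsto_half_div hF hω) hw_half'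
  have hL2pos : ∀ᶠ n in (U : Filter ℕ),
      (0 : ℝ) < ((p n).m₂ - (p n).m₂ / 2).choose ((p n).w₂ - (p n).w₂ / 2) :=
    hw_half.mono fun n h => by exact_mod_cast Nat.choose_pos h
  have hL1pos : ∀ᶠ n in (U : Filter ℕ), (0 : ℝ) < ((p n).m₂ / 2).choose ((p n).w₂ / 2) :=
    hw_half'.mono fun n h => by exact_mod_cast Nat.choose_pos h
  rw [scaledEntropy_mul] at hL1 hL2
  have hkn : ∀ᶠ n in (U : Filter ℕ), k n < n := by
    filter_upwards [hkU.eventually_lt_const hR₁, hF (eventually_ge_atTop 1)] with n h1 h2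
    have hn : (0 : ℝ) < n := by exact_mod_cast h2
    rw [div_lt_one hn] at h1
    exact_mod_cast h1
  have k1 := key _ _ (tendsto_logb_two_pow hσ) (Eventually.of_forall fun n => by positivity)
    (Eventually.of_forall fun n => (p n).two_pow_le_stepAverage)
  have k2 := key _ _ hL2 hL2pos (Eventually.of_forall fun n => (p n).list_le_stepAverage)
  have hpairs := tendsto_logb_mul hL1 hL2 hL1pos hL2pos
  have k3 := key (fun n => (p n).pairs / 2 ^ (p n).l / 4) _
    (tendsto_logb_div (tendsto_logb_div hpairs (tendsto_logb_two_pow hlam)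
      (by filter_upwards [hL1pos, hL2pos] with n a b using mul_pos a b)
      (Eventually.of_forall fun n => by positivity)) (tendsto_logb_const hF 4)
      (by filter_upwards [hL1pos, hL2pos] with n a b using div_pos (mul_pos a b) (by positivity))
      (Eventually.of_forall fun n => by norm_num))
    (by filter_upwards [hL1pos, hL2pos] with n a b
        have : 0 < (p n).pairs := mul_pos a b
        positivity)
    (hkn.mono fun n h => (p n).collisions_le_stepAverage h)
  have hfinal : beta R q ≤ alphaDumer89 R - ε := by
    rw [beta_eq]
    change max σ (max (1 / 2 * scaledEntropy (1 - R + lam) ω')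
      (scaledEntropy (1 - R + lam) ω' - lam)) +
      (1 - R - scaledEntropy σ (deltaGV R - ν₁ - ν₂) - scaledEntropy (R - lam - σ) ν₁ -
        scaledEntropy (1 - R + lam) ν₂) ≤ _
    rw [hωe]
    have : max σ (max (1 / 2 * scaledEntropy (1 - R + lam) ω)
      (scaledEntropy (1 - R + lam) ω - lam)) ≤ alphaDumer89 R - ε -
      (1 - R - scaledEntropy σ (deltaGV R - ν₁ - ν₂) - scaledEntropy (R - lam - σ) ν₁ -
        scaledEntropy (1 - R + lam) ν₂) :=
      max_le (by linarith) (max_le (by linarith) (by linarith))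
    linarith
  have := alphaDumer89_le_beta hR₀ hR₁ hq hslack
  linarith

end RLPN

end

noncomputable section

namespace RLPN

open Filter Topology

/-! ### Weights with a large Krawtchouk value -/

/-- Below the first root, the Krawtchouk values are exponentially as large as their upper bound for
some weights of any prescribed rate. -/
theorem exists_weights {m u : ℕ → ℕ} {M ν ω : ℝ}
    (hm : Tendsto (fun n => (m n : ℝ) / n) atTop (𝓝 M))
    (hu : Tendsto (fun n => (u n : ℝ) / n) atTop (𝓝 ν))
    (hum : ∀ᶠ n in atTop, u n ≤ m n) (hmn : ∀ᶠ n in atTop, m n ≤ n) (hM : 0 < M) (hν₀ : 0 ≤ ν)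
    (hν : ν / M < 1 / 2) (hω₀ : 0 < ω) (hω : ω / M ≤ 1 / 2) (hlt : ν / M < omegaPerp (ω / M)) :
    ∃ w : ℕ → ℕ, Tendsto (fun n => (w n : ℝ) / n) atTop (𝓝 ω) ∧ ∀ᶠ n in atTop, w n ≤ m n ∧
      (1 - zKraw (ν / M) (ω / M)) ^ u n * (1 + zKraw (ν / M) (ω / M)) ^ (m n - u n) ≤
        (m n + 1) * (|krawtchouk (m n) (w n) (u n)| * zKraw (ν / M) (ω / M) ^ w n) := by
  have hx0 : 0 ≤ ν / M := div_nonneg hν₀ hM.le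
  obtain ⟨r0, r1, hquad, -, hcond⟩ := zKraw_facts hx0 hν (div_pos hω₀ hM) hω hlt
  set r := zKraw (ν / M) (ω / M)
  have hquad' : (M - ω) * r ^ 2 - (M - 2 * ν) * r + ω = 0 := by
    have := congrArg (M * ·) hquad
    simp only [mul_zero] at this
    rw [← this]
    field_simp
  have hcond' : ν * (1 + r) ^ 2 < (M - ν) * (1 - r) ^ 2 := by
    have := mul_lt_mul_of_pos_left hcond hM
    have e1 : M * ((1 + r) ^ 2 * (ν / M)) = ν * (1 + r) ^ 2 := by field_simp
    have e2 : M * ((1 - r) ^ 2 * (1 - ν / M)) = (M - ν) * (1 - r) ^ 2 := by field_simp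
    rwa [e1, e2] at this
  have hex : ∀ n, ∃ w, u n ≤ m n → w ≤ m n ∧ (1 - r) ^ u n * (1 + r) ^ (m n - u n) ≤
      (m n + 1) * (|krawtchouk (m n) w (u n)| * r ^ w) := by
    intro n
    by_cases h : u n ≤ m n
    -- The weight is the index of the dominant term of the generating function at the saddle point;
    -- its rate is not prescribed but computed.
    · obtain ⟨w, h1, h2⟩ := exists_krawtchouk_mul_pow_ge h r0
      exact ⟨w, fun _ => ⟨h1, h2⟩⟩
    · exact ⟨0, fun h' => absurd h' h⟩
  choose w hw using hex
  have hw' := hum.mono fun n hn => hw n hn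
  refine ⟨w, ?_, hw'⟩
  rw [tendsto_iff_ultrafilter]
  intro U hU
  obtain ⟨b, hb⟩ := exists_tendsto_of_mem_Icc U (fun n => (w n : ℝ) / n) (by
    filter_upwards [hU hw', hU hmn] with n h1 h2
    exact natCast_div_mem_Icc (h1.1.trans h2))
  suffices b = ω by rwa [this] at hb
  have hmU := hm.mono_left hU
  have huU := hu.mono_left hU
  have hmu := tendsto_natSub_div hmU huU (hU hum)
  have hm1 := tendsto_logb_natCast hU (tendsto_add_const_div hU hmU 1)
  set g : ℝ → ℝ := fun ρ =>
    ν * Real.logb 2 (1 - ρ) + (M - ν) * Real.logb 2 (1 + ρ) - b * Real.logb 2 ρ with hg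
  -- At radius r the Krawtchouk value is as large as Cauchy's bound up to a factor m + 1, while the
  -- bounds at nearby radii ρ also apply to it. Comparing rates gives g(r) ≤ g(ρ).
  have hmin : IsLocalMin g r := by
    have c1 : ∀ᶠ ρ in 𝓝 r, 0 < ρ := lt_mem_nhds r0
    have c2 : ∀ᶠ ρ in 𝓝 r, ρ < 1 := gt_mem_nhds r1
    have c3 : ∀ᶠ ρ in 𝓝 r, ν * (1 + ρ) ^ 2 < (M - ν) * (1 - ρ) ^ 2 := by
      have a1 : ContinuousAt (fun ρ : ℝ => ν * (1 + ρ) ^ 2) r := by fun_prop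
      have a2 : ContinuousAt (fun ρ : ℝ => (M - ν) * (1 - ρ) ^ 2) r := by fun_prop
      exact a1.eventually_lt a2 hcond'
    filter_upwards [c1, c2, c3] with ρ h0 h1 h2
    have rate : ∀ z : ℝ, 0 < z → z < 1 → Tendsto (fun n => Real.logb 2
        ((1 - z) ^ u n * (1 + z) ^ (m n - u n) / z ^ w n) / n) U (𝓝 (g z)) := by
      intro z z0 z1
      have hz1 : 0 < 1 - z := by linarith
      have hz2 : 0 < 1 + z := by linarith
      exact tendsto_logb_div (tendsto_logb_mul (tendsto_logb_pow (1 - z) huU)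
        (tendsto_logb_pow (1 + z) hmu) (Eventually.of_forall fun n => by positivity)
        (Eventually.of_forall fun n => by positivity)) (tendsto_logb_pow z hb)
        (Eventually.of_forall fun n => by positivity) (Eventually.of_forall fun n => by positivity)
    have hρ1 : 0 < 1 - ρ := by linarith
    have hr1 : 0 < 1 - r := by linarith
    have hev : ∀ᶠ n in (U : Filter ℕ),
        (u n : ℝ) / n * (1 + ρ) ^ 2 < ((m n : ℝ) / n - u n / n) * (1 - ρ) ^ 2 :=
      (huU.mul_const _).eventually_lt ((hmU.sub huU).mul_const _) h2
    have key := le_of_rates (rate r r0 r1) (tendsto_logb_mul hm1 (rate ρ h0 h1)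
      (Eventually.of_forall fun n => by positivity) (Eventually.of_forall fun n => by positivity))
      (Eventually.of_forall fun n => by positivity) (by
        filter_upwards [hU hw', hU hum, hev, hU (eventually_ge_atTop 1)] with n a1 a2 a3 a4
        have hn : (0 : ℝ) < n := by exact_mod_cast a4
        have hK : |krawtchouk (m n) (w n) (u n)| ≤
            (1 - ρ) ^ u n * (1 + ρ) ^ (m n - u n) / ρ ^ w n := by
          rw [le_div_iff₀ (by positivity)]
          refine abs_krawtchouk_mul_pow_le _ h0 h1 a2 ?_
          have := mul_le_mul_of_nonneg_left a3.le hn.le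
          have e1 : (n : ℝ) * ((u n : ℝ) / n * (1 + ρ) ^ 2) = u n * (1 + ρ) ^ 2 := by field_simp
          have e2 : (n : ℝ) * (((m n : ℝ) / n - u n / n) * (1 - ρ) ^ 2) =
              (m n - u n) * (1 - ρ) ^ 2 := by field_simp
          rwa [e1, e2] at this
        rw [div_le_iff₀ (by positivity), Nat.cast_add, Nat.cast_one, mul_assoc]
        refine a1.2.trans ?_
        gcongr)
    rwa [zero_add] at key
  have hl := log_two_pos.ne'
  have hd : HasDerivAt g (ν * (-1 / (1 - r) / Real.log 2) + (M - ν) * (1 / (1 + r) / Real.log 2) -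
      b * (1 / r / Real.log 2)) r := by
    have d1 : HasDerivAt (fun ρ : ℝ => Real.logb 2 (1 - ρ)) (-1 / (1 - r) / Real.log 2) r :=
      (((hasDerivAt_id r).const_sub 1).log (by simp only [id]; linarith)).div_const _
    have d2 : HasDerivAt (fun ρ : ℝ => Real.logb 2 (1 + ρ)) (1 / (1 + r) / Real.log 2) r :=
      (((hasDerivAt_id r).const_add 1).log (by simp only [id]; linarith)).div_const _
    have d3 : HasDerivAt (fun ρ : ℝ => Real.logb 2 ρ) (1 / r / Real.log 2) r :=
      ((hasDerivAt_id r).log r0.ne').div_const _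
    exact ((d1.const_mul ν).add (d2.const_mul (M - ν))).sub (d3.const_mul b)
  have h0 := hmin.hasDerivAt_eq_zero hd
  have hr1 : 1 - r ≠ 0 := by linarith
  have hr2 : 1 + r ≠ 0 := by linarith
  have hr0 := r0.ne'
  field_simp at h0
  -- The equation g'(r) = 0 is the quadratic equation of r with b in place of ω. The difference of
  -- the two equations is this product.
  have hfac : (b - ω) * (1 - r ^ 2) = 0 := by nlinarith
  have : 1 - r ^ 2 ≠ 0 := by nlinarith
  have := (mul_eq_zero.1 hfac).resolve_right this
  linarith

end RLPN

end

noncomputable section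

namespace RLPN

open Filter Topology

/-! ### Parameters reaching the exponent -/

theorem tendsto_logb_max {F : Filter ℕ} {a b : ℕ → ℝ} {α β : ℝ}
    (ha : Tendsto (fun n => Real.logb 2 (a n) / n) F (𝓝 α))
    (hb : Tendsto (fun n => Real.logb 2 (b n) / n) F (𝓝 β))
    (ha0 : ∀ᶠ n in F, 0 < a n) (hb0 : ∀ᶠ n in F, 0 < b n) :
    Tendsto (fun n => Real.logb 2 (max (a n) (b n)) / n) F (𝓝 (max α β)) := by
  refine (ha.max hb).congr' ?_
  filter_upwards [ha0, hb0] with n h1 h2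
  have mono : ∀ {x y : ℝ}, 0 < x → x ≤ y → Real.logb 2 x / n ≤ Real.logb 2 y / n := fun hx hxy =>
    div_le_div_of_nonneg_right (Real.logb_le_logb_of_le (by norm_num) hx hxy) (Nat.cast_nonneg n)
  rcases le_total (a n) (b n) with h | h
  · rw [max_eq_right h, max_eq_right (mono h1 h)]
  · rw [max_eq_left h, max_eq_left (mono h2 h)]

theorem eventually_le_of_rates {F : Filter ℕ} {a b : ℕ → ℝ} {α β : ℝ}
    (ha : Tendsto (fun n => Real.logb 2 (a n) / n) F (𝓝 α))
    (hb : Tendsto (fun n => Real.logb 2 (b n) / n) F (𝓝 β))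
    (hb0 : ∀ᶠ n in F, 0 < b n) (hαβ : α < β) : ∀ᶠ n in F, a n ≤ b n := by
  filter_upwards [ha.eventually_lt hb hαβ, hb0] with n h1 h2
  by_contra h
  have h3 := div_le_div_of_nonneg_right
    (Real.logb_le_logb_of_le (b := 2) (by norm_num) h2 (not_le.1 h).le) (Nat.cast_nonneg (α := ℝ) n)
  linarith

theorem eventually_lt_of_tendsto_natCast {F : Filter ℕ} {a b : ℕ → ℕ} {α β : ℝ}
    (ha : Tendsto (fun n => (a n : ℝ) / n) F (𝓝 α))
    (hb : Tendsto (fun n => (b n : ℝ) / n) F (𝓝 β)) (h : α < β) : ∀ᶠ n in F, a n < b n := by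
  filter_upwards [ha.eventually_lt hb h] with n h1
  by_contra h2
  have : (b n : ℝ) / n ≤ a n / n :=
    div_le_div_of_nonneg_right (by exact_mod_cast not_lt.1 h2) (Nat.cast_nonneg n)
  linarith

/-- Integer sequences of prescribed rate below a given sequence. -/
theorem exists_natSeq_le {b : ℕ → ℕ} {α β : ℝ}
    (hb : Tendsto (fun n => (b n : ℝ) / n) atTop (𝓝 β)) (hα : 0 ≤ α) (hαβ : α < β) :
    ∃ a : ℕ → ℕ, (∀ n, a n ≤ b n) ∧ Tendsto (fun n => (a n : ℝ) / n) atTop (𝓝 α) := by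
  have h1 : Tendsto (fun n : ℕ => (⌊α * n⌋₊ : ℝ) / n) atTop (𝓝 α) :=
    (tendsto_nat_floor_mul_div_atTop hα).comp tendsto_natCast_atTop_atTop
  refine ⟨fun n => min ⌊α * n⌋₊ (b n), fun n => min_le_right _ _, h1.congr' ?_⟩
  filter_upwards [eventually_lt_of_tendsto_natCast h1 hb hαβ] with n hn
  rw [min_eq_left hn.le]

namespace Params

variable {n k : ℕ} (p : Params n k)

theorem succProb_le_one (e : Word n) : p.succProb e ≤ 1 := by
  rw [succProb]
  refine div_le_one_of_le₀ ?_ (Nat.cast_nonneg _)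
  exact_mod_cast Finset.card_le_univ _

/-- The constant is s + 8 = (s + 2) + 1 + 1 + 2 + 2: Fourier transform and maximum, the two lists,
the collisions counted twice, and the additive 2 absorbed by 2^s ≥ 1. -/
theorem stepAverage_le_max : p.stepAverage ≤ ((p.s + 8 : ℕ) : ℝ) *
    max (2 ^ p.s) (max (max ((p.m₂ / 2).choose (p.w₂ / 2) : ℝ)
      ((p.m₂ - p.m₂ / 2).choose (p.w₂ - p.w₂ / 2))) (p.pairs / 2 ^ p.l)) := by
  refine p.stepAverage_le.trans ?_
  set L1 := ((p.m₂ / 2).choose (p.w₂ / 2) : ℝ)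
  set L2 := ((p.m₂ - p.m₂ / 2).choose (p.w₂ - p.w₂ / 2) : ℝ)
  set P := p.pairs / 2 ^ p.l
  set B := max ((2 : ℝ) ^ p.s) (max (max L1 L2) P)
  have h1 : (2 : ℝ) ^ p.s ≤ B := le_max_left _ _
  have h2 : max (max L1 L2) P ≤ B := le_max_right _ _
  have h3 : L1 ≤ B := ((le_max_left _ _).trans (le_max_left _ _)).trans h2
  have h4 : L2 ≤ B := ((le_max_right _ _).trans (le_max_left _ _)).trans h2
  have h5 : P ≤ B := (le_max_right _ _).trans h2
  have h6 : (1 : ℝ) ≤ 2 ^ p.s := one_le_pow₀ (by norm_num)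
  have h7 : ((p.s : ℝ) + 2) * 2 ^ p.s ≤ (p.s + 2) * B :=
    mul_le_mul_of_nonneg_left h1 (by positivity)
  push_cast
  linarith

/-- An explicit lower bound for `N δ²`. -/
theorem le_numChecks_mul_bias_sq (hk : k < n) (hu₁ : p.u₁ ≤ p.m₁) (hu₂ : p.u₂ ≤ p.m₂)
    (hw₁ : p.w₁ ≤ p.m₁) (hw₂ : p.w₂ ≤ p.m₂) {A r : ℝ} (hA : 0 ≤ A) (hr : 0 < r)
    (h₁ : 2 ^ p.m₁ / p.m₁.choose p.u₁ ≤
      (p.m₁ + 1) * (krawtchouk p.m₁ p.w₁ p.u₁ ^ 2 / p.m₁.choose p.w₁))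
    (h₂ : A ≤ (p.m₂ + 1) * (|krawtchouk p.m₂ p.w₂ p.u₂| * r ^ p.w₂)) :
    p.pairs * (A / r ^ p.w₂) ^ 2 / (((p.m₂ + 1 : ℕ) : ℝ) ^ 2 * (p.m₂.choose p.w₂ : ℝ) ^ 2 *
      ((p.m₁ + 1 : ℕ) : ℝ) * p.m₁.choose p.u₁ * 2 ^ p.l) / 4 ≤ p.numChecks * p.bias ^ 2 := by
  have h3 := mul_le_mul_of_nonneg_right (p.le_numChecks hk) (sq_nonneg p.bias)
  rw [div_mul_eq_mul_div, p.expectedChecks_mul_bias_sq hu₁ hu₂ hw₁ hw₂] at h3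
  refine le_trans (div_le_div_of_nonneg_right ?_ (by norm_num)) h3
  have c1 : (0 : ℝ) < p.m₁.choose p.u₁ := by exact_mod_cast Nat.choose_pos hu₁
  have c2 : (0 : ℝ) < p.m₂.choose p.w₂ := by exact_mod_cast Nat.choose_pos hw₂
  have c3 : 0 ≤ p.pairs := by rw [pairs]; positivity
  have h4 : 2 ^ p.m₁ / p.m₁.choose p.u₁ / ((p.m₁ + 1 : ℕ) : ℝ) ≤
      krawtchouk p.m₁ p.w₁ p.u₁ ^ 2 / p.m₁.choose p.w₁ := by
    rw [div_le_iff₀ (by positivity)]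
    push_cast
    linarith
  have h5 : (A / r ^ p.w₂ / ((p.m₂ + 1 : ℕ) : ℝ)) ^ 2 ≤ krawtchouk p.m₂ p.w₂ p.u₂ ^ 2 := by
    rw [← sq_abs (krawtchouk _ _ _)]
    refine pow_le_pow_left₀ (by positivity) ?_ 2
    rw [div_le_iff₀ (by positivity), div_le_iff₀ (by positivity)]
    push_cast
    linarith
  calc _ = p.pairs / p.m₂.choose p.w₂ * ((2 ^ p.m₁ / p.m₁.choose p.u₁ / ((p.m₁ + 1 : ℕ) : ℝ)) *
        ((A / r ^ p.w₂ / ((p.m₂ + 1 : ℕ) : ℝ)) ^ 2 / p.m₂.choose p.w₂) /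
          (2 ^ p.m₁ * 2 ^ p.l)) := by field_simp
    _ ≤ _ := by gcongr

end Params

/-- Strictly feasible rates are reached by admissible parameters. -/
theorem exists_admissible {R : ℝ} (hR₀ : 0 < R) (hR₁ : R < 1) {k : ℕ → ℕ} {e : ∀ n, Word n}
    (hkn : ∀ n, k n ≤ n) (hk : Tendsto (fun n : ℕ => (k n : ℝ) / n) atTop (𝓝 R))
    (he : Tendsto (fun n : ℕ => (hammingNorm (e n) : ℝ) / n) atTop (𝓝 (deltaGV R)))
    {q : Rates} (hq : StrictlyFeasible R q) {ε : ℝ} (hε : 0 < ε) :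
    ∃ p : ∀ n, Params n (k n), Admissible e p ∧
      ∀ᶠ n : ℕ in atTop, Real.logb 2 (p n).time / n ≤ beta R q + ε := by
  obtain ⟨σ_pos, ν₁_pos, ν₂_pos, lam_pos, sum_lt, ν₁_lt, lt_sum, ν_sum_lt, ω₂_pos, ω₂_lt,
    slack_pos⟩ := hq
  obtain ⟨σ, ν₁, ν₂, lam, ω₁, ω⟩ := q
  dsimp only at *
  have hτ := deltaGV_lt hR₀ hR₁
  obtain ⟨s, hsk, hs⟩ := exists_natSeq_le hk σ_pos.le (by linarith)
  have hks := tendsto_natSub_div hk hs (Eventually.of_forall hsk)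
  obtain ⟨l, hlk, hl⟩ := exists_natSeq_le hks lam_pos.le (by linarith)
  have hsl : ∀ n, s n + l n ≤ k n := fun n => by have := hsk n; have := hlk n; omega
  set m1 : ℕ → ℕ := fun n => k n - l n - s n with hm1d
  set m2 : ℕ → ℕ := fun n => n - k n + l n with hm2d
  have hm1 : Tendsto (fun n => (m1 n : ℝ) / n) atTop (𝓝 (R - lam - σ)) :=
    tendsto_natSub_div (tendsto_natSub_div hk hl (Eventually.of_forall fun n => by
      have := hsl n; omega)) hs (Eventually.of_forall fun n => by have := hsl n; omega)
  have hm2 : Tendsto (fun n => (m2 n : ℝ) / n) atTop (𝓝 (1 - R + lam)) :=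
    tendsto_natAdd_div (tendsto_natSub_div (tendsto_self_div le_rfl) hk
      (Eventually.of_forall hkn)) hl
  have hM : 0 < 1 - R + lam := by linarith
  obtain ⟨u1, hu1m, hu1⟩ := exists_natSeq_le hm1 ν₁_pos.le ν₁_lt
  obtain ⟨u2, hu2m, hu2⟩ := exists_natSeq_le hm2 ν₂_pos.le (by linarith)
  have hν : ν₂ / (1 - R + lam) < 1 / 2 := by rw [div_lt_iff₀ hM]; linarith
  have hx0 : 0 ≤ ν₂ / (1 - R + lam) := by positivity
  have hy0 : 0 < ω / (1 - R + lam) := by positivity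
  have hy1 : ω / (1 - R + lam) ≤ 1 / 2 := ω₂_lt.le.trans (omegaPerp_le_half _)
  have hxy := (lt_omegaPerp_comm hx0 hν.le hy0.le hy1).2 ω₂_lt
  have hm2n : ∀ n, m2 n ≤ n := fun n => by
    have := hsl n; have := hkn n; simp only [hm2d]; omega
  obtain ⟨w2, hw2, hw2'⟩ := exists_weights hm2 hu2 (Eventually.of_forall hu2m)
    (Eventually.of_forall hm2n) hM ν₂_pos.le hν ω₂_pos hy1 hxy
  obtain ⟨r0, r1, -⟩ := zKraw_facts hx0 hν hy0 hy1 hxy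
  have hkr := krExp_of_le hx0 hxy.le
  have hkr' := mul_krExpLow (ν := ν₂) (ω := ω) hM
  set r := zKraw (ν₂ / (1 - R + lam)) (ω / (1 - R + lam))
  have hr1 : 0 < 1 - r := by linarith
  -- No rate is needed for w₁: the orthogonality relation provides a nearly optimal weight for each
  -- n.
  choose w1 hw1m hw1 using fun n => exists_krawtchouk_sq_div_ge (hu1m n)
  have hw2m : ∀ᶠ n in atTop, w2 n ≤ m2 n := hw2'.mono fun n hn => hn.1
  have hu := tendsto_natAdd_div hu1 hu2
  have hut := (eventually_lt_of_tendsto_natCast hu he (by linarith)).mono fun n hn => hn.le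
  set t : ℕ → ℕ := fun n => hammingNorm (e n) - u1 n - u2 n with htd
  have ht : Tendsto (fun n => (t n : ℝ) / n) atTop (𝓝 (deltaGV R - ν₁ - ν₂)) :=
    tendsto_natSub_div (tendsto_natSub_div he hu1 (hut.mono fun n hn => by omega)) hu2
      (hut.mono fun n hn => by omega)
  have hts := (eventually_lt_of_tendsto_natCast ht hs (by linarith)).mono fun n hn => hn.le
  have hkn' := eventually_lt_of_tendsto_natCast hk (tendsto_self_div le_rfl) hR₁
  set PS : ℕ → ℝ := fun n => (s n).choose (t n) * (m1 n).choose (u1 n) * (m2 n).choose (u2 n) /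
    n.choose (hammingNorm (e n)) with hPSd
  have choose_pos : ∀ {a b : ℕ}, b ≤ a → (0 : ℝ) < a.choose b := fun h => by
    exact_mod_cast Nat.choose_pos h
  have hPS0 : ∀ᶠ n in atTop, 0 < PS n := by
    filter_upwards [hts] with n hn
    exact div_pos (mul_pos (mul_pos (choose_pos hn) (choose_pos (hu1m n))) (choose_pos (hu2m n)))
      (choose_pos (hammingNorm_le (e n)))
  have hPS : Tendsto (fun n => Real.logb 2 (PS n) / n) atTop
      (𝓝 (scaledEntropy σ (deltaGV R - ν₁ - ν₂) + scaledEntropy (R - lam - σ) ν₁ +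
        scaledEntropy (1 - R + lam) ν₂ - (1 - R))) := by
    have h1R : scaledEntropy 1 (deltaGV R) = 1 - R := by
      rw [scaledEntropy_one, (deltaGV_spec hR₀ hR₁).2]
    have p1 : ∀ᶠ n in atTop, (0 : ℝ) < (s n).choose (t n) := hts.mono fun n hn => choose_pos hn
    have p2 : ∀ᶠ n in atTop, (0 : ℝ) < (m1 n).choose (u1 n) :=
      Eventually.of_forall fun n => choose_pos (hu1m n)
    have p3 : ∀ᶠ n in atTop, (0 : ℝ) < (m2 n).choose (u2 n) :=
      Eventually.of_forall fun n => choose_pos (hu2m n)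
    have p4 : ∀ᶠ n : ℕ in atTop, (0 : ℝ) < n.choose (hammingNorm (e n)) :=
      Eventually.of_forall fun n => choose_pos (hammingNorm_le (e n))
    have := tendsto_logb_div (tendsto_logb_mul (tendsto_logb_mul
      (tendsto_logb_choose le_rfl hs ht hts)
      (tendsto_logb_choose le_rfl hm1 hu1 (Eventually.of_forall hu1m)) p1 p2)
      (tendsto_logb_choose le_rfl hm2 hu2 (Eventually.of_forall hu2m)) (p1.mp (p2.mono
        fun n h2 h1 => mul_pos h1 h2)) p3)
      (tendsto_logb_choose le_rfl (tendsto_self_div le_rfl) he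
        (Eventually.of_forall fun n => hammingNorm_le (e n)))
      (p1.mp (p2.mp (p3.mono fun n h3 h2 h1 => mul_pos (mul_pos h1 h2) h3))) p4
    rwa [h1R] at this
  -- With n/P_succ iterations the expected number of correct bets is at least n, which tends to
  -- infinity at only a polynomial cost.
  set p : ∀ n, Params n (k n) := fun n =>
    ⟨s n, l n, u1 n, u2 n, w1 n, w2 n, ⌈n / PS n⌉₊, hsl n, hkn n⟩ with hpd
  have hsucc : ∀ᶠ n in atTop, (p n).succProb (e n) = PS n := by
    filter_upwards [hut] with n hn
    rw [Params.succProb_eq]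
    exact congrArg (· / _) (if_pos hn)
  have hE1 : ∀ᶠ n in atTop, w2 n / 2 ≤ m2 n / 2 := hw2m.mono fun n hn => by omega
  have hE2 : ∀ᶠ n in atTop, w2 n - w2 n / 2 ≤ m2 n - m2 n / 2 := hw2m.mono fun n hn => by omega
  have hL1 := tendsto_logb_choose le_rfl (tendsto_half_div le_rfl hm2)
    (tendsto_half_div le_rfl hw2) hE1
  have hL2 := tendsto_logb_choose le_rfl (tendsto_sub_half_div le_rfl hm2)
    (tendsto_sub_half_div le_rfl hw2) hE2
  rw [scaledEntropy_mul] at hL1 hL2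
  have hL1pos := hE1.mono fun n hn => choose_pos hn
  have hL2pos := hE2.mono fun n hn => choose_pos hn
  have hpairs : Tendsto (fun n => Real.logb 2 (p n).pairs / n) atTop _ :=
    tendsto_logb_mul hL1 hL2 hL1pos hL2pos
  have hpairspos : ∀ᶠ n in atTop, 0 < (p n).pairs :=
    hL1pos.mp (hL2pos.mono fun n h2 h1 => mul_pos h1 h2)
  have two_pos : ∀ a : ℕ → ℕ, ∀ᶠ n in atTop, (0 : ℝ) < 2 ^ a n := fun a =>
    Eventually.of_forall fun n => by positivity
  have succ_pos : ∀ a : ℕ → ℕ, ∀ c : ℕ, 0 < c → ∀ᶠ n in atTop, (0 : ℝ) < ((a n + c : ℕ) : ℝ) :=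
    fun a c hc => Eventually.of_forall fun n => by positivity
  refine ⟨p, ⟨?_, ?_, ?_⟩, ?_⟩
  · have h1 : Tendsto (fun n => (s n : ℝ) / n * n) atTop atTop :=
      hs.pos_mul_atTop σ_pos tendsto_natCast_atTop_atTop
    have h2 : Tendsto (fun n => (s n : ℝ)) atTop atTop := h1.congr' (by
      filter_upwards [eventually_ge_atTop 1] with n hn
      have : (n : ℝ) ≠ 0 := by exact_mod_cast (by omega : n ≠ 0)
      field_simp)
    exact tendsto_natCast_atTop_iff.1 h2
  · have hA := tendsto_logb_div (tendsto_logb_mul (tendsto_logb_pow (1 - r) hu2)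
      (tendsto_logb_pow (1 + r) (tendsto_natSub_div hm2 hu2 (Eventually.of_forall hu2m)))
      (Eventually.of_forall fun n => by positivity) (Eventually.of_forall fun n => by positivity))
      (tendsto_logb_pow r hw2) (Eventually.of_forall fun n => by positivity)
      (Eventually.of_forall fun n => by positivity)
    have hA0 : ∀ n, 0 < (1 - r) ^ u2 n * (1 + r) ^ (m2 n - u2 n) / r ^ w2 n :=
      fun n => by positivity
    have hC2 := tendsto_logb_choose le_rfl hm2 hw2 hw2m
    have hC2pos := hw2m.mono fun n hn => choose_pos hn
    have hC1pos : ∀ᶠ n in atTop, (0 : ℝ) < (m1 n).choose (u1 n) :=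
      Eventually.of_forall fun n => choose_pos (hu1m n)
    have hden := tendsto_logb_mul (tendsto_logb_mul (tendsto_logb_mul (tendsto_logb_mul
      (tendsto_logb_sq (tendsto_logb_natCast le_rfl (tendsto_add_const_div le_rfl hm2 1)))
      (tendsto_logb_sq hC2) ((succ_pos m2 1 one_pos).mono fun n h => pow_pos h 2)
        (hC2pos.mono fun n h => pow_pos h 2))
      (tendsto_logb_natCast le_rfl (tendsto_add_const_div le_rfl hm1 1))
      (by filter_upwards [hC2pos] with n h; positivity) (succ_pos m1 1 one_pos))
      (tendsto_logb_choose le_rfl hm1 hu1 (Eventually.of_forall hu1m))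
      (by filter_upwards [hC2pos] with n h; positivity) hC1pos)
      (tendsto_logb_two_pow hl)
      (by filter_upwards [hC2pos, hC1pos] with n h h'; positivity) (two_pos l)
    have hnum := tendsto_logb_mul hpairs (tendsto_logb_sq hA) hpairspos
      (Eventually.of_forall fun n => pow_pos (hA0 n) 2)
    have hLB := tendsto_logb_div (tendsto_logb_div hnum hden
      (hpairspos.mono fun n h => mul_pos h (pow_pos (hA0 n) 2))
      (by filter_upwards [hC2pos, hC1pos] with n h h'; positivity))
      (tendsto_logb_const le_rfl 4)
      (by filter_upwards [hC2pos, hC1pos, hpairspos] with n h h' h''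
          exact div_pos (mul_pos h'' (pow_pos (hA0 n) 2)) (by positivity))
      (Eventually.of_forall fun n => by norm_num)
    rw [tendsto_atTop]
    intro J
    -- The lower bound for N δ² has rate exactly `slack`, because `pairs` has the same rate as
    -- binom(m₂, w₂). As the slack is positive, the bound beats every multiple of n.
    have hJ := eventually_le_of_rates (tendsto_logb_natCast le_rfl
      (a := fun n => (⌈J⌉₊ + 1) * n) (α := ((⌈J⌉₊ + 1 : ℕ) : ℝ)) (by
        have := (tendsto_self_div (F := atTop) le_rfl).const_mul (((⌈J⌉₊ + 1 : ℕ) : ℝ))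
        rw [mul_one] at this
        refine this.congr fun n => ?_
        push_cast; ring)) hLB
      (by filter_upwards [hC2pos, hC1pos, hpairspos] with n h h' h''
          exact div_pos (div_pos (mul_pos h'' (pow_pos (hA0 n) 2)) (by positivity)) (by norm_num))
      (by rw [slack] at slack_pos
          dsimp only at slack_pos
          rw [hkr, hkr'] at slack_pos
          linarith)
    filter_upwards [hJ, hw2', hkn', eventually_ge_atTop 1] with n h1 h2 h3 h4
    have hn : (0 : ℝ) < n := by exact_mod_cast h4
    rw [le_div_iff₀ hn]
    have h5 := (p n).le_numChecks_mul_bias_sq h3 (hu1m n) (hu2m n) (hw1m n) h2.1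
      (by positivity) r0 (hw1 n) h2.2
    refine le_trans ?_ (h1.trans h5)
    push_cast
    have := Nat.le_ceil J
    exact mul_le_mul_of_nonneg_right (by linarith) hn.le
  · refine tendsto_atTop_mono' _ ?_ tendsto_natCast_atTop_atTop
    filter_upwards [hsucc, hPS0] with n h1 h2
    rw [h1]
    have : (n : ℝ) / PS n ≤ ((p n).iter : ℝ) := Nat.le_ceil _
    rwa [div_le_iff₀ h2] at this
  · have hs8 := tendsto_logb_natCast le_rfl (tendsto_add_const_div le_rfl hs 8)
    have hn2 := tendsto_logb_natCast le_rfl (a := fun n => 2 * n) (α := 2) (by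
        have := (tendsto_self_div (F := atTop) le_rfl).const_mul 2
        rw [mul_one] at this
        refine this.congr fun n => ?_
        push_cast; ring)
    have hn2pos : ∀ᶠ n : ℕ in atTop, (0 : ℝ) < ((2 * n : ℕ) : ℝ) := by
      filter_upwards [eventually_ge_atTop 1] with n hn
      exact_mod_cast (by omega : 0 < 2 * n)
    have hL := tendsto_logb_max hL1 hL2 hL1pos hL2pos
    have hLpos := hL1pos.mono fun n h => lt_max_of_lt_left (c :=
      ((m2 n - m2 n / 2).choose (w2 n - w2 n / 2) : ℝ)) h
    have hP := tendsto_logb_div hpairs (tendsto_logb_two_pow hl) hpairspos (two_pos l)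
    have hPpos := hpairspos.mono fun n h => div_pos h (show (0 : ℝ) < 2 ^ l n by positivity)
    have hB := tendsto_logb_max (tendsto_logb_two_pow hs)
      (tendsto_logb_max hL hP hLpos hPpos) (two_pos s)
      (hPpos.mono fun n h => lt_max_of_lt_right h)
    have hBpos := (two_pos s).mono fun n h => lt_max_of_lt_left (c := max (max
      ((m2 n / 2).choose (w2 n / 2) : ℝ) ((m2 n - m2 n / 2).choose (w2 n - w2 n / 2)))
      ((p n).pairs / 2 ^ l n)) h
    have hUB := tendsto_logb_mul (tendsto_logb_div hn2 hPS hn2pos hPS0)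
      (tendsto_logb_mul hs8 hB (succ_pos s 8 (by norm_num)) hBpos)
      (by filter_upwards [hn2pos, hPS0] with n h h' using div_pos h h')
      (by filter_upwards [succ_pos s 8 (by norm_num), hBpos] with n h h' using mul_pos h h')
    have hlt := hUB.eventually_lt_const (u := beta R ⟨σ, ν₁, ν₂, lam, ω₁, ω⟩ + ε) (by
      rw [beta_eq]
      dsimp only
      rw [max_self]
      have e1 : 1 / 2 * scaledEntropy (1 - R + lam) ω + 1 / 2 * scaledEntropy (1 - R + lam) ω -
        lam = scaledEntropy (1 - R + lam) ω - lam := by ring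
      rw [e1]
      linarith)
    filter_upwards [hlt, hsucc, hPS0, eventually_ge_atTop 1] with n h1 h2 h3 h4
    refine le_trans (div_le_div_of_nonneg_right ?_ (Nat.cast_nonneg n)) h1.le
    have hn : (1 : ℝ) ≤ n := by exact_mod_cast h4
    have h5 : 0 < n / PS n := div_pos (by linarith) h3
    have hPS1 : PS n ≤ 1 := by rw [← h2]; exact (p n).succProb_le_one _
    have h6 : 1 ≤ n / PS n := by rw [le_div_iff₀ h3]; linarith
    have hstep : 0 < (p n).stepAverage :=
      lt_of_lt_of_le (by positivity) (p n).two_pow_le_stepAverage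
    have hit0 : 0 < ((p n).iter : ℝ) := lt_of_lt_of_le h5 (Nat.le_ceil _)
    have hit : ((p n).iter : ℝ) ≤ ((2 * n : ℕ) : ℝ) / PS n := by
      have : ((p n).iter : ℝ) ≤ n / PS n + 1 := (Nat.ceil_lt_add_one h5.le).le
      have e1 : ((2 * n : ℕ) : ℝ) / PS n = n / PS n + n / PS n := by push_cast; ring
      rw [e1]; linarith
    rw [Params.time_eq]
    refine Real.logb_le_logb_of_le (by norm_num) (mul_pos hit0 hstep) ?_
    exact mul_le_mul hit (p n).stepAverage_le_max hstep.le (hit0.le.trans hit)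

/-- A diagonal choice among conditions that each hold eventually. -/
theorem exists_diagonal {Q : ℕ → ℕ → Prop} (hQ : ∀ j, ∀ᶠ n in atTop, Q j n) :
    ∃ f : ℕ → ℕ, Tendsto f atTop atTop ∧ ∀ᶠ n in atTop, Q (f n) n := by
  classical
  refine ⟨fun n => Nat.findGreatest (fun j => Q j n) n, ?_, ?_⟩
  · rw [tendsto_atTop]
    intro j
    filter_upwards [hQ j, eventually_ge_atTop j] with n h1 h2
    exact Nat.le_findGreatest h2 h1
  · filter_upwards [hQ 0] with n hn
    exact Nat.findGreatest_spec (P := fun j => Q j n) (Nat.zero_le n) hn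

/-- For each j there are admissible parameters within 1/(j + 1) of the optimum. Letting j grow
slowly with n keeps the three divergence conditions and drives the excess to zero. The reverse
inequality for the diagonal choice is `lower_bound`. -/
theorem exists_optimal {R : ℝ} (hR₀ : 0 < R) (hR₁ : R < 1) {k : ℕ → ℕ} {e : ∀ n, Word n}
    (hkn : ∀ n, k n ≤ n) (hk : Tendsto (fun n : ℕ => (k n : ℝ) / n) atTop (𝓝 R))
    (he : Tendsto (fun n : ℕ => (hammingNorm (e n) : ℝ) / n) atTop (𝓝 (deltaGV R))) :
    ∃ p : ∀ n, Params n (k n), Admissible e p ∧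
      Tendsto (fun n : ℕ => Real.logb 2 (p n).time / n) atTop (𝓝 (alphaDumer89 R)) := by
  obtain ⟨q, hq, hqα⟩ := (isLeast_alphaDumer89 hR₀ hR₁).1
  have hex : ∀ j : ℕ, ∃ p : ∀ n, Params n (k n), Admissible e p ∧
      ∀ᶠ n : ℕ in atTop, Real.logb 2 (p n).time / n ≤ alphaDumer89 R + 1 / ((j : ℝ) + 1) := by
    intro j
    have hj : (0 : ℝ) < 1 / ((j : ℝ) + 1) / 2 := by positivity
    obtain ⟨q', hq', hlt⟩ := exists_strictlyFeasible hR₀ hR₁ hq hj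
    obtain ⟨p, hp, hle⟩ := exists_admissible hR₀ hR₁ hkn hk he hq' hj
    refine ⟨p, hp, hle.mono fun n hn => ?_⟩
    rw [hqα] at hlt
    linarith
  choose P hP hPt using hex
  obtain ⟨f, hf, hfQ⟩ := exists_diagonal (Q := fun j n => j ≤ (P j n).s ∧
    (j : ℝ) ≤ (P j n).numChecks * (P j n).bias ^ 2 / n ∧
    (j : ℝ) ≤ (P j n).iter * (P j n).succProb (e n) ∧
    Real.logb 2 (P j n).time / n ≤ alphaDumer89 R + 1 / ((j : ℝ) + 1)) (fun j =>
      ((hP j).secret.eventually_ge_atTop j).and (((hP j).samples.eventually_ge_atTop _).and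
        (((hP j).bets.eventually_ge_atTop _).and (hPt j))))
  have hf' : Tendsto (fun n => (f n : ℝ)) atTop atTop := tendsto_natCast_atTop_atTop.comp hf
  have hadm : Admissible e fun n => P (f n) n :=
    ⟨tendsto_atTop_mono' _ (hfQ.mono fun n h => h.1) hf,
      tendsto_atTop_mono' _ (hfQ.mono fun n h => h.2.1) hf',
      tendsto_atTop_mono' _ (hfQ.mono fun n h => h.2.2.1) hf'⟩
  refine ⟨fun n => P (f n) n, hadm, ?_⟩
  have hub : Tendsto (fun n => alphaDumer89 R + 1 / ((f n : ℝ) + 1)) atTop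
      (𝓝 (alphaDumer89 R)) := by
    have := (tendsto_const_nhds (x := alphaDumer89 R)).add
      ((tendsto_one_div_add_atTop_nhds_zero_nat (𝕜 := ℝ)).comp hf)
    rwa [add_zero] at this
  rw [tendsto_order]
  refine ⟨fun a ha => ?_, fun a ha => ?_⟩
  · have hpos : 0 < (alphaDumer89 R - a) / 2 := by linarith
    filter_upwards [lower_bound hR₀ hR₁ hk he hadm hpos] with n hn
    linarith
  · filter_upwards [hfQ, hub.eventually_lt_const ha] with n h1 h2
    exact h1.2.2.2.trans_lt h2

end RLPN

end

theorem mainTheorem9 (R : ℝ) (hR₀ : 0 < R) (hR₁ : R < 1) :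
    IsLeast (RLPN.beta R '' RLPN.region R) (RLPN.alphaDumer89 R) ∧
    ∀ (k : ℕ → ℕ) (e : ∀ n, RLPN.Word n),
      (∀ n, k n ≤ n) →
      Filter.Tendsto (fun n : ℕ => (k n : ℝ) / n) Filter.atTop (nhds R) →
      Filter.Tendsto (fun n : ℕ => (hammingNorm (e n) : ℝ) / n) Filter.atTop
        (nhds (RLPN.deltaGV R)) →
      RLPN.IsComplexityExponent k e (RLPN.alphaDumer89 R) :=
  ⟨RLPN.isLeast_alphaDumer89 hR₀ hR₁, fun _ _ hkn hk he =>
    ⟨RLPN.exists_optimal hR₀ hR₁ hkn hk he, fun _ hp _ hε => RLPN.lower_bound hR₀ hR₁ hk he hp hε⟩⟩
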